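/- **Model.** Let $N\ge 2$, $\omega=e^{2\pi i/N}$, $n\ge1$, let $u,v,\varkappa,\theta\in\mathbb C$ be nonzero and $\alpha_-,\eta_-\in\mathbb C$. Let $\mathcal V=\mathcal V_1\otimes\cdots\otimes\mathcal V_n$, where $\mathcal V_k$ has basis $|\gamma\rangle_k$, $\gamma\in\mathbb Z_N$, and let $\mathbf v_k|\gamma\rangle_k=v\omega^\gamma|\gamma\rangle_k$, $\mathbf u_k|\gamma\rangle_k=u|\gamma-1\rangle_k$ (acting as the identity on the other factors). Put $$L_k(\lambda)=\begin{pmatrix}1+\frac{\varkappa}{\lambda}\mathbf v_k&-\frac1\lambda\mathbf u_k\\ \mathbf u_k^{-1}\mathbf v_k&0\end{pmatrix},\quad \widetilde L_k(\lambda)=\begin{pmatrix}\varkappa\lambda+\omega\theta\mathbf v_k^{-1}&-\theta\mathbf u_k^{-1}\\ \lambda\mathbf v_k^{-1}\mathbf u_k&0\end{pmatrix},\quad K_-(\lambda)=\begin{pmatrix}\alpha_-(\frac\theta\lambda-\lambda)&\eta_-\\ \eta_-&0\end{pmatrix},$$ and let $\mathcal C(\lambda)$, $\lambda\in\mathbb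 C\setminus\{0\}$, be the lower left entry of $\widetilde L_n(\lambda)\cdots\widetilde L_1(\lambda)K_-(\lambda)L_1(\lambda)\cdots L_n(\lambda)$. **Functions $w_p$.** For $p=(x,y)$ with $x^N+y^N=1$ and $y\ne0$ let $w_p:\mathbb Z_N\to\mathbb C$ be defined by $w_p(0)=1$, $w_p(s)/w_p(s-1)=y/(1-x\omega^s)$. All Fermat points below are assumed to have $y\neq 0$. **Open chain.** Let $v_{m,s}$ ($1\le s\le m\le n$) be amplitudes with $v_{1,1}=v$, and let $p_{m,s;m',s'}=(v_{m,s}/v_{m',s'},\,y_{m,s;m',s'})$ (for $m'=m$, $s\ne s'$, and for $m'=m+1$) be points of the Fermat curve $x^N+y^N=1$, such that for $2\le m\le n$ $$v_{m,1}\cdots v_{m,m}=v_{m-1,1}\cdots v_{m-1,m-1}\,v,\qquad \varkappa\prod_{s\ne l}\frac{y_{m-1,s;m-1,l}}{y_{m-1,l;m-1,s}}\,\frac{\prod_{k=1}^m y_{m-1,l;m,k}}{\prod_{s=1}^{m-2}y_{m-2,s;m-1,l}}=1\quad(1\le l\le m-1).$$ Define $|\boldsymbol\gamma_m\rangle\in\mathcal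 V_1\otimes\cdots\otimes\mathcal V_m$, $\boldsymbol\gamma_m\in(\mathbb Z_N)^m$, by $|\boldsymbol\gamma_1\rangle=|\gamma_{1,1}\rangle_1$ and $$|\boldsymbol\gamma_m\rangle=\sum_{\boldsymbol\gamma_{m-1}}\Bigl(\prod_{j\ne l}w_{p_{m-1,j;m-1,l}}(\gamma_{m-1,j}-\gamma_{m-1,l}-1)\Bigr)\frac{\omega^{\sum_l\gamma_{m-1,l}}}{\prod_{k=1}^m\prod_{l=1}^{m-1}w_{p_{m-1,l;m,k}}(\gamma_{m-1,l}-\gamma_{m,k}-1)}\,|\boldsymbol\gamma_{m-1}\rangle\otimes\Bigl|\sum_k\gamma_{m,k}-\sum_l\gamma_{m-1,l}\Bigr\rangle_m .$$ Let $h_r=u\prod_{l=1}^{n-1}y_{n-1,l;n,r}$. **One-boundary chain.** Let $s_1,\dots,s_n$ be nonzero, and let $p^B_{r,k}=(v_{n,r}/s_k,\,y^B_{r,k})$, $\tilde p^B_{r,k}=(\varkappa^2v_{n,r}s_k/(\omega\theta),\,\tilde y^B_{r,k})$ for $1\le r,k\le n$ and $\tilde p_{r,r'}=\tilde p_{r',r}=(\varkappa^2v_{n,r}v_{n,r'}/(\omega\theta),\,\tilde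 y_{r,r'})$ for $r\ne r'$ be points of the Fermat curve with $$\frac{\eta_-v_{n,r}^2}{\varkappa^{n-2}\omega^{n+1}\theta}\prod_{r'\ne r}\tilde y_{r,r'}=\alpha_-h_r\prod_{k=1}^ny^B_{r,k}\tilde y^B_{r,k},\qquad 1\le r\le n.$$ For $\boldsymbol\sigma\in(\mathbb Z_N)^n$ put $\Psi_{\boldsymbol\sigma}=\sum_{\boldsymbol\gamma_n}Q(\boldsymbol\gamma_n,\boldsymbol\sigma)|\boldsymbol\gamma_n\rangle$ with $$Q(\boldsymbol\gamma_n,\boldsymbol\sigma)=\prod_{r}\omega^{\gamma_{n,r}^2+\gamma_{n,r}}\prod_{k,r}w_{p^B_{r,k}}(\gamma_{n,r}-\sigma_k)\,w_{\tilde p^B_{r,k}}(\gamma_{n,r}+\sigma_k)\prod_{r<r'}\frac{v_{n,r}\omega^{\gamma_{n,r}}-v_{n,r'}\omega^{\gamma_{n,r'}}}{w_{\tilde p_{r,r'}}(\gamma_{n,r}+\gamma_{n,r'})},$$ $\lambda_k=-\varkappa s_k\omega^{\sigma_k}$ and $f_k=\prod_{r=1}^n\lambda_ky^B_{r,k}/\tilde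 y^B_{r,k}$. Let $\boldsymbol\sigma^{\pm k}$ be $\boldsymbol\sigma$ with $\sigma_k$ replaced by $\sigma_k\pm1$, and let $\sqrt\theta$ be either square root of $\theta$. **Claim.** For every $\boldsymbol\sigma\in(\mathbb Z_N)^n$: 1. For $k=1,\dots,n$, $$\mathcal C(\lambda_k)\Psi_{\boldsymbol\sigma}=\eta_-f_k\Psi_{\boldsymbol\sigma^{+k}},\qquad \mathcal C(\omega\theta/\lambda_k)\Psi_{\boldsymbol\sigma}=\eta_-(\omega\theta)^nf_k^{-1}\Psi_{\boldsymbol\sigma^{-k}}.$$ 2. $\mathcal C(\pm\sqrt\theta)\Psi_{\boldsymbol\sigma}=\eta_-(\pm\sqrt\theta)^n\Psi_{\boldsymbol\sigma}$. 3. $\mathcal C(\lambda)$ is a Laurent polynomial in $\lambda$ with operator coefficients and exponents between $-n$ and $n+1$. If the $2n+2$ points $\lambda_k$, $\omega\theta/\lambda_k$ $(1\le k\le n)$, $\pm\sqrt\theta$ are pairwise distinct, then for all $\lambda\ne0$ $$\mathcal C(\lambda)\Psi_{\boldsymbol\sigma}=\frac{\theta-\lambda^2}{\lambda}\sum_{k=1}^n\prod_{r\ne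 k}\frac{\lambda_k(\lambda-\lambda_r)(\omega\theta-\lambda\lambda_r)}{\lambda(\lambda_k-\lambda_r)(\omega\theta-\lambda_k\lambda_r)}\,\frac{\lambda_k}{\omega\theta-\lambda_k^2}\left(\frac{\omega\theta-\lambda\lambda_k}{\theta-\lambda_k^2}\,\mathcal C(\lambda_k)\Psi_{\boldsymbol\sigma}-\frac{\omega\lambda_k(\lambda-\lambda_k)}{\omega^2\theta-\lambda_k^2}\,\mathcal C(\omega\theta/\lambda_k)\Psi_{\boldsymbol\sigma}\right)$$ $$\qquad+\frac12\sum_{\epsilon=\pm1}\prod_{r=1}^n\frac{(\lambda-\lambda_r)(\omega\theta-\lambda\lambda_r)}{\lambda(\epsilon\sqrt\theta-\lambda_r)(\omega\epsilon\sqrt\theta-\lambda_r)}\,(1+\epsilon\lambda/\sqrt\theta)\,\mathcal C(\epsilon\sqrt\theta)\Psi_{\boldsymbol\sigma},$$ where the vectors $\mathcal C(\cdot)\Psi_{\boldsymbol\sigma}$ on the right-hand side are given by 1 and 2. -/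

import Mathlib

noncomputable section

namespace RTC

open Finset

/-- The primitive root of unity `ω = e^{2πi/N}`. -/
def omega (N : ℕ) : ℂ := Complex.exp (2 * Real.pi * Complex.I / N)

/-- The power `ω ^ γ` with an exponent `γ` in `ℤ/N`. -/
def wpow (N : ℕ) [NeZero N] (γ : ZMod N) : ℂ := omega N ^ γ.val

lemma omega_isPrimitiveRoot (N : ℕ) [NeZero N] : IsPrimitiveRoot (omega N) N :=
  Complex.isPrimitiveRoot_exp N (NeZero.ne N)

lemma wpow_natCast (N : ℕ) [NeZero N] (j : ℕ) : wpow N (j : ZMod N) = omega N ^ j := by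
  unfold wpow
  rw [ZMod.val_natCast]
  exact (pow_eq_pow_mod j (omega_isPrimitiveRoot N).pow_eq_one).symm

lemma wpow_add (N : ℕ) [NeZero N] (a b : ZMod N) :
    wpow N (a + b) = wpow N a * wpow N b := by
  conv_lhs => rw [← ZMod.natCast_zmod_val a, ← ZMod.natCast_zmod_val b, ← Nat.cast_add,
    wpow_natCast, pow_add]
  rfl

lemma wpow_ne_zero (N : ℕ) [NeZero N] (a : ZMod N) : wpow N a ≠ 0 :=
  pow_ne_zero _ (Complex.exp_ne_zero _)

/-! ### The function `w_p` on `ℤ/N` attached to a point of the Fermat curve -/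

/-- The function `w_p(s)` for a point `p = (x, y)` with `x ^ N + y ^ N = 1`, normalised by
`w_p(0) = 1` and satisfying `w_p(s) / w_p(s - 1) = y / (1 - x ω ^ s)`. -/
def wFun (N : ℕ) [NeZero N] (x y : ℂ) (s : ZMod N) : ℂ :=
  ∏ j ∈ Finset.Icc 1 s.val, y / (1 - x * omega N ^ j)

/-- A nondegenerate point of the Fermat curve. (If `y = 0`, some factor `1 - x ω ^ s`
vanishes and `w_p` does not exist.) -/
def FermatPoint (N : ℕ) (x y : ℂ) : Prop := x ^ N + y ^ N = 1 ∧ y ≠ 0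

lemma wFun_zero (N : ℕ) [NeZero N] (x y : ℂ) : wFun N x y 0 = 1 := by
  simp [wFun]

lemma one_sub_ne_zero_of_fermat {N : ℕ} [NeZero N] {x y : ℂ} (h : FermatPoint N x y) (j : ℕ) :
    1 - x * omega N ^ j ≠ 0 := by
  intro h0
  have h1 : x * omega N ^ j = 1 := (sub_eq_zero.mp h0).symm
  have h2 : x ^ N = 1 := by
    have := congrArg (· ^ N) h1
    simp only [mul_pow, one_pow] at this
    rwa [← pow_mul, mul_comm j N, pow_mul, (omega_isPrimitiveRoot N).pow_eq_one, one_pow,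
      mul_one] at this
  have h3 : y ^ N = 0 := by
    have := h.1
    rw [h2] at this
    simpa using this
  exact h.2 (pow_eq_zero_iff (NeZero.ne N) |>.mp h3)

/-- The full product over one period equals `1`; this is what makes `wFun` cyclic. -/
lemma prod_period {N : ℕ} [NeZero N] {x y : ℂ} (h : FermatPoint N x y) :
    ∏ j ∈ Finset.Icc 1 N, y / (1 - x * omega N ^ j) = 1 := by
  have hN : 0 < N := Nat.pos_of_ne_zero (NeZero.ne N)
  have key : ∏ j ∈ Finset.Icc 1 N, (1 - x * omega N ^ j) = 1 - x ^ N := by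
    have e1 := (omega_isPrimitiveRoot N).pow_sub_pow_eq_prod_sub_mul (1 : ℂ) x hN
    rw [one_pow] at e1
    rw [e1]
    refine Finset.prod_bij (fun j _ => omega N ^ j) ?_ ?_ ?_ ?_
    · intro j _
      rw [Polynomial.mem_nthRootsFinset hN, ← pow_mul, mul_comm, pow_mul,
        (omega_isPrimitiveRoot N).pow_eq_one, one_pow]
    · intro a ha b hb hab
      rw [Finset.mem_Icc] at ha hb
      have e2 : omega N ^ (a - 1) = omega N ^ (b - 1) := by
        have hne : omega N ≠ 0 := Complex.exp_ne_zero _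
        apply mul_right_cancel₀ hne
        rw [← pow_succ, ← pow_succ, Nat.sub_add_cancel ha.1, Nat.sub_add_cancel hb.1]
        exact hab
      have := (omega_isPrimitiveRoot N).pow_inj (by omega) (by omega) e2
      omega
    · intro ζ hζ
      rw [Polynomial.mem_nthRootsFinset hN] at hζ
      obtain ⟨i, hi, rfl⟩ := (omega_isPrimitiveRoot N).eq_pow_of_pow_eq_one hζ
      rcases Nat.eq_zero_or_pos i with rfl | hi0
      · exact ⟨N, Finset.mem_Icc.mpr ⟨hN, le_rfl⟩, by
          rw [(omega_isPrimitiveRoot N).pow_eq_one, pow_zero]⟩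
      · exact ⟨i, Finset.mem_Icc.mpr ⟨hi0, hi.le⟩, rfl⟩
    · intro j _
      ring
  rw [Finset.prod_div_distrib, key, Finset.prod_const, Nat.card_Icc, Nat.add_sub_cancel,
    show 1 - x ^ N = y ^ N by rw [← h.1, add_sub_cancel_left], div_self (pow_ne_zero _ h.2)]

/-- `wFun` satisfies the defining recursion of `w_p` for every `s` in `ℤ/N`. -/
lemma wFun_rec {N : ℕ} [NeZero N] {x y : ℂ} (h : FermatPoint N x y) (s : ZMod N) :
    wFun N x y s = y / (1 - x * wpow N s) * wFun N x y (s - 1) := by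
  by_cases hs : s = 0
  · subst hs
    have hN : 0 < N := Nat.pos_of_ne_zero (NeZero.ne N)
    have hv : ((0 : ZMod N) - 1).val = N - 1 := by
      rw [zero_sub]
      obtain ⟨m, rfl⟩ : ∃ m, N = m + 1 := ⟨N - 1, by omega⟩
      exact ZMod.val_neg_one m
    have hp := prod_period h
    obtain ⟨m, hm⟩ : ∃ m, N = m + 1 := ⟨N - 1, by omega⟩
    have hp' : (∏ j ∈ Finset.Icc 1 m, y / (1 - x * omega N ^ j)) *
        (y / (1 - x * omega N ^ (m + 1))) = 1 := by
      rw [← Finset.prod_Icc_succ_top (by omega)]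
      rw [← hm]
      exact hp
    rw [wFun_zero]
    unfold wFun
    rw [hv]
    have e : N - 1 = m := by omega
    rw [← hm, (omega_isPrimitiveRoot N).pow_eq_one] at hp'
    have hw : wpow N 0 = 1 := by simp [wpow]
    rw [e, hw, mul_comm, hp']
  · have hpos : 0 < s.val := Nat.pos_of_ne_zero fun h0 => hs ((ZMod.val_eq_zero s).mp h0)
    have hv : (s - 1).val = s.val - 1 := by
      have hlt : s.val - 1 < N := lt_of_le_of_lt (Nat.sub_le _ _) (ZMod.val_lt s)
      have : s - 1 = ((s.val - 1 : ℕ) : ZMod N) := by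
        rw [Nat.cast_sub (by omega)]
        simp
      rw [this, ZMod.val_natCast, Nat.mod_eq_of_lt hlt]
    unfold wFun wpow
    rw [hv]
    obtain ⟨m, hm⟩ : ∃ m, s.val = m + 1 := ⟨s.val - 1, by omega⟩
    rw [hm, Nat.add_sub_cancel, Finset.prod_Icc_succ_top (by omega), mul_comm]

/-! ### The space of states and the operators `u_k`, `v_k` -/

/-- The space `𝒱₁ ⊗ ⋯ ⊗ 𝒱ₙ`, realised by coordinates in the basis
`|c₁⟩ ⊗ ⋯ ⊗ |cₙ⟩`, `c ∈ (ℤ/N)ⁿ`. -/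
abbrev States (N n : ℕ) : Type := (Fin n → ZMod N) → ℂ

/-- The basis vector `|c₁⟩ ⊗ ⋯ ⊗ |cₙ⟩`. -/
def ket {N n : ℕ} (c : Fin n → ZMod N) : States N n := Pi.single c 1

/-- `v_k |…, γ_k, …⟩ = v ω ^ γ_k |…, γ_k, …⟩`. -/
def vOp (N n : ℕ) [NeZero N] (v : ℂ) (k : Fin n) : Module.End ℂ (States N n) where
  toFun f := fun c => v * wpow N (c k) * f c
  map_add' f g := by ext c; simp [mul_add]
  map_smul' a f := by ext c; simp; ring

/-- The inverse of `v_k` (for `v ≠ 0`). -/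
def vInv (N n : ℕ) [NeZero N] (v : ℂ) (k : Fin n) : Module.End ℂ (States N n) where
  toFun f := fun c => (v * wpow N (c k))⁻¹ * f c
  map_add' f g := by ext c; simp [mul_add]
  map_smul' a f := by ext c; simp; ring

/-- `u_k |…, γ_k, …⟩ = u |…, γ_k - 1, …⟩`. -/
def uOp (N n : ℕ) (u : ℂ) (k : Fin n) : Module.End ℂ (States N n) where
  toFun f := fun c => u * f (c + Pi.single k 1)
  map_add' f g := by ext c; simp [mul_add]
  map_smul' a f := by ext c; simp; ring

/-- The inverse of `u_k` (for `u ≠ 0`). -/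
def uInv (N n : ℕ) (u : ℂ) (k : Fin n) : Module.End ℂ (States N n) where
  toFun f := fun c => u⁻¹ * f (c - Pi.single k 1)
  map_add' f g := by ext c; simp [mul_add]
  map_smul' a f := by ext c; simp; ring

lemma vOp_ket (N n : ℕ) [NeZero N] (v : ℂ) (k : Fin n) (c : Fin n → ZMod N) :
    vOp N n v k (ket c) = (v * wpow N (c k)) • ket c := by
  ext d
  by_cases h : d = c
  · subst h; simp [vOp, ket]
  · simp [vOp, ket, h]

lemma uOp_ket (N n : ℕ) (u : ℂ) (k : Fin n) (c : Fin n → ZMod N) :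
    uOp N n u k (ket c) = u • ket (c - Pi.single k 1) := by
  ext d
  by_cases h : d + Pi.single k 1 = c
  · simp [uOp, ket, ← h]
  · have h' : d ≠ c - Pi.single k 1 := fun e => h (by rw [e]; simp)
    simp [uOp, ket, h, h']

lemma vOp_mul_vInv (N n : ℕ) [NeZero N] (v : ℂ) (hv : v ≠ 0) (k : Fin n) :
    vOp N n v k * vInv N n v k = 1 ∧ vInv N n v k * vOp N n v k = 1 := by
  constructor <;>
  · ext1 f
    ext c
    have := mul_ne_zero hv (wpow_ne_zero N (c k))
    simp [vOp, vInv]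
    field_simp [wpow_ne_zero N (c k)]

lemma uOp_mul_uInv (N n : ℕ) (u : ℂ) (hu : u ≠ 0) (k : Fin n) :
    uOp N n u k * uInv N n u k = 1 ∧ uInv N n u k * uOp N n u k = 1 := by
  constructor <;>
  · ext1 f
    ext c
    simp [uOp, uInv, hu]

/-! ### The `L`-operators and the boundary operator -/

/-- The `2 × 2` matrices with operator entries. -/
abbrev OpMatrix (N n : ℕ) : Type := Matrix (Fin 2) (Fin 2) (Module.End ℂ (States N n))

/-- The `L`-operator `L_k(lam)`. -/
def Lop (N n : ℕ) [NeZero N] (u v ϰ : ℂ) (lam : ℂ) (k : Fin n) : OpMatrix N n :=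
  !![1 + (ϰ / lam) • vOp N n v k, -((1 / lam) • uOp N n u k);
     uInv N n u k * vOp N n v k, 0]

/-- The twisted `L`-operator. -/
def LopTilde (N n : ℕ) [NeZero N] (u v ϰ θ : ℂ) (lam : ℂ) (k : Fin n) : OpMatrix N n :=
  !![(ϰ * lam) • 1 + (omega N * θ) • vInv N n v k, -(θ • uInv N n u k);
     lam • (vInv N n v k * uOp N n u k), 0]

/-- The boundary matrix `K_-(lam)` with `β_- = δ_- = 0`. -/
def Kminus (N n : ℕ) (θ α η : ℂ) (lam : ℂ) : OpMatrix N n :=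
  !![(α * (θ / lam - lam)) • 1, η • 1;
     η • 1, 0]

/-- `U(lam) = L̃ₙ(lam) ⋯ L̃₁(lam) K_-(lam) L₁(lam) ⋯ Lₙ(lam)`. -/
def Umat (N n : ℕ) [NeZero N] (u v ϰ θ α η : ℂ) (lam : ℂ) : OpMatrix N n :=
  (List.ofFn fun k : Fin n => LopTilde N n u v ϰ θ lam k.rev).prod *
    Kminus N n θ α η lam *
    (List.ofFn fun k : Fin n => Lop N n u v ϰ lam k).prod

/-- The boundary operator `𝒞(lam)`, the lower left entry of `U(lam)`. -/
def Cop (N n : ℕ) [NeZero N] (u v ϰ θ α η : ℂ) (lam : ℂ) : Module.End ℂ (States N n) :=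
  Umat N n u v ϰ θ α η lam 1 0

/-! ### Eigenvectors of the open chain

The amplitude `v_{m,s}` is `amp m s`, and the `y`-coordinate of the Fermat point with
`x`-coordinate `v_{m,s} / v_{m',s'}` is `y m s m' s'`; here `s : Fin m`, `s' : Fin m'`. -/

/-- The conditions defining the amplitudes and the Fermat points for the open chain. -/
structure IsOpenData (N n : ℕ) (v ϰ : ℂ) (amp : (m : ℕ) → Fin m → ℂ)
    (y : (m : ℕ) → Fin m → (m' : ℕ) → Fin m' → ℂ) : Prop where
  init : amp 1 0 = v
  prod_amp : ∀ m, 1 ≤ m → m < n → ∏ s, amp (m + 1) s = (∏ s, amp m s) * v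
  fermat_same : ∀ m, 1 ≤ m → m ≤ n → ∀ s s' : Fin m, s ≠ s' →
    FermatPoint N (amp m s / amp m s') (y m s m s')
  fermat_succ : ∀ m, 1 ≤ m → m < n → ∀ (s : Fin m) (s' : Fin (m + 1)),
    FermatPoint N (amp m s / amp (m + 1) s') (y m s (m + 1) s')
  rec_y : ∀ m, 1 ≤ m → m < n → ∀ l : Fin m,
    ϰ * (∏ s ∈ univ.erase l, y m s m l / y m l m s) *
      ((∏ k : Fin (m + 1), y m l (m + 1) k) / ∏ s : Fin (m - 1), y (m - 1) s m l) = 1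

/-- The factor `μ(γ_m)`. -/
def muCoef (N : ℕ) [NeZero N] (amp : (m : ℕ) → Fin m → ℂ)
    (y : (m : ℕ) → Fin m → (m' : ℕ) → Fin m' → ℂ) (m : ℕ) (γ : Fin m → ZMod N) : ℂ :=
  ∏ j : Fin m, ∏ l ∈ univ.erase j, wFun N (amp m j / amp m l) (y m j m l) (γ j - γ l - 1)

/-- The factor `Q(γ_m | γ_{m+1})`. -/
def QOpen (N : ℕ) [NeZero N] (amp : (m : ℕ) → Fin m → ℂ)
    (y : (m : ℕ) → Fin m → (m' : ℕ) → Fin m' → ℂ) (m : ℕ)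
    (γ : Fin m → ZMod N) (γ' : Fin (m + 1) → ZMod N) : ℂ :=
  wpow N (∑ l, γ l) /
    ∏ k : Fin (m + 1), ∏ l : Fin m,
      wFun N (amp m l / amp (m + 1) k) (y m l (m + 1) k) (γ l - γ' k - 1)

/-- The eigenvector `|γ_m⟩` of the open chain with `m` particles, by recursion on `m`:
`|γ_{m+1}⟩ = ∑ μ(γ_m) Q(γ_m | γ_{m+1}) |γ_m⟩ ⊗ |∑ γ_{m+1,k} - ∑ γ_{m,l}⟩`.
For `m = 1` the recursion gives the basis vector `|γ_{1,1}⟩`. -/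
def openVec (N : ℕ) [NeZero N] (amp : (m : ℕ) → Fin m → ℂ)
    (y : (m : ℕ) → Fin m → (m' : ℕ) → Fin m' → ℂ) :
    (m : ℕ) → (Fin m → ZMod N) → States N m
  | 0, _ => fun _ => 1
  | m + 1, γ' => fun c => ∑ γ : Fin m → ZMod N,
      muCoef N amp y m γ * QOpen N amp y m γ γ' *
        (openVec N amp y m γ (Fin.init c) *
          (if c (Fin.last m) = ∑ k, γ' k - ∑ l, γ l then 1 else 0))

/-- `h_r = u ∏_l y_{n-1,l;n,r}`. -/
def hCoef (n : ℕ) (u : ℂ) (y : (m : ℕ) → Fin m → (m' : ℕ) → Fin m' → ℂ) (r : Fin n) : ℂ :=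
  u * ∏ l : Fin (n - 1), y (n - 1) l n r

/-! ### Eigenvectors of the one-boundary chain -/

/-- The conditions defining the amplitudes `s_k` and the `y`-coordinates `yB r k`, `yBt r k`,
`yt r r'` of the Fermat points `p^B_{r,k}`, `p̃^B_{r,k}`, `p̃_{r,r'}`. -/
structure IsBoundaryData (N n : ℕ) (u ϰ θ α η : ℂ) (amp : (m : ℕ) → Fin m → ℂ)
    (y : (m : ℕ) → Fin m → (m' : ℕ) → Fin m' → ℂ) (s : Fin n → ℂ)
    (yB yBt yt : Fin n → Fin n → ℂ) : Prop where
  s_ne_zero : ∀ k, s k ≠ 0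
  fermat_B : ∀ r k, FermatPoint N (amp n r / s k) (yB r k)
  fermat_Bt : ∀ r k, FermatPoint N (ϰ ^ 2 * amp n r * s k / (omega N * θ)) (yBt r k)
  fermat_t : ∀ r r', r ≠ r' →
    FermatPoint N (ϰ ^ 2 * amp n r * amp n r' / (omega N * θ)) (yt r r')
  yt_symm : ∀ r r', yt r r' = yt r' r
  eq_y : ∀ r, η * amp n r ^ 2 / (ϰ ^ ((n : ℤ) - 2) * omega N ^ (n + 1) * θ) *
      ∏ r' ∈ univ.erase r, yt r r' =
    α * hCoef n u y r * ∏ k, yB r k * yBt r k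

/-- The coefficient `Q(γ_n, σ)`. -/
def QBoundary (N n : ℕ) [NeZero N] (ϰ θ : ℂ) (amp : (m : ℕ) → Fin m → ℂ) (s : Fin n → ℂ)
    (yB yBt yt : Fin n → Fin n → ℂ) (γ σ : Fin n → ZMod N) : ℂ :=
  (∏ r, wpow N (γ r ^ 2 + γ r)) *
    (∏ k, ∏ r, wFun N (amp n r / s k) (yB r k) (γ r - σ k) *
      wFun N (ϰ ^ 2 * amp n r * s k / (omega N * θ)) (yBt r k) (γ r + σ k)) *
    ∏ r, ∏ r' ∈ univ.filter (fun r' => r < r'),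
      (amp n r * wpow N (γ r) - amp n r' * wpow N (γ r')) /
        wFun N (ϰ ^ 2 * amp n r * amp n r' / (omega N * θ)) (yt r r') (γ r + γ r')

/-- The vector `Ψ_σ`. -/
def Psi (N n : ℕ) [NeZero N] (ϰ θ : ℂ) (amp : (m : ℕ) → Fin m → ℂ)
    (y : (m : ℕ) → Fin m → (m' : ℕ) → Fin m' → ℂ) (s : Fin n → ℂ)
    (yB yBt yt : Fin n → Fin n → ℂ) (σ : Fin n → ZMod N) : States N n :=
  ∑ γ : Fin n → ZMod N, QBoundary N n ϰ θ amp s yB yBt yt γ σ • openVec N amp y n γ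

/-- `λ_k = -ϰ s_k ω ^ σ_k`. -/
def lamB (N n : ℕ) [NeZero N] (ϰ : ℂ) (s : Fin n → ℂ) (σ : Fin n → ZMod N) (k : Fin n) : ℂ :=
  -ϰ * s k * wpow N (σ k)

/-- `f_k = ∏_r λ_k y^B_{r,k} / ỹ^B_{r,k}`. -/
def fCoef (N n : ℕ) [NeZero N] (ϰ : ℂ) (s : Fin n → ℂ) (yB yBt : Fin n → Fin n → ℂ)
    (σ : Fin n → ZMod N) (k : Fin n) : ℂ :=
  ∏ r, lamB N n ϰ s σ k * yB r k / yBt r k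

/-- The interpolation formula in the `2n + 2` points `L k`, `ωθ / L k`, `±ρ` (`ρ ^ 2 = θ`), with
prescribed values `X k`, `Y k` and `Z (±1)`. -/
def interp (N n : ℕ) (θ ρ : ℂ) (L : Fin n → ℂ) {V : Type*} [AddCommGroup V] [Module ℂ V]
    (X Y : Fin n → V) (Z : ℂ → V) (lam : ℂ) : V :=
  ((θ - lam ^ 2) / lam) • (∑ k,
    ((∏ r ∈ univ.erase k, L k * (lam - L r) * (omega N * θ - lam * L r) /
        (lam * (L k - L r) * (omega N * θ - L k * L r))) *
      (L k / (omega N * θ - L k ^ 2))) •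
      (((omega N * θ - lam * L k) / (θ - L k ^ 2)) • X k -
        (omega N * L k * (lam - L k) / (omega N ^ 2 * θ - L k ^ 2)) • Y k)) +
  (1 / 2 : ℂ) • ∑ ε ∈ ({1, -1} : Finset ℂ),
    ((∏ r, (lam - L r) * (omega N * θ - lam * L r) /
        (lam * (ε * ρ - L r) * (omega N * ε * ρ - L r))) *
      (1 + ε * lam / ρ)) • Z ε

end RTC

end

/-! Write A, B, C, D for the entries of the open monodromy matrix `Tmat`, and 𝒜, 𝒞 for the left
column of `Umat`. The strategy is separation of variables: in a basis diagonalising A, the operator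
𝒜 becomes a difference operator, and Ψ_σ is built so that 𝒜 annihilates it at λ_k and ωθ/λ_k. A
quadratic relation then yields 𝒞 at these points.

Open chain (`Tmat_openVec_aux`). By induction on the number of sites, |γ⟩ is an eigenvector of A(x)
with eigenvalue ∏(1 - λ_s(γ)/x), where λ_s(γ) is `lamB` for the open amplitudes. The recursion of
w_p turns the shifts caused by B into residues, which a partial fraction identity sums to the new
eigenvalue. B and C are known at the zeros of that eigenvalue, where they act as pure shifts (B
directly, C through `quantum_det`), and Lagrange interpolation gives them everywhere. The
eigenvalues separate the labels γ, so the |γ⟩ form a basis and A(x) is invertible wherever its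
eigenvalues do not vanish.

Boundary. Since L̃ is a signed transpose of L (`LopTilde_eq`), 𝒜(x) is quadratic in A and C
(`Umat_zero_zero`). On the basis it has a diagonal part and shifts γ ↦ γ + e_r. Apart from a common
scalar factor, its coefficients depend on x only through z(x) = 1/x + x/(ωθ), called `zB`. The
recursion `QBoundary_rec` for the coefficients of Ψ_σ makes the shifted terms the partial fraction
expansion of ∏_k (z - z(λ_k)) - ∏_t (z - z(λ_t(γ))). Hence 𝒜(x)Ψ_σ is proportional to ∏_k (z(x) -
z(λ_k)) in every component and vanishes at x = λ_k and x = ωθ/λ_k (`Umat_zero_zero_Psi`).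

The identity `row_mul_Umat`, B(θ/x)𝒜(x) + A(θ/x)𝒞(x) = ηxⁿA(x), reduces at such x to A(θ/x)𝒞(x)Ψ_σ =
ηxⁿA(x)Ψ_σ. Both A's are diagonal, and `QBoundary_add_single` shows that the ratio of their
eigenvalues is absorbed by a shift of σ_k and the constant f_k. At x² = θ the whole matrix U(x) is
an antidiagonal scalar matrix. Finally 𝒞 has 2n + 2 Laurent coefficients, so its values at 2n + 2
distinct points determine it (`LaurentOn.eq_interp`). -/

noncomputable section
namespace RTC
open Finset

/-! ### Adding one site to the chain -/

section Lift

variable {N m : ℕ}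

/-- An operator on the first `m` sites of a chain with `m + 1` sites. -/
def liftEnd (N m : ℕ) :
    Module.End ℂ (States N m) →ₐ[ℂ] Module.End ℂ (States N (m + 1)) where
  toFun X :=
    { toFun := fun f c =>
        X (fun c' => f (Fin.snoc (α := fun _ => ZMod N) c' (c (Fin.last m)))) (Fin.init c)
      map_add' := fun f g => by
        ext c
        exact congrFun (X.map_add (fun c' => f (Fin.snoc (α := fun _ => ZMod N) c' _))
          (fun c' => g (Fin.snoc (α := fun _ => ZMod N) c' _))) (Fin.init c)
      map_smul' := fun a f => by
        ext c
        exact congrFun (X.map_smul a (fun c' => f (Fin.snoc (α := fun _ => ZMod N) c' _)))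
          (Fin.init c) }
  map_one' := by
    refine LinearMap.ext fun f => funext fun c => ?_
    simp [Fin.snoc_init_self]
  map_mul' X Y := by
    refine LinearMap.ext fun f => funext fun c => ?_
    simp [Fin.snoc_last, Fin.init_snoc]
  map_zero' := rfl
  map_add' X Y := rfl
  commutes' a := by
    refine LinearMap.ext fun f => funext fun c => ?_
    simp [Algebra.algebraMap_eq_smul_one, Fin.snoc_init_self]

lemma liftEnd_apply (X : Module.End ℂ (States N m)) (f : States N (m + 1))
    (c : Fin (m + 1) → ZMod N) :
    liftEnd N m X f c =
      X (fun c' => f (Fin.snoc (α := fun _ => ZMod N) c' (c (Fin.last m)))) (Fin.init c) := rfl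

/-- The vector `g ⊗ |d⟩`. -/
def tens (g : States N m) (d : ZMod N) : States N (m + 1) :=
  fun c => g (Fin.init c) * if c (Fin.last m) = d then 1 else 0

lemma tens_smul (a : ℂ) (g : States N m) (d : ZMod N) : tens (a • g) d = a • tens g d := by
  ext c; simp [tens]

lemma tens_sum {ι : Type*} (s : Finset ι) (g : ι → States N m) (d : ZMod N) :
    tens (∑ i ∈ s, g i) d = ∑ i ∈ s, tens (g i) d := by
  ext c; simp [tens]

lemma liftEnd_tens (X : Module.End ℂ (States N m)) (g : States N m) (d : ZMod N) :
    liftEnd N m X (tens g d) = tens (X g) d := by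
  ext c
  rw [liftEnd_apply]
  by_cases h : c (Fin.last m) = d
  · simp [tens, h]
  · have : (fun c' : Fin m → ZMod N =>
        tens g d (Fin.snoc (α := fun _ => ZMod N) c' (c (Fin.last m)))) = 0 := by
      ext c'; simp [tens, h]
    rw [this]; simp [tens, h]

lemma init_add_single_last (c : Fin (m + 1) → ZMod N) (a : ZMod N) :
    Fin.init (α := fun _ => ZMod N) (c + Pi.single (Fin.last m) a) = Fin.init c := by
  ext i
  simp [Fin.init, (Fin.castSucc_lt_last i).ne]

lemma init_sub_single_last (c : Fin (m + 1) → ZMod N) (a : ZMod N) :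
    Fin.init (α := fun _ => ZMod N) (c - Pi.single (Fin.last m) a) = Fin.init c := by
  ext i
  simp [Fin.init, (Fin.castSucc_lt_last i).ne]

lemma snoc_add_single (c : Fin m → ZMod N) (d a : ZMod N) (k : Fin m) :
    Fin.snoc (α := fun _ => ZMod N) (c + Pi.single k a) d =
      Fin.snoc (α := fun _ => ZMod N) c d + Pi.single k.castSucc a := by
  ext i
  refine Fin.lastCases ?_ (fun j => ?_) i
  · simp [(Fin.castSucc_lt_last k).ne']
  · simp [Pi.single_apply]

lemma snoc_sub_single (c : Fin m → ZMod N) (d a : ZMod N) (k : Fin m) :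
    Fin.snoc (α := fun _ => ZMod N) (c - Pi.single k a) d =
      Fin.snoc (α := fun _ => ZMod N) c d - Pi.single k.castSucc a := by
  ext i
  refine Fin.lastCases ?_ (fun j => ?_) i
  · simp [(Fin.castSucc_lt_last k).ne']
  · simp [Pi.single_apply]

lemma uOp_tens (u : ℂ) (g : States N m) (d : ZMod N) :
    uOp N (m + 1) u (Fin.last m) (tens g d) = u • tens g (d - 1) := by
  ext c
  simp [uOp, tens, init_add_single_last, eq_sub_iff_add_eq]

lemma uInv_tens (u : ℂ) (g : States N m) (d : ZMod N) :
    uInv N (m + 1) u (Fin.last m) (tens g d) = u⁻¹ • tens g (d + 1) := by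
  ext c
  simp [uInv, tens, init_sub_single_last, sub_eq_iff_eq_add]

lemma liftEnd_uOp (u : ℂ) (k : Fin m) :
    liftEnd N m (uOp N m u k) = uOp N (m + 1) u k.castSucc := by
  refine LinearMap.ext fun f => funext fun c => ?_
  simp [liftEnd_apply, uOp, snoc_add_single, Fin.snoc_init_self]

lemma liftEnd_uInv (u : ℂ) (k : Fin m) :
    liftEnd N m (uInv N m u k) = uInv N (m + 1) u k.castSucc := by
  refine LinearMap.ext fun f => funext fun c => ?_
  simp [liftEnd_apply, uInv, snoc_sub_single, Fin.snoc_init_self]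

lemma uOp_mul_liftEnd (u : ℂ) (X : Module.End ℂ (States N m)) :
    uOp N (m + 1) u (Fin.last m) * liftEnd N m X =
      liftEnd N m X * uOp N (m + 1) u (Fin.last m) := by
  refine LinearMap.ext fun f => funext fun c => ?_
  have := congrFun (X.map_smul u (fun c' => f (Fin.snoc (α := fun _ => ZMod N) c'
    (c (Fin.last m) + 1)))) (Fin.init c)
  have e : ∀ c' : Fin m → ZMod N, Fin.snoc (α := fun _ => ZMod N) c' (c (Fin.last m)) +
      Pi.single (Fin.last m) 1 = Fin.snoc (α := fun _ => ZMod N) c' (c (Fin.last m) + 1) := by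
    intro c'
    ext i
    refine Fin.lastCases ?_ (fun j => ?_) i
    · simp
    · simp [(Fin.castSucc_lt_last j).ne]
  simp only [Module.End.mul_apply, liftEnd_apply, uOp, LinearMap.coe_mk, AddHom.coe_mk, e,
    init_add_single_last]
  simp only [Pi.add_apply, Pi.single_eq_same]
  exact this.symm

lemma uInv_mul_liftEnd (u : ℂ) (X : Module.End ℂ (States N m)) :
    uInv N (m + 1) u (Fin.last m) * liftEnd N m X =
      liftEnd N m X * uInv N (m + 1) u (Fin.last m) := by
  refine LinearMap.ext fun f => funext fun c => ?_
  have := congrFun (X.map_smul u⁻¹ (fun c' => f (Fin.snoc (α := fun _ => ZMod N) c'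
    (c (Fin.last m) - 1)))) (Fin.init c)
  have e : ∀ c' : Fin m → ZMod N, Fin.snoc (α := fun _ => ZMod N) c' (c (Fin.last m)) -
      Pi.single (Fin.last m) 1 = Fin.snoc (α := fun _ => ZMod N) c' (c (Fin.last m) - 1) := by
    intro c'
    ext i
    refine Fin.lastCases ?_ (fun j => ?_) i
    · simp
    · simp [(Fin.castSucc_lt_last j).ne]
  simp only [Module.End.mul_apply, liftEnd_apply, uInv, LinearMap.coe_mk, AddHom.coe_mk, e,
    init_sub_single_last]
  simp only [Pi.sub_apply, Pi.single_eq_same]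
  exact this.symm

variable [NeZero N]

lemma vOp_tens (v : ℂ) (g : States N m) (d : ZMod N) :
    vOp N (m + 1) v (Fin.last m) (tens g d) = (v * wpow N d) • tens g d := by
  ext c
  by_cases h : c (Fin.last m) = d <;> simp [vOp, tens, h]

lemma liftEnd_vOp (v : ℂ) (k : Fin m) :
    liftEnd N m (vOp N m v k) = vOp N (m + 1) v k.castSucc := by
  refine LinearMap.ext fun f => funext fun c => ?_
  simp [liftEnd_apply, vOp, Fin.init, Fin.snoc_init_self]

lemma liftEnd_vInv (v : ℂ) (k : Fin m) :
    liftEnd N m (vInv N m v k) = vInv N (m + 1) v k.castSucc := by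
  refine LinearMap.ext fun f => funext fun c => ?_
  simp [liftEnd_apply, vInv, Fin.init, Fin.snoc_init_self]

lemma vOp_mul_liftEnd (v : ℂ) (X : Module.End ℂ (States N m)) :
    vOp N (m + 1) v (Fin.last m) * liftEnd N m X =
      liftEnd N m X * vOp N (m + 1) v (Fin.last m) := by
  refine LinearMap.ext fun f => funext fun c => ?_
  have := congrFun (X.map_smul (v * wpow N (c (Fin.last m)))
    (fun c' => f (Fin.snoc (α := fun _ => ZMod N) c' (c (Fin.last m))))) (Fin.init c)
  simp only [Module.End.mul_apply, liftEnd_apply, vOp, LinearMap.coe_mk, AddHom.coe_mk,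
    Fin.snoc_last]
  exact this.symm

lemma vInv_mul_liftEnd (v : ℂ) (X : Module.End ℂ (States N m)) :
    vInv N (m + 1) v (Fin.last m) * liftEnd N m X =
      liftEnd N m X * vInv N (m + 1) v (Fin.last m) := by
  refine LinearMap.ext fun f => funext fun c => ?_
  have := congrFun (X.map_smul (v * wpow N (c (Fin.last m)))⁻¹
    (fun c' => f (Fin.snoc (α := fun _ => ZMod N) c' (c (Fin.last m))))) (Fin.init c)
  simp only [Module.End.mul_apply, liftEnd_apply, vInv, LinearMap.coe_mk, AddHom.coe_mk,
    Fin.snoc_last]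
  exact this.symm

end Lift

lemma omega_ne_zero (N : ℕ) : omega N ≠ 0 := Complex.exp_ne_zero _

/-! ### Powers of ω with exponents in ℤ/N -/

section Commutation

variable {N : ℕ} [NeZero N]

lemma wpow_zero : wpow N 0 = 1 := by simp [wpow]

lemma wpow_one : wpow N 1 = omega N := by
  have := wpow_natCast N 1
  simpa using this

lemma wpow_neg (a : ZMod N) : wpow N (-a) = (wpow N a)⁻¹ := by
  apply eq_inv_of_mul_eq_one_left
  rw [← wpow_add, neg_add_cancel, wpow_zero]

lemma wpow_sub (a b : ZMod N) : wpow N (a - b) = wpow N a / wpow N b := by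
  rw [sub_eq_add_neg, wpow_add, wpow_neg, div_eq_mul_inv]

lemma wpow_sum {ι : Type*} (s : Finset ι) (g : ι → ZMod N) :
    wpow N (∑ i ∈ s, g i) = ∏ i ∈ s, wpow N (g i) := by
  classical
  induction s using Finset.induction_on with
  | empty => simp [wpow_zero]
  | insert a s ha ih => rw [Finset.sum_insert ha, Finset.prod_insert ha, wpow_add, ih]

lemma wpow_injective : Function.Injective (wpow N) := by
  intro a b h
  exact ZMod.val_injective N
    ((omega_isPrimitiveRoot N).pow_inj (ZMod.val_lt a) (ZMod.val_lt b) h)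

variable {n : ℕ}

end Commutation
end RTC
end
noncomputable section
namespace RTC
open Finset

/-! ### Monodromy matrices -/

section Monodromy

variable {N : ℕ} [NeZero N] {m : ℕ}

/-- The monodromy matrix `L₁(lam) ⋯ L_m(lam)`. -/
def Tmat (N : ℕ) [NeZero N] (u v ϰ : ℂ) (m : ℕ) (lam : ℂ) : OpMatrix N m :=
  (List.ofFn fun k : Fin m => Lop N m u v ϰ lam k).prod

/-- The twisted monodromy matrix `L̃_m(lam) ⋯ L̃₁(lam)`. -/
def TmatTilde (N : ℕ) [NeZero N] (u v ϰ θ : ℂ) (m : ℕ) (lam : ℂ) : OpMatrix N m :=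
  (List.ofFn fun k : Fin m => LopTilde N m u v ϰ θ lam k.rev).prod

lemma Umat_eq (u v ϰ θ α η lam : ℂ) (n : ℕ) :
    Umat N n u v ϰ θ α η lam =
      TmatTilde N u v ϰ θ n lam * Kminus N n θ α η lam * Tmat N u v ϰ n lam := rfl

lemma liftEnd_Lop (u v ϰ lam : ℂ) (k : Fin m) :
    (liftEnd N m).mapMatrix (Lop N m u v ϰ lam k) = Lop N (m + 1) u v ϰ lam k.castSucc := by
  ext i j : 2
  fin_cases i <;> fin_cases j <;>
    simp [Lop, liftEnd_uOp, liftEnd_vOp, liftEnd_uInv, AlgHom.mapMatrix_apply]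

lemma liftEnd_LopTilde (u v ϰ θ lam : ℂ) (k : Fin m) :
    (liftEnd N m).mapMatrix (LopTilde N m u v ϰ θ lam k) =
      LopTilde N (m + 1) u v ϰ θ lam k.castSucc := by
  ext i j : 2
  fin_cases i <;> fin_cases j <;>
    simp [LopTilde, liftEnd_uOp, liftEnd_vInv, liftEnd_uInv, AlgHom.mapMatrix_apply]

lemma Tmat_succ (u v ϰ lam : ℂ) :
    Tmat N u v ϰ (m + 1) lam =
      (liftEnd N m).mapMatrix (Tmat N u v ϰ m lam) * Lop N (m + 1) u v ϰ lam (Fin.last m) := by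
  unfold Tmat
  rw [List.ofFn_succ', List.concat_eq_append, List.prod_append, List.prod_singleton,
    map_list_prod, List.map_ofFn]
  congr 4
  ext1 k
  exact (liftEnd_Lop u v ϰ lam k).symm

lemma TmatTilde_succ (u v ϰ θ lam : ℂ) :
    TmatTilde N u v ϰ θ (m + 1) lam =
      LopTilde N (m + 1) u v ϰ θ lam (Fin.last m) *
        (liftEnd N m).mapMatrix (TmatTilde N u v ϰ θ m lam) := by
  unfold TmatTilde
  rw [List.ofFn_succ, List.prod_cons, map_list_prod, List.map_ofFn, Fin.rev_zero]
  congr 3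
  ext1 k
  rw [Function.comp_apply, Fin.rev_succ]
  exact (liftEnd_LopTilde u v ϰ θ lam k.rev).symm

lemma Tmat_zero (u v ϰ lam : ℂ) : Tmat N u v ϰ 0 lam = 1 := by simp [Tmat]

lemma TmatTilde_zero (u v ϰ θ lam : ℂ) : TmatTilde N u v ϰ θ 0 lam = 1 := by simp [TmatTilde]

lemma Tmat_succ_apply (u v ϰ lam : ℂ) (i j : Fin 2) :
    Tmat N u v ϰ (m + 1) lam i j =
      liftEnd N m (Tmat N u v ϰ m lam i 0) * Lop N (m + 1) u v ϰ lam (Fin.last m) 0 j +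
      liftEnd N m (Tmat N u v ϰ m lam i 1) * Lop N (m + 1) u v ϰ lam (Fin.last m) 1 j := by
  rw [Tmat_succ, Matrix.mul_apply, Fin.sum_univ_two]
  rfl

lemma TmatTilde_succ_apply (u v ϰ θ lam : ℂ) (i j : Fin 2) :
    TmatTilde N u v ϰ θ (m + 1) lam i j =
      LopTilde N (m + 1) u v ϰ θ lam (Fin.last m) i 0 *
        liftEnd N m (TmatTilde N u v ϰ θ m lam 0 j) +
      LopTilde N (m + 1) u v ϰ θ lam (Fin.last m) i 1 *
        liftEnd N m (TmatTilde N u v ϰ θ m lam 1 j) := by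
  rw [TmatTilde_succ, Matrix.mul_apply, Fin.sum_univ_two]
  rfl

/-- Because the lower right entry of L vanishes, the right column on m + 1 sites comes from the left
column on m sites. This is how B is obtained from A of the shorter chain. -/
lemma Tmat_succ_zero_one (u v ϰ lam : ℂ) (i : Fin 2) :
    Tmat N u v ϰ (m + 1) lam i 1 =
      -(1 / lam) • (liftEnd N m (Tmat N u v ϰ m lam i 0) * uOp N (m + 1) u (Fin.last m)) := by
  rw [Tmat_succ_apply]
  refine LinearMap.ext fun f => ?_
  simp [Lop]

/-- Operators on different sites commute, so the last factor can be moved past the shorter chain in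
every induction on the length. -/
lemma commute_Lop_liftEnd (u v ϰ lam : ℂ) (i j : Fin 2) (X : Module.End ℂ (States N m)) :
    Commute (Lop N (m + 1) u v ϰ lam (Fin.last m) i j) (liftEnd N m X) := by
  have hu : Commute (uOp N (m + 1) u (Fin.last m)) (liftEnd N m X) := uOp_mul_liftEnd u X
  have hv : Commute (vOp N (m + 1) v (Fin.last m)) (liftEnd N m X) := vOp_mul_liftEnd v X
  have hi : Commute (uInv N (m + 1) u (Fin.last m)) (liftEnd N m X) := uInv_mul_liftEnd u X
  fin_cases i <;> fin_cases j
  · exact (Commute.one_left _).add_left (hv.smul_left _)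
  · exact (hu.smul_left _).neg_left
  · exact hi.mul_left hv
  · exact Commute.zero_left _

/-! ### Quadratic relations -/

/-- `b p + a r = 0` for the entries of `L(θ/lam)` and `L̃(lam)`. -/
lemma Lop_mul_LopTilde_zero (u v ϰ θ lam : ℂ) (hv : v ≠ 0) (hθ : θ ≠ 0) (k : Fin m) :
    Lop N m u v ϰ (θ / lam) k 0 1 * LopTilde N m u v ϰ θ lam k 0 0 +
      Lop N m u v ϰ (θ / lam) k 0 0 * LopTilde N m u v ϰ θ lam k 1 0 = 0 := by
  refine LinearMap.ext fun f => funext fun c => ?_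
  have h1 := wpow_ne_zero N (c k)
  have h2 := omega_ne_zero N
  simp [Lop, LopTilde, uOp, vOp, vInv, wpow_add, wpow_one]
  field_simp
  ring

lemma Lop_mul_LopTilde_one (u v ϰ θ lam : ℂ) (hu : u ≠ 0) (hv : v ≠ 0) (k : Fin m) :
    Lop N m u v ϰ (θ / lam) k 1 0 * LopTilde N m u v ϰ θ lam k 1 0 = lam • 1 := by
  refine LinearMap.ext fun f => funext fun c => ?_
  have h1 := wpow_ne_zero N (c k)
  have h2 := omega_ne_zero N
  simp [Lop, LopTilde, uOp, vOp, vInv, uInv, wpow_sub, wpow_one]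
  field_simp
  simp

lemma Lop_mul_LopTilde_two (u v ϰ θ lam : ℂ) (hu : u ≠ 0) (hθ : θ ≠ 0) (hl : lam ≠ 0)
    (k : Fin m) :
    Lop N m u v ϰ (θ / lam) k 0 1 * LopTilde N m u v ϰ θ lam k 0 1 = lam • 1 := by
  refine LinearMap.ext fun f => funext fun c => ?_
  simp [Lop, LopTilde, uOp, uInv]
  field_simp

/-- `(B(θ/lam), A(θ/lam)) T̃(lam) = lam ^ m (0, 1)`. -/
lemma row_mul_TmatTilde (u v ϰ θ lam : ℂ) (hu : u ≠ 0) (hv : v ≠ 0) (hθ : θ ≠ 0)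
    (hl : lam ≠ 0) : ∀ (m : ℕ) (j : Fin 2),
    Tmat N u v ϰ m (θ / lam) 0 1 * TmatTilde N u v ϰ θ m lam 0 j +
      Tmat N u v ϰ m (θ / lam) 0 0 * TmatTilde N u v ϰ θ m lam 1 j =
      if j = 0 then 0 else lam ^ m • 1
  | 0, j => by fin_cases j <;> simp [Tmat_zero, TmatTilde_zero]
  | m + 1, j => by
    -- Multiplying the row (B, A) of length m + 1 by the last L̃ returns lam times the row (B, A) of
    -- length m. The induction removes one site at a time.
    have h1 : Tmat N u v ϰ (m + 1) (θ / lam) 0 1 *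
          LopTilde N (m + 1) u v ϰ θ lam (Fin.last m) 0 0 +
        Tmat N u v ϰ (m + 1) (θ / lam) 0 0 *
          LopTilde N (m + 1) u v ϰ θ lam (Fin.last m) 1 0 =
        lam • liftEnd N m (Tmat N u v ϰ m (θ / lam) 0 1) := by
      have e : Lop N (m + 1) u v ϰ (θ / lam) (Fin.last m) 1 1 = 0 := rfl
      rw [Tmat_succ_apply, Tmat_succ_apply, e, mul_zero, add_zero, add_mul, mul_assoc, mul_assoc,
        mul_assoc, ← add_assoc, ← mul_add, Lop_mul_LopTilde_zero u v ϰ θ lam hv hθ,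
        Lop_mul_LopTilde_one u v ϰ θ lam hu hv]
      simp
    have h2 : Tmat N u v ϰ (m + 1) (θ / lam) 0 1 *
          LopTilde N (m + 1) u v ϰ θ lam (Fin.last m) 0 1 +
        Tmat N u v ϰ (m + 1) (θ / lam) 0 0 *
          LopTilde N (m + 1) u v ϰ θ lam (Fin.last m) 1 1 =
        lam • liftEnd N m (Tmat N u v ϰ m (θ / lam) 0 0) := by
      have e : Lop N (m + 1) u v ϰ (θ / lam) (Fin.last m) 1 1 = 0 := rfl
      have e' : LopTilde N (m + 1) u v ϰ θ lam (Fin.last m) 1 1 = 0 := rfl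
      rw [Tmat_succ_apply, e, e', mul_zero, mul_zero, add_zero, add_zero, mul_assoc,
        Lop_mul_LopTilde_two u v ϰ θ lam hu hθ hl]
      simp
    have ih := congrArg (liftEnd N m) (row_mul_TmatTilde u v ϰ θ lam hu hv hθ hl m j)
    rw [map_add, map_mul, map_mul] at ih
    rw [TmatTilde_succ_apply, TmatTilde_succ_apply, mul_add, mul_add, add_add_add_comm,
      ← mul_assoc, ← mul_assoc, ← mul_assoc, ← mul_assoc, ← add_mul, ← add_mul, h1, h2,
      smul_mul_assoc, smul_mul_assoc, ← smul_add, ih]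
    split_ifs
    · simp
    · simp [pow_succ', mul_smul]

/-- `B(θ/lam) 𝒜(lam) + A(θ/lam) 𝒞(lam) = η lam ^ n A(lam)`. -/
lemma row_mul_Umat (u v ϰ θ α η lam : ℂ) (hu : u ≠ 0) (hv : v ≠ 0) (hθ : θ ≠ 0)
    (hl : lam ≠ 0) (n : ℕ) :
    Tmat N u v ϰ n (θ / lam) 0 1 * Umat N n u v ϰ θ α η lam 0 0 +
      Tmat N u v ϰ n (θ / lam) 0 0 * Umat N n u v ϰ θ α η lam 1 0 =
      (η * lam ^ n) • Tmat N u v ϰ n lam 0 0 := by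
  have h0 := row_mul_TmatTilde (N := N) u v ϰ θ lam hu hv hθ hl n 0
  have h1 := row_mul_TmatTilde (N := N) u v ϰ θ lam hu hv hθ hl n 1
  simp only [if_true, one_ne_zero, if_false] at h0 h1
  rw [Umat_eq, mul_assoc]
  simp only [Matrix.mul_apply (M := TmatTilde N u v ϰ θ n lam), Fin.sum_univ_two]
  rw [mul_add, mul_add, add_add_add_comm, ← mul_assoc, ← mul_assoc, ← mul_assoc, ← mul_assoc,
    ← add_mul, ← add_mul, h0, h1]
  simp [Matrix.mul_apply, Fin.sum_univ_two, Kminus, mul_smul, smul_comm η]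

/-- The product `v₁ ⋯ v_m`. -/
def vTot (N : ℕ) [NeZero N] (v : ℂ) (m : ℕ) : Module.End ℂ (States N m) where
  toFun f := fun c => v ^ m * wpow N (∑ k, c k) * f c
  map_add' f g := by ext c; simp [mul_add]
  map_smul' a f := by ext c; simp; ring

/-- The product `v₁⁻¹ ⋯ v_m⁻¹`. -/
def vTotInv (N : ℕ) [NeZero N] (v : ℂ) (m : ℕ) : Module.End ℂ (States N m) where
  toFun f := fun c => (v ^ m * wpow N (∑ k, c k))⁻¹ * f c
  map_add' f g := by ext c; simp [mul_add]
  map_smul' a f := by ext c; simp; ring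

lemma vTot_succ (v : ℂ) :
    vTot N v (m + 1) = liftEnd N m (vTot N v m) * vOp N (m + 1) v (Fin.last m) := by
  refine LinearMap.ext fun f => funext fun c => ?_
  simp [vTot, vOp, liftEnd_apply, Fin.sum_univ_castSucc, wpow_add, Fin.snoc_init_self]
  simp only [Fin.init]
  ring

lemma vTotInv_succ (v : ℂ) :
    vTotInv N v (m + 1) = liftEnd N m (vTotInv N v m) * vInv N (m + 1) v (Fin.last m) := by
  refine LinearMap.ext fun f => funext fun c => ?_
  simp [vTotInv, vInv, liftEnd_apply, Fin.sum_univ_castSucc, wpow_add, Fin.snoc_init_self]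
  simp only [Fin.init]
  ring

/-- The factor ω arises from moving u_k past v_k. It makes the unwanted terms of the quantum
determinant at the arguments x and ωx cancel. -/
lemma Lop_exchange (u v ϰ x : ℂ) (hx : x ≠ 0) (k : Fin m) :
    Lop N m u v ϰ x k 0 1 * Lop N m u v ϰ (omega N * x) k 0 0 =
      omega N • (Lop N m u v ϰ x k 0 0 * Lop N m u v ϰ (omega N * x) k 0 1) := by
  refine LinearMap.ext fun f => funext fun c => ?_
  have h2 := omega_ne_zero N
  simp [Lop, uOp, vOp, wpow_add, wpow_one]
  field_simp
  ring

lemma Lop_bc (u v ϰ x x' : ℂ) (hu : u ≠ 0) (k : Fin m) :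
    Lop N m u v ϰ x k 0 1 * Lop N m u v ϰ x' k 1 0 = -(1 / x) • vOp N m v k := by
  refine LinearMap.ext fun f => funext fun c => ?_
  simp [Lop, uOp, vOp, uInv]
  field_simp
  simp

lemma Lop_cb (u v ϰ x : ℂ) (hu : u ≠ 0) (k : Fin m) :
    omega N • (Lop N m u v ϰ x k 1 0 * Lop N m u v ϰ (omega N * x) k 0 1) =
      -(1 / (omega N * x)) • vOp N m v k := by
  refine LinearMap.ext fun f => funext fun c => ?_
  have h2 := omega_ne_zero N
  simp [Lop, uOp, vOp, uInv, wpow_sub, wpow_one]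
  field_simp

/-- The algebra of adding one site to the quantum determinant: `h1` cancels the terms in `x`, while
`h2` and `h3` turn the rest into the shorter determinant `z - w • y` times the operator `e` of the
new site. -/
lemma quantum_det_aux {R : Type*} [Ring R] [Algebra ℂ R] {w s : ℂ} {x y z p q r t e : R}
    (h1 : p = w • q) (h2 : r = -(w * s) • e) (h3 : w • t = -s • e) :
    x * p + y * r - w • (x * q + z * t) = s • ((z - w • y) * e) := by
  rw [smul_add, ← mul_smul_comm w x q, ← mul_smul_comm w z t, h1, h2, h3]
  simp only [mul_smul_comm, smul_mul_assoc, sub_mul, smul_sub, neg_smul, mul_smul, mul_neg,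
    smul_comm s w]
  abel

/-- The quantum determinant. -/
lemma quantum_det (u v ϰ x : ℂ) (hu : u ≠ 0) (hx : x ≠ 0) : ∀ m : ℕ,
    Tmat N u v ϰ m x 1 1 * Tmat N u v ϰ m (omega N * x) 0 0 -
      omega N • (Tmat N u v ϰ m x 1 0 * Tmat N u v ϰ m (omega N * x) 0 1) =
      (1 / (omega N * x)) ^ m • vTot N v m
  | 0 => by
    refine LinearMap.ext fun f => funext fun c => ?_
    simp [Tmat_zero, vTot, wpow_zero]
  | m + 1 => by
    have ih := congrArg (liftEnd N m) (quantum_det u v ϰ x hu hx m)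
    rw [map_sub, map_smul, map_smul, map_mul, map_mul] at ih
    have e (x : ℂ) : Lop N (m + 1) u v ϰ x (Fin.last m) 1 1 = 0 := rfl
    simp only [Tmat_succ_apply (N := N) (m := m), e, mul_zero, add_zero]
    rw [mul_add, add_mul,
      (commute_Lop_liftEnd u v ϰ x 0 1 (Tmat N u v ϰ m (omega N * x) 0 0)).mul_mul_mul_comm,
      (commute_Lop_liftEnd u v ϰ x 0 1 (Tmat N u v ϰ m (omega N * x) 0 1)).mul_mul_mul_comm,
      (commute_Lop_liftEnd u v ϰ x 0 0 (Tmat N u v ϰ m (omega N * x) 0 0)).mul_mul_mul_comm,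
      (commute_Lop_liftEnd u v ϰ x 1 0 (Tmat N u v ϰ m (omega N * x) 0 0)).mul_mul_mul_comm,
      vTot_succ, pow_succ', mul_smul, ← smul_mul_assoc ((1 / (omega N * x)) ^ m), ← ih]
    have h2 := omega_ne_zero N
    refine quantum_det_aux (Lop_exchange u v ϰ x hx _) ?_ (Lop_cb u v ϰ x hu _)
    rw [Lop_bc u v ϰ _ _ hu]
    congr 1
    field_simp

/-- Up to the factor ωθ v_k⁻¹, the twisted operator is the signed transpose of L at ωθ/lam.
Transposition matches the reversed order of sites in `TmatTilde`, so the twisted chain can be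
eliminated. -/
lemma LopTilde_eq (u v ϰ θ lam : ℂ) (hv : v ≠ 0) (hθ : θ ≠ 0) (hl : lam ≠ 0) (k : Fin m)
    (i j : Fin 2) :
    LopTilde N m u v ϰ θ lam k i j =
      (omega N * θ * if i = j then 1 else -1) •
        (vInv N m v k * Lop N m u v ϰ (omega N * θ / lam) k j i) := by
  refine LinearMap.ext fun f => funext fun c => ?_
  have h1 := wpow_ne_zero N (c k)
  have h2 := omega_ne_zero N
  fin_cases i <;> fin_cases j <;>
    simp [Lop, LopTilde, uOp, vOp, vInv, uInv, wpow_sub, wpow_one]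
  all_goals field_simp
  ring

/-- The twisted monodromy matrix in terms of the monodromy matrix. -/
lemma TmatTilde_eq (u v ϰ θ lam : ℂ) (hv : v ≠ 0) (hθ : θ ≠ 0) (hl : lam ≠ 0) :
    ∀ (m : ℕ) (i j : Fin 2), TmatTilde N u v ϰ θ m lam i j =
      ((omega N * θ) ^ m * if i = j then 1 else -1) •
        (vTotInv N v m * Tmat N u v ϰ m (omega N * θ / lam) j i)
  | 0, i, j => by
    refine LinearMap.ext fun f => funext fun c => ?_
    fin_cases i <;> fin_cases j <;> simp [Tmat_zero, TmatTilde_zero, vTotInv, wpow_zero]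
  | m + 1, i, j => by
    have key : ∀ k : Fin 2, LopTilde N (m + 1) u v ϰ θ lam (Fin.last m) i k *
        liftEnd N m (TmatTilde N u v ϰ θ m lam k j) =
        ((omega N * θ) ^ (m + 1) * if i = j then 1 else -1) • (vTotInv N v (m + 1) *
          (liftEnd N m (Tmat N u v ϰ m (omega N * θ / lam) j k) *
            Lop N (m + 1) u v ϰ (omega N * θ / lam) (Fin.last m) k i)) := by
      intro k
      rw [TmatTilde_eq u v ϰ θ lam hv hθ hl m k j, LopTilde_eq u v ϰ θ lam hv hθ hl, map_smul,
        map_mul, smul_mul_smul_comm, vTotInv_succ]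
      congr 1
      · fin_cases i <;> fin_cases j <;> fin_cases k <;> simp <;> ring
      · rw [(commute_Lop_liftEnd _ _ _ _ _ _ _).mul_mul_mul_comm, vInv_mul_liftEnd,
          (commute_Lop_liftEnd _ _ _ _ _ _ _).eq]
    rw [TmatTilde_succ_apply, Tmat_succ_apply, key, key, ← smul_add, ← mul_add]

/-- The operator `𝒜(lam)` in terms of the monodromy matrix. -/
lemma Umat_zero_zero (u v ϰ θ α η lam : ℂ) (hv : v ≠ 0) (hθ : θ ≠ 0) (hl : lam ≠ 0) (n : ℕ) :
    Umat N n u v ϰ θ α η lam 0 0 = (omega N * θ) ^ n • (vTotInv N v n *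
      ((α * (θ / lam - lam)) • (Tmat N u v ϰ n (omega N * θ / lam) 0 0 * Tmat N u v ϰ n lam 0 0) +
        η • (Tmat N u v ϰ n (omega N * θ / lam) 0 0 * Tmat N u v ϰ n lam 1 0 -
          Tmat N u v ϰ n (omega N * θ / lam) 1 0 * Tmat N u v ϰ n lam 0 0))) := by
  rw [Umat_eq]
  simp only [Matrix.mul_apply, Fin.sum_univ_two, TmatTilde_eq u v ϰ θ lam hv hθ hl]
  refine LinearMap.ext fun f => ?_
  simp [Kminus, smul_smul, smul_sub]
  module

/-! ### The points `±√θ` -/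

lemma Umat_succ (u v ϰ θ α η lam : ℂ) (n : ℕ) :
    Umat N (n + 1) u v ϰ θ α η lam = LopTilde N (n + 1) u v ϰ θ lam (Fin.last n) *
      (liftEnd N n).mapMatrix (Umat N n u v ϰ θ α η lam) *
      Lop N (n + 1) u v ϰ lam (Fin.last n) := by
  have hK : (liftEnd N n).mapMatrix (Kminus N n θ α η lam) = Kminus N (n + 1) θ α η lam := by
    ext i j : 2
    fin_cases i <;> fin_cases j <;> simp [Kminus, AlgHom.mapMatrix_apply]
  rw [Umat_eq, Umat_eq, map_mul, map_mul, hK, Tmat_succ, TmatTilde_succ]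
  simp only [mul_assoc]

/-- At `lam ^ 2 = θ` the operator `𝒞(lam)` is a scalar. -/
lemma Umat_of_sq_eq (u v ϰ θ α η lam : ℂ) (hu : u ≠ 0) (hv : v ≠ 0) (hl : lam ≠ 0)
    (h : lam ^ 2 = θ) : ∀ n : ℕ, Umat N n u v ϰ θ α η lam =
      !![0, (η * lam ^ n) • 1; (η * lam ^ n) • 1, 0]
  | 0 => by
    rw [Umat_eq, Tmat_zero, TmatTilde_zero, mul_one, one_mul]
    have : θ / lam - lam = 0 := by rw [← h]; field_simp; simp
    simp [Kminus, this]
  | n + 1 => by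
    have hm (s : ℂ) : (liftEnd N n).mapMatrix !![0, s • 1; s • 1, 0] =
        (!![0, s • 1; s • 1, 0] : OpMatrix N (n + 1)) := by
      ext i j : 2
      fin_cases i <;> fin_cases j <;> simp [AlgHom.mapMatrix_apply]
    -- An antidiagonal scalar matrix between L̃ and L stays antidiagonal and gains a factor lam. The
    -- four entries are compared after substituting θ = lam ^ 2.
    rw [Umat_succ, Umat_of_sq_eq u v ϰ θ α η lam hu hv hl h n, hm, LopTilde, Lop,
      Matrix.mul_fin_two, Matrix.mul_fin_two]
    have h2 := omega_ne_zero N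
    subst h
    congr 5
    all_goals
      refine LinearMap.ext fun f => funext fun c => ?_
      have h1 := wpow_ne_zero N (c (Fin.last n))
      simp [uOp, uInv, vOp, vInv, wpow_sub, wpow_add, wpow_one]
    all_goals field_simp
    all_goals ring

end Monodromy
end RTC
end
noncomputable section
namespace RTC
open Finset

/-! ### Interpolation -/

section Interpolation

open Polynomial in
lemma eval_eq_sum_lagrange {ι : Type*} [Fintype ι] [DecidableEq ι] {z : ι → ℂ}
    (hz : Function.Injective z) {p : ℂ[X]} (hp : p.degree < Fintype.card ι) (x : ℂ) :
    p.eval x = ∑ i, p.eval (z i) * ∏ j ∈ univ.erase i, (x - z j) / (z i - z j) := by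
  conv_lhs => rw [Lagrange.eq_interpolate (s := univ) (v := z) hz.injOn hp,
    Lagrange.interpolate_apply, eval_finsetSum]
  refine Finset.sum_congr rfl fun i _ => ?_
  rw [eval_mul, eval_C, Lagrange.basis, eval_prod]
  congr 1
  refine Finset.prod_congr rfl fun j _ => ?_
  rw [Lagrange.basisDivisor, eval_mul, eval_C, eval_sub, eval_X, eval_C, div_eq_inv_mul]

open Polynomial in
/-- Partial fraction expansion of the difference of two monic polynomials of equal degree. -/
lemma prod_sub_prod_eq {ι κ : Type*} [Fintype ι] [DecidableEq ι] [Fintype κ]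
    (hc : Fintype.card ι = Fintype.card κ) {z : ι → ℂ} (hz : Function.Injective z) (Z : κ → ℂ)
    (x : ℂ) : ∏ i, (x - z i) - ∏ k, (x - Z k) =
      -∑ i, (∏ k, (z i - Z k)) * ∏ j ∈ univ.erase i, (x - z j) / (z i - z j) := by
  have hm1 : (∏ i, (X - C (z i))).Monic := monic_prod_of_monic _ _ fun i _ => monic_X_sub_C _
  have hm2 : (∏ k, (X - C (Z k))).Monic := monic_prod_of_monic _ _ fun i _ => monic_X_sub_C _
  have hd1 : (∏ i, (X - C (z i))).degree = (Fintype.card ι : WithBot ℕ) := by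
    rw [degree_eq_natDegree hm1.ne_zero, natDegree_prod_of_monic _ _ fun i _ => monic_X_sub_C _]
    simp
  have hd2 : (∏ k, (X - C (Z k))).degree = (Fintype.card ι : WithBot ℕ) := by
    rw [degree_eq_natDegree hm2.ne_zero, natDegree_prod_of_monic _ _ fun i _ => monic_X_sub_C _]
    simp [hc]
  have hd : (∏ i, (X - C (z i)) - ∏ k, (X - C (Z k))).degree < (Fintype.card ι : WithBot ℕ) := by
    rw [← hd1]
    exact degree_sub_lt_left (hd1.trans hd2.symm) hm1.ne_zero (hm1.leadingCoeff.trans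
      hm2.leadingCoeff.symm)
  have := eval_eq_sum_lagrange hz hd x
  simp only [eval_sub, eval_prod, eval_X, eval_C] at this
  rw [this, ← Finset.sum_neg_distrib]
  refine Finset.sum_congr rfl fun i _ => ?_
  rw [Finset.prod_eq_zero (mem_univ i) (sub_self (z i))]
  ring

variable {V W : Type*} [AddCommGroup V] [Module ℂ V] [AddCommGroup W] [Module ℂ W]

/-- `F` agrees on `ℂ ∖ {0}` with a Laurent polynomial with exponents `a, …, a + d - 1`. -/
def LaurentOn (a : ℤ) (d : ℕ) (F : ℂ → V) : Prop :=
  ∃ c : ℕ → V, ∀ x : ℂ, x ≠ 0 → F x = ∑ j ∈ range d, x ^ (a + (j : ℤ)) • c j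

namespace LaurentOn

variable {a : ℤ} {d : ℕ} {F G : ℂ → V}

lemma const (w : V) : LaurentOn 0 1 fun _ => w := ⟨fun _ => w, fun x _ => by simp⟩

lemma congr (hF : LaurentOn a d F) (h : ∀ x, x ≠ 0 → G x = F x) : LaurentOn a d G := by
  obtain ⟨c, hc⟩ := hF
  exact ⟨c, fun x hx => (h x hx).trans (hc x hx)⟩

lemma add (hF : LaurentOn a d F) (hG : LaurentOn a d G) : LaurentOn a d fun x => F x + G x := by
  obtain ⟨c, hc⟩ := hF
  obtain ⟨c', hc'⟩ := hG
  exact ⟨c + c', fun x hx => by simp [hc x hx, hc' x hx, Finset.sum_add_distrib]⟩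

lemma map (hF : LaurentOn a d F) (φ : V →ₗ[ℂ] W) : LaurentOn a d fun x => φ (F x) := by
  obtain ⟨c, hc⟩ := hF
  exact ⟨fun j => φ (c j), fun x hx => by simp [hc x hx]⟩

lemma shift (hF : LaurentOn a d F) (k : ℤ) : LaurentOn (a + k) d fun x => x ^ k • F x := by
  obtain ⟨c, hc⟩ := hF
  refine ⟨c, fun x hx => ?_⟩
  simp only [hc x hx, Finset.smul_sum]
  refine Finset.sum_congr rfl fun j _ => ?_
  rw [smul_smul, ← zpow_add₀ hx]
  congr 2
  ring

lemma mono (hF : LaurentOn a d F) {a' : ℤ} {d' : ℕ} (h1 : a' ≤ a) (h2 : a + d ≤ a' + d') :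
    LaurentOn a' d' F := by
  obtain ⟨c, hc⟩ := hF
  obtain ⟨k, rfl⟩ : ∃ k : ℕ, a = a' + k := ⟨(a - a').toNat, by omega⟩
  obtain ⟨l, rfl⟩ : ∃ l : ℕ, d' = k + (d + l) := ⟨d' - (k + d), by omega⟩
  refine ⟨fun j => if j < k then 0 else if j < k + d then c (j - k) else 0, fun x hx => ?_⟩
  rw [hc x hx, Finset.sum_range_add, Finset.sum_range_add,
    Finset.sum_eq_zero (s := range k) fun j hj => by simp [Finset.mem_range.mp hj],
    Finset.sum_eq_zero (s := range l) fun j _ => by simp, zero_add, add_zero]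
  refine Finset.sum_congr rfl fun j hj => ?_
  simp [Finset.mem_range.mp hj, add_assoc]

/-- Lagrange interpolation for Laurent polynomials. -/
lemma eq_sum (hF : LaurentOn a d F) {ι : Type*} [Fintype ι] [DecidableEq ι] {z : ι → ℂ}
    (hz : Function.Injective z) (hz0 : ∀ i, z i ≠ 0) (hd : d ≤ Fintype.card ι) {x : ℂ}
    (hx : x ≠ 0) :
    F x = ∑ i, ((x / z i) ^ a * ∏ j ∈ univ.erase i, (x - z j) / (z i - z j)) • F (z i) := by
  obtain ⟨c, hc⟩ := hF
  have key : ∀ j ∈ range d, x ^ (a + (j : ℤ)) • c j =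
      ∑ i, ((x / z i) ^ a * ∏ l ∈ univ.erase i, (x - z l) / (z i - z l)) •
        z i ^ (a + (j : ℤ)) • c j := by
    intro j hj
    have h1 : (Polynomial.X ^ j : Polynomial ℂ).degree < Fintype.card ι := by
      rw [Polynomial.degree_X_pow]
      exact_mod_cast (Finset.mem_range.mp hj).trans_le hd
    have h2 := eval_eq_sum_lagrange hz h1 x
    simp only [Polynomial.eval_pow, Polynomial.eval_X] at h2
    rw [zpow_add₀ hx, zpow_natCast, h2, Finset.mul_sum, Finset.sum_smul]
    refine Finset.sum_congr rfl fun i _ => ?_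
    rw [smul_smul, zpow_add₀ (hz0 i), zpow_natCast, div_zpow]
    have := zpow_ne_zero a (hz0 i)
    congr 1
    field_simp
  rw [hc x hx, Finset.sum_congr rfl key, Finset.sum_comm]
  refine Finset.sum_congr rfl fun i _ => ?_
  rw [hc _ (hz0 i), Finset.smul_sum]

variable {R : Type*} [Ring R] [Algebra ℂ R] {H : ℂ → R}

lemma linear_mul (hH : LaurentOn a d H) (P Q : R) :
    LaurentOn a (d + 1) fun x => (P + x • Q) * H x := by
  have h1 := (hH.map (LinearMap.mulLeft ℂ P)).mono (a' := a) (d' := d + 1) le_rfl (by simp)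
  have h2 := ((hH.map (LinearMap.mulLeft ℂ Q)).shift 1).mono (a' := a) (d' := d + 1) (by simp)
    (by push_cast; omega)
  exact (h1.add h2).congr fun x _ => by simp [add_mul]

lemma mul_linear (hH : LaurentOn a d H) (P Q : R) :
    LaurentOn (a - 1) (d + 1) fun x => H x * (P + (1 / x) • Q) := by
  have h1 := (hH.map (LinearMap.mulRight ℂ P)).mono (a' := a - 1) (d' := d + 1) (by simp)
    (by push_cast; omega)
  have h2 := ((hH.map (LinearMap.mulRight ℂ Q)).shift (-1)).mono (a' := a - 1) (d' := d + 1)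
    (by omega) (by push_cast; omega)
  exact (h1.add h2).congr fun x _ => by simp [mul_add]

end LaurentOn
end Interpolation

/-! ### The monodromy matrices as Laurent polynomials -/

section LaurentMonodromy

variable {N m : ℕ}

lemma LaurentOn.liftEnd {a : ℤ} {d : ℕ} {F : ℂ → Module.End ℂ (States N m)}
    (hF : LaurentOn a d F) : LaurentOn a d fun x => liftEnd N m (F x) :=
  hF.map (RTC.liftEnd N m).toLinearMap

variable [NeZero N]

lemma Lop_eq_linear (u v ϰ : ℂ) (k : Fin m) (i j : Fin 2) :
    ∃ P Q, ∀ x, Lop N m u v ϰ x k i j = P + (1 / x) • Q := by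
  fin_cases i <;> fin_cases j
  · exact ⟨1, ϰ • vOp N m v k, fun x => by simp [Lop, smul_smul, div_eq_inv_mul]⟩
  · exact ⟨0, -uOp N m u k, fun x => by simp [Lop]⟩
  · exact ⟨uInv N m u k * vOp N m v k, 0, fun x => by simp [Lop]⟩
  · exact ⟨0, 0, fun x => by simp [Lop]⟩

lemma LopTilde_eq_linear (u v ϰ θ : ℂ) (k : Fin m) (i j : Fin 2) :
    ∃ P Q, ∀ x, LopTilde N m u v ϰ θ x k i j = P + x • Q := by
  fin_cases i <;> fin_cases j
  · exact ⟨(omega N * θ) • vInv N m v k, ϰ • 1, fun x => by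
      simp [LopTilde, smul_smul, mul_comm x, add_comm]⟩
  · exact ⟨-(θ • uInv N m u k), 0, fun x => by simp [LopTilde]⟩
  · exact ⟨0, vInv N m v k * uOp N m u k, fun x => by simp [LopTilde]⟩
  · exact ⟨0, 0, fun x => by simp [LopTilde]⟩

lemma LaurentOn.mul_Lop {a : ℤ} {d : ℕ} {F : ℂ → Module.End ℂ (States N m)}
    (hF : LaurentOn a d F) (u v ϰ : ℂ) (k : Fin m) (i j : Fin 2) :
    LaurentOn (a - 1) (d + 1) fun x => F x * Lop N m u v ϰ x k i j := by
  obtain ⟨P, Q, h⟩ := Lop_eq_linear (N := N) u v ϰ k i j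
  simpa only [h] using hF.mul_linear P Q

lemma LaurentOn.LopTilde_mul {a : ℤ} {d : ℕ} {F : ℂ → Module.End ℂ (States N m)}
    (hF : LaurentOn a d F) (u v ϰ θ : ℂ) (k : Fin m) (i j : Fin 2) :
    LaurentOn a (d + 1) fun x => LopTilde N m u v ϰ θ x k i j * F x := by
  obtain ⟨P, Q, h⟩ := LopTilde_eq_linear (N := N) u v ϰ θ k i j
  simpa only [h] using hF.linear_mul P Q

lemma laurentOn_Tmat (u v ϰ : ℂ) : ∀ (m : ℕ) (i j : Fin 2),
    LaurentOn (-(m : ℤ)) (m + 1) fun x => Tmat N u v ϰ m x i j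
  | 0, i, j => by
    simp only [Tmat_zero]
    exact LaurentOn.const _
  | m + 1, i, j => by
    simp only [Tmat_succ_apply]
    have h := fun k => (laurentOn_Tmat u v ϰ m i k).liftEnd.mul_Lop u v ϰ (Fin.last m) k j
    refine ((h 0).add (h 1)).mono ?_ ?_ <;> push_cast <;> omega

/-- Removing the factor 1/x of B leaves m + 1 coefficients, as many as the eigenvalue of A on m + 1
sites has zeros. These zeros therefore suffice as interpolation nodes. -/
lemma laurentOn_Tmat_zero_one (u v ϰ : ℂ) (m : ℕ) :
    LaurentOn (-(m : ℤ)) (m + 1) fun x => x • Tmat N u v ϰ (m + 1) x 0 1 := by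
  simp only [Tmat_succ_zero_one]
  have h := (laurentOn_Tmat (N := N) u v ϰ m 0 0).liftEnd.map
    (LinearMap.mulRight ℂ (-uOp N (m + 1) u (Fin.last m)))
  refine h.congr fun x hx => ?_
  rw [smul_smul, show x * -(1 / x) = -1 by field_simp]
  refine LinearMap.ext fun f => ?_
  simp

/-- The lower row of the first L does not depend on x, so only m of the m + 1 sites contribute
powers of 1/x. Again m + 1 nodes suffice to interpolate C. -/
lemma laurentOn_Tmat_one (u v ϰ : ℂ) : ∀ (m : ℕ) (j : Fin 2),
    LaurentOn (-(m : ℤ)) (m + 1) fun x => Tmat N u v ϰ (m + 1) x 1 j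
  | 0, j => by
    refine (LaurentOn.const (Lop N 1 u v ϰ 0 0 1 j)).congr fun x _ => ?_
    rw [Tmat_succ_apply, Tmat_zero]
    fin_cases j <;> simp [Lop]
  | m + 1, j => by
    have e (x : ℂ) : Lop N (m + 1 + 1) u v ϰ x (Fin.last (m + 1)) 1 j =
        Lop N (m + 1 + 1) u v ϰ 0 (Fin.last (m + 1)) 1 j := by
      fin_cases j <;> simp [Lop]
    have h0 := (laurentOn_Tmat_one u v ϰ m 0).liftEnd.mul_Lop u v ϰ (Fin.last (m + 1)) 0 j
    have h1 := (laurentOn_Tmat_one u v ϰ m 1).liftEnd.mul_Lop u v ϰ (Fin.last (m + 1)) 1 j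
    simp only [Tmat_succ_apply (m := m + 1)]
    refine (h0.add h1).mono ?_ ?_ <;> push_cast <;> omega

lemma laurentOn_Umat (u v ϰ θ α η : ℂ) : ∀ (m : ℕ) (i j : Fin 2),
    LaurentOn (-((m : ℤ) + 1)) (2 * m + 3) fun x => Umat N m u v ϰ θ α η x i j
  | 0, i, j => by
    simp only [Umat_eq, Tmat_zero, TmatTilde_zero, mul_one, one_mul]
    fin_cases i <;> fin_cases j
    · have h1 := ((LaurentOn.const ((α * θ) • (1 : Module.End ℂ (States N 0)))).shift (-1)).mono
        (a' := -1) (d' := 3) (by simp) (by simp)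
      have h2 := ((LaurentOn.const ((-α) • (1 : Module.End ℂ (States N 0)))).shift 1).mono
        (a' := -1) (d' := 3) (by simp) (by simp)
      refine (h1.add h2).congr fun x _ => ?_
      simp [Kminus, smul_smul]
      module
    · exact (LaurentOn.const (η • (1 : Module.End ℂ (States N 0)))).mono (by simp) (by simp)
    · exact (LaurentOn.const (η • (1 : Module.End ℂ (States N 0)))).mono (by simp) (by simp)
    · exact (LaurentOn.const (0 : Module.End ℂ (States N 0))).mono (by simp) (by simp)
  | m + 1, i, j => by
    simp only [Umat_succ, Matrix.mul_apply, Fin.sum_univ_two, AlgHom.mapMatrix_apply,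
      Matrix.map_apply]
    have h := fun k l => (laurentOn_Umat u v ϰ θ α η m k l).liftEnd.LopTilde_mul u v ϰ θ
      (Fin.last m) i k
    refine ((((h 0 0).add (h 1 0)).mul_Lop u v ϰ (Fin.last m) 0 j).add
      (((h 0 1).add (h 1 1)).mul_Lop u v ϰ (Fin.last m) 1 j)).mono ?_ ?_ <;> push_cast <;> omega

/-- The bound for `Umat` on m + 1 sites has one coefficient too many. The lower row of the outermost
L̃ is (x v⁻¹u, 0), whose explicit factor x raises the lowest exponent by one. -/
lemma laurentOn_Cop (u v ϰ θ α η : ℂ) (m : ℕ) :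
    LaurentOn (-((m + 1 : ℕ) : ℤ)) (2 * (m + 1) + 2) (Cop N (m + 1) u v ϰ θ α η) := by
  have h := fun l => ((laurentOn_Umat u v ϰ θ α η m 0 l).liftEnd.map (LinearMap.mulLeft ℂ
    (vInv N (m + 1) v (Fin.last m) * uOp N (m + 1) u (Fin.last m)))).shift 1
  refine LaurentOn.congr ((((h 0).mul_Lop u v ϰ (Fin.last m) 0 0).add
    ((h 1).mul_Lop u v ϰ (Fin.last m) 1 0)).mono ?_ ?_) fun x _ => ?_
  · push_cast; omega
  · push_cast; omega
  · rw [Cop, Umat_succ, Matrix.mul_apply, Fin.sum_univ_two, Matrix.mul_apply, Matrix.mul_apply,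
      Fin.sum_univ_two, Fin.sum_univ_two]
    simp [AlgHom.mapMatrix_apply, LopTilde, mul_assoc]

end LaurentMonodromy
end RTC
end
noncomputable section
namespace RTC
open Finset

/-! ### Ratios of the functions `w_p` -/

section WFun

variable {N : ℕ} [NeZero N]

lemma wFun_ne_zero {x y : ℂ} (h : FermatPoint N x y) (s : ZMod N) : wFun N x y s ≠ 0 :=
  Finset.prod_ne_zero_iff.mpr fun j _ => div_ne_zero h.2 (one_sub_ne_zero_of_fermat h j)

lemma one_sub_mul_wpow_ne_zero {x y : ℂ} (h : FermatPoint N x y) (s : ZMod N) :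
    1 - x * wpow N s ≠ 0 := one_sub_ne_zero_of_fermat h _

lemma wFun_mul_one_sub {x y : ℂ} (h : FermatPoint N x y) (s : ZMod N) :
    wFun N x y s * (1 - x * wpow N s) = y * wFun N x y (s - 1) := by
  rw [wFun_rec h s]
  field_simp [one_sub_mul_wpow_ne_zero h s]

variable {m : ℕ}

lemma lamB_ne_zero {ϰ : ℂ} (hϰ : ϰ ≠ 0) {a : Fin m → ℂ} {r : Fin m} (ha : a r ≠ 0)
    (γ : Fin m → ZMod N) : lamB N m ϰ a γ r ≠ 0 :=
  mul_ne_zero (mul_ne_zero (neg_ne_zero.mpr hϰ) ha) (wpow_ne_zero N _)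

lemma lamB_add_single_self (ϰ : ℂ) (a : Fin m → ℂ) (γ : Fin m → ZMod N) (r : Fin m) :
    lamB N m ϰ a (γ + Pi.single r 1 : Fin m → ZMod N) r = omega N * lamB N m ϰ a γ r := by
  simp [lamB, wpow_add, wpow_one]; ring

lemma lamB_add_single_of_ne (ϰ : ℂ) (a : Fin m → ℂ) (γ : Fin m → ZMod N) {r s : Fin m}
    (h : s ≠ r) (b : ZMod N) : lamB N m ϰ a (γ + Pi.single r b) s = lamB N m ϰ a γ s := by
  simp [lamB, h]

/-- This identifies the factors 1 - xω^s in the recursion of w_p with factors 1 - λ/λ', the form in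
which they occur in eigenvalues of A. -/
lemma div_mul_wpow_sub {ϰ : ℂ} (hϰ : ϰ ≠ 0) {k : ℕ} {a : Fin m → ℂ} {b : Fin k → ℂ}
    (γ : Fin m → ZMod N) (γ' : Fin k → ZMod N) (i : Fin m) (j : Fin k) :
    a i / b j * wpow N (γ i - γ' j) = lamB N m ϰ a γ i / lamB N k ϰ b γ' j := by
  rw [wpow_sub, lamB, lamB, mul_assoc, mul_assoc, mul_div_mul_left _ _ (neg_ne_zero.mpr hϰ),
    div_mul_div_comm]

/-- The product of `-λ_k`. -/
lemma prod_neg_lamB (ϰ : ℂ) (a : Fin m → ℂ) (γ : Fin m → ZMod N) :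
    ∏ k, -lamB N m ϰ a γ k = ϰ ^ m * (∏ k, a k) * wpow N (∑ k, γ k) := by
  simp only [lamB, neg_mul, neg_neg, Finset.prod_mul_distrib, wpow_sum]
  simp

/-- Splitting off the factors involving a given index from a product over pairs. -/
lemma prod_prod_erase_eq {ι : Type*} [Fintype ι] [DecidableEq ι] (f : ι → ι → ℂ) (r : ι) :
    ∏ j, ∏ l ∈ univ.erase j, f j l =
      (∏ s ∈ univ.erase r, f r s * f s r) *
        ∏ j ∈ univ.erase r, ∏ l ∈ (univ.erase j).erase r, f j l := by
  rw [← Finset.mul_prod_erase univ _ (mem_univ r), Finset.prod_mul_distrib, mul_assoc]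
  congr 1
  rw [← Finset.prod_mul_distrib]
  refine Finset.prod_congr rfl fun j hj => ?_
  rw [Finset.mul_prod_erase]
  simpa using (Finset.ne_of_mem_erase hj).symm

end WFun

/-! ### The eigenvectors of the open chain -/

section OpenChain

variable {N n : ℕ} {v ϰ : ℂ} {amp : (m : ℕ) → Fin m → ℂ}
  {y : (m : ℕ) → Fin m → (m' : ℕ) → Fin m' → ℂ}

lemma IsOpenData.prod_amp_eq (h : IsOpenData N n v ϰ amp y) : ∀ m, m ≤ n → ∏ s, amp m s = v ^ m
  | 0, _ => by simp
  | 1, _ => by simp [h.init]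
  | m + 2, hm => by
    rw [h.prod_amp (m + 1) (by omega) (by omega), h.prod_amp_eq (m + 1) (by omega), ← pow_succ]

lemma IsOpenData.amp_ne_zero (h : IsOpenData N n v ϰ amp y) (hv : v ≠ 0) {m : ℕ} (hm : m ≤ n)
    (s : Fin m) : amp m s ≠ 0 := by
  have : ∏ s, amp m s ≠ 0 := by
    rw [h.prod_amp_eq m hm]
    exact pow_ne_zero _ hv
  exact Finset.prod_ne_zero_iff.mp this s (mem_univ s)

lemma sum_add_single {m : ℕ} (γ : Fin m → ZMod N) (r : Fin m) (a : ZMod N) :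
    ∑ k, (γ + Pi.single r a : Fin m → ZMod N) k = ∑ k, γ k + a := by
  simp [Finset.sum_add_distrib]

lemma sum_sub_single {m : ℕ} (γ : Fin m → ZMod N) (r : Fin m) (a : ZMod N) :
    ∑ k, (γ - Pi.single r a : Fin m → ZMod N) k = ∑ k, γ k - a := by
  simp [Finset.sum_sub_distrib]

variable [NeZero N]

/-- A Fermat point with y ≠ 0 has x^N ≠ 1, so no multiple of x by a power of ω equals 1. Zeros with
different indices are therefore distinct even when taken from different labels γ and γ'. -/
lemma IsOpenData.one_sub_ne_zero (h : IsOpenData N n v ϰ amp y) (hϰ : ϰ ≠ 0) {m : ℕ}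
    (hm : m ≤ n) (γ γ' : Fin m → ZMod N) {r s : Fin m} (hrs : r ≠ s) :
    1 - lamB N m ϰ (amp m) γ r / lamB N m ϰ (amp m) γ' s ≠ 0 := by
  rw [← div_mul_wpow_sub hϰ]
  exact one_sub_mul_wpow_ne_zero (h.fermat_same m (Nat.one_le_iff_ne_zero.mpr
    (by rintro rfl; exact r.elim0)) hm r s hrs) _

lemma IsOpenData.lamB_ne (h : IsOpenData N n v ϰ amp y) (hv : v ≠ 0) (hϰ : ϰ ≠ 0) {m : ℕ}
    (hm : m ≤ n) (γ γ' : Fin m → ZMod N) {r s : Fin m} (hrs : r ≠ s) :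
    lamB N m ϰ (amp m) γ r ≠ lamB N m ϰ (amp m) γ' s := by
  intro e
  apply h.one_sub_ne_zero hϰ hm γ γ' hrs
  rw [e, div_self (lamB_ne_zero hϰ (h.amp_ne_zero hv hm s) γ'), sub_self]

lemma IsOpenData.lamB_injective (h : IsOpenData N n v ϰ amp y) (hv : v ≠ 0) (hϰ : ϰ ≠ 0)
    {m : ℕ} (hm : m ≤ n) (γ : Fin m → ZMod N) :
    Function.Injective (lamB N m ϰ (amp m) γ) := by
  intro r s hrs
  by_contra hne
  exact h.lamB_ne hv hϰ hm γ γ hne hrs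

lemma openVec_succ (amp : (m : ℕ) → Fin m → ℂ) (y : (m : ℕ) → Fin m → (m' : ℕ) → Fin m' → ℂ)
    (m : ℕ) (γ' : Fin (m + 1) → ZMod N) :
    openVec N amp y (m + 1) γ' = ∑ γ : Fin m → ZMod N,
      (muCoef N amp y m γ * QOpen N amp y m γ γ') •
        tens (openVec N amp y m γ) (∑ k, γ' k - ∑ l, γ l) := by
  ext c
  simp only [openVec, Finset.sum_apply, Pi.smul_apply, tens, smul_eq_mul]

/-- The label of the last site complements the total label of the shorter vector, so every summand
has the same total. -/
lemma vTot_openVec (amp : (m : ℕ) → Fin m → ℂ)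
    (y : (m : ℕ) → Fin m → (m' : ℕ) → Fin m' → ℂ) (v : ℂ) :
    ∀ (m : ℕ) (γ : Fin m → ZMod N), vTot N v m (openVec N amp y m γ) =
      (v ^ m * wpow N (∑ k, γ k)) • openVec N amp y m γ
  | 0, γ => by
    ext c
    simp [vTot]
  | m + 1, γ' => by
    rw [openVec_succ, map_sum, Finset.smul_sum]
    refine Finset.sum_congr rfl fun γ _ => ?_
    rw [map_smul, vTot_succ, Module.End.mul_apply, vOp_tens, map_smul, liftEnd_tens,
      vTot_openVec amp y v m γ, tens_smul, wpow_sub, smul_smul, smul_smul, smul_smul]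
    congr 1
    have := wpow_ne_zero N (∑ l, γ l)
    field_simp
    ring

lemma vTotInv_openVec (amp : (m : ℕ) → Fin m → ℂ)
    (y : (m : ℕ) → Fin m → (m' : ℕ) → Fin m' → ℂ) {v : ℂ} (hv : v ≠ 0) (m : ℕ)
    (γ : Fin m → ZMod N) : vTotInv N v m (openVec N amp y m γ) =
      (v ^ m * wpow N (∑ k, γ k))⁻¹ • openVec N amp y m γ := by
  have h1 := mul_ne_zero (pow_ne_zero m hv) (wpow_ne_zero N (∑ k, γ k))
  have h2 := congrArg (vTotInv N v m) (vTot_openVec amp y v m γ)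
  have h3 : vTotInv N v m (vTot N v m (openVec N amp y m γ)) = openVec N amp y m γ := by
    ext c
    have := mul_ne_zero (pow_ne_zero m hv) (wpow_ne_zero N (∑ k, c k))
    simp only [vTotInv, vTot, LinearMap.coe_mk, AddHom.coe_mk]
    rw [inv_mul_cancel_left₀ this]
  rw [h3, map_smul] at h2
  conv_rhs => rw [h2]
  rw [inv_smul_smul₀ h1]

/-- One step of the recursion of w_p in the factors with k = r. The product on the left is the
eigenvalue of A on m sites at the zero λ_r(γ'), which is why B shifts γ' there. -/
lemma QOpen_sub_single (h : IsOpenData N n v ϰ amp y) (hϰ : ϰ ≠ 0) {m : ℕ} (hm : m < n)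
    (γ : Fin m → ZMod N) (γ' : Fin (m + 1) → ZMod N) (r : Fin (m + 1)) :
    QOpen N amp y m γ γ' *
        ∏ l, (1 - lamB N m ϰ (amp m) γ l / lamB N (m + 1) ϰ (amp (m + 1)) γ' r) =
      (∏ l, y m l (m + 1) r) * QOpen N amp y m γ (γ' - Pi.single r 1) := by
  have hF : ∀ (l : Fin m) k, FermatPoint N (amp m l / amp (m + 1) k) (y m l (m + 1) k) :=
    fun l k => h.fermat_succ m (Nat.one_le_iff_ne_zero.mpr (by rintro rfl; exact l.elim0)) hm l k
  have h1 : (∏ l : Fin m, wFun N (amp m l / amp (m + 1) r) (y m l (m + 1) r) (γ l - γ' r)) *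
      ∏ l, (1 - lamB N m ϰ (amp m) γ l / lamB N (m + 1) ϰ (amp (m + 1)) γ' r) =
      (∏ l, y m l (m + 1) r) *
        ∏ l : Fin m, wFun N (amp m l / amp (m + 1) r) (y m l (m + 1) r) (γ l - γ' r - 1) := by
    rw [← Finset.prod_mul_distrib, ← Finset.prod_mul_distrib]
    refine Finset.prod_congr rfl fun l _ => ?_
    rw [← div_mul_wpow_sub hϰ, wFun_mul_one_sub (hF l r)]
  unfold QOpen
  rw [← Finset.mul_prod_erase univ _ (mem_univ r), ← Finset.mul_prod_erase univ _ (mem_univ r)]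
  have h2 : ∏ k ∈ univ.erase r, ∏ l : Fin m, wFun N (amp m l / amp (m + 1) k) (y m l (m + 1) k)
        (γ l - (γ' - Pi.single r 1 : Fin (m + 1) → ZMod N) k - 1) =
      ∏ k ∈ univ.erase r, ∏ l : Fin m, wFun N (amp m l / amp (m + 1) k) (y m l (m + 1) k)
        (γ l - γ' k - 1) := by
    refine Finset.prod_congr rfl fun k hk => ?_
    simp [Finset.ne_of_mem_erase hk]
  have h3 : ∏ l : Fin m, wFun N (amp m l / amp (m + 1) r) (y m l (m + 1) r)
        (γ l - (γ' - Pi.single r 1 : Fin (m + 1) → ZMod N) r - 1) =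
      ∏ l : Fin m, wFun N (amp m l / amp (m + 1) r) (y m l (m + 1) r) (γ l - γ' r) := by
    refine Finset.prod_congr rfl fun l _ => ?_
    simp only [Pi.sub_apply, Pi.single_eq_same]
    congr 1
    ring
  rw [h2, h3]
  have n1 : ∏ l : Fin m, wFun N (amp m l / amp (m + 1) r) (y m l (m + 1) r) (γ l - γ' r) ≠ 0 :=
    Finset.prod_ne_zero_iff.mpr fun l _ => wFun_ne_zero (hF l r) _
  have n2 : ∏ l : Fin m, wFun N (amp m l / amp (m + 1) r) (y m l (m + 1) r) (γ l - γ' r - 1) ≠ 0 :=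
    Finset.prod_ne_zero_iff.mpr fun l _ => wFun_ne_zero (hF l r) _
  have n3 : ∏ k ∈ univ.erase r, ∏ l : Fin m, wFun N (amp m l / amp (m + 1) k)
      (y m l (m + 1) k) (γ l - γ' k - 1) ≠ 0 :=
    Finset.prod_ne_zero_iff.mpr fun k _ => Finset.prod_ne_zero_iff.mpr fun l _ =>
      wFun_ne_zero (hF l k) _
  rw [div_mul_eq_mul_div, mul_div_assoc', div_eq_div_iff (mul_ne_zero n2 n3) (mul_ne_zero n1 n3)]
  linear_combination (wpow N (∑ l, γ l) * ∏ k ∈ univ.erase r, ∏ l : Fin m,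
    wFun N (amp m l / amp (m + 1) k) (y m l (m + 1) k) (γ l - γ' k - 1)) * h1

lemma QOpen_add_single (h : IsOpenData N n v ϰ amp y) (hϰ : ϰ ≠ 0) {m : ℕ} (hm : m < n)
    (γ : Fin m → ZMod N) (γ' : Fin (m + 1) → ZMod N) (r : Fin m) :
    QOpen N amp y m (γ + Pi.single r 1) γ' * ∏ k, y m r (m + 1) k =
      QOpen N amp y m γ γ' * omega N *
        ∏ k, (1 - lamB N m ϰ (amp m) γ r / lamB N (m + 1) ϰ (amp (m + 1)) γ' k) := by
  have hF : ∀ (l : Fin m) k, FermatPoint N (amp m l / amp (m + 1) k) (y m l (m + 1) k) :=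
    fun l k => h.fermat_succ m (Nat.one_le_iff_ne_zero.mpr (by rintro rfl; exact l.elim0)) hm l k
  unfold QOpen
  rw [sum_add_single, wpow_add, wpow_one, Finset.prod_comm]
  rw [Finset.prod_comm (f := fun k (l : Fin m) => wFun N (amp m l / amp (m + 1) k)
    (y m l (m + 1) k) (γ l - γ' k - 1))]
  rw [← Finset.mul_prod_erase univ _ (mem_univ r), ← Finset.mul_prod_erase univ _ (mem_univ r)]
  have h2 : ∏ l ∈ univ.erase r, ∏ k : Fin (m + 1), wFun N (amp m l / amp (m + 1) k)
        (y m l (m + 1) k) ((γ + Pi.single r 1 : Fin m → ZMod N) l - γ' k - 1) =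
      ∏ l ∈ univ.erase r, ∏ k : Fin (m + 1), wFun N (amp m l / amp (m + 1) k) (y m l (m + 1) k)
        (γ l - γ' k - 1) := by
    refine Finset.prod_congr rfl fun l hl => ?_
    simp [Finset.ne_of_mem_erase hl]
  have h3 : ∏ k : Fin (m + 1), wFun N (amp m r / amp (m + 1) k) (y m r (m + 1) k)
        ((γ + Pi.single r 1 : Fin m → ZMod N) r - γ' k - 1) =
      ∏ k : Fin (m + 1), wFun N (amp m r / amp (m + 1) k) (y m r (m + 1) k) (γ r - γ' k) := by
    refine Finset.prod_congr rfl fun l _ => ?_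
    simp only [Pi.add_apply, Pi.single_eq_same]
    congr 1
    ring
  rw [h2, h3]
  have h1 : (∏ k : Fin (m + 1), wFun N (amp m r / amp (m + 1) k) (y m r (m + 1) k)
        (γ r - γ' k)) *
      ∏ k, (1 - lamB N m ϰ (amp m) γ r / lamB N (m + 1) ϰ (amp (m + 1)) γ' k) =
      (∏ k, y m r (m + 1) k) * ∏ k : Fin (m + 1), wFun N (amp m r / amp (m + 1) k)
        (y m r (m + 1) k) (γ r - γ' k - 1) := by
    rw [← Finset.prod_mul_distrib, ← Finset.prod_mul_distrib]
    refine Finset.prod_congr rfl fun k _ => ?_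
    rw [← div_mul_wpow_sub hϰ, wFun_mul_one_sub (hF r k)]
  have n1 : ∏ k : Fin (m + 1), wFun N (amp m r / amp (m + 1) k) (y m r (m + 1) k)
      (γ r - γ' k) ≠ 0 := Finset.prod_ne_zero_iff.mpr fun l _ => wFun_ne_zero (hF r l) _
  have n2 : ∏ k : Fin (m + 1), wFun N (amp m r / amp (m + 1) k) (y m r (m + 1) k)
      (γ r - γ' k - 1) ≠ 0 := Finset.prod_ne_zero_iff.mpr fun l _ => wFun_ne_zero (hF r l) _
  have n3 : ∏ l ∈ univ.erase r, ∏ k : Fin (m + 1), wFun N (amp m l / amp (m + 1) k)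
      (y m l (m + 1) k) (γ l - γ' k - 1) ≠ 0 :=
    Finset.prod_ne_zero_iff.mpr fun k _ => Finset.prod_ne_zero_iff.mpr fun l _ =>
      wFun_ne_zero (hF k l) _
  rw [div_mul_eq_mul_div, div_mul_eq_mul_div, div_mul_eq_mul_div,
    div_eq_div_iff (mul_ne_zero n1 n3) (mul_ne_zero n2 n3)]
  linear_combination (-(omega N * wpow N (∑ l, γ l) * ∏ l ∈ univ.erase r, ∏ k : Fin (m + 1),
    wFun N (amp m l / amp (m + 1) k) (y m l (m + 1) k) (γ l - γ' k - 1))) * h1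

/-- Raising γ_r advances the w attached to (r, s) by one step and sets the w attached to (s, r) back
by one, whence a product on each side. -/
lemma muCoef_add_single (h : IsOpenData N n v ϰ amp y) (hϰ : ϰ ≠ 0) {m : ℕ} (hm : m ≤ n)
    (γ : Fin m → ZMod N) (r : Fin m) :
    muCoef N amp y m (γ + Pi.single r 1) * ((∏ s ∈ univ.erase r, y m s m r) *
        ∏ s ∈ univ.erase r, (1 - lamB N m ϰ (amp m) γ r / lamB N m ϰ (amp m) γ s)) =
      muCoef N amp y m γ * ((∏ s ∈ univ.erase r, y m r m s) *
        ∏ s ∈ univ.erase r,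
          (1 - lamB N m ϰ (amp m) γ s / (omega N * lamB N m ϰ (amp m) γ r))) := by
  unfold muCoef
  rw [prod_prod_erase_eq _ r, prod_prod_erase_eq (fun j l : Fin m =>
    wFun N (amp m j / amp m l) (y m j m l) (γ j - γ l - 1)) r]
  have h2 : ∏ j ∈ univ.erase r, ∏ l ∈ (univ.erase j).erase r, wFun N (amp m j / amp m l)
        (y m j m l) ((γ + Pi.single r 1 : Fin m → ZMod N) j -
          (γ + Pi.single r 1 : Fin m → ZMod N) l - 1) =
      ∏ j ∈ univ.erase r, ∏ l ∈ (univ.erase j).erase r, wFun N (amp m j / amp m l)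
        (y m j m l) (γ j - γ l - 1) := by
    refine Finset.prod_congr rfl fun j hj => Finset.prod_congr rfl fun l hl => ?_
    simp [Finset.ne_of_mem_erase hj, Finset.ne_of_mem_erase hl]
  rw [h2, mul_right_comm, mul_right_comm _ _
    ((∏ s ∈ univ.erase r, y m r m s) * _)]
  congr 1
  simp only [← Finset.prod_mul_distrib]
  refine Finset.prod_congr rfl fun s hs => ?_
  have hsr := Finset.ne_of_mem_erase hs
  have hF := fun (i j : Fin m) (hij : i ≠ j) => h.fermat_same m (Nat.one_le_iff_ne_zero.mpr
    (by rintro rfl; exact r.elim0)) hm i j hij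
  have e1 := wFun_mul_one_sub (hF r s hsr.symm) (γ r - γ s)
  have e2 := wFun_mul_one_sub (hF s r hsr) (γ s - (γ r + 1))
  have e3 : amp m s / amp m r * wpow N (γ s - (γ r + 1)) =
      lamB N m ϰ (amp m) γ s / (omega N * lamB N m ϰ (amp m) γ r) := by
    rw [← lamB_add_single_self, ← lamB_add_single_of_ne ϰ (amp m) γ hsr 1, ← div_mul_wpow_sub hϰ]
    simp [hsr]
  rw [div_mul_wpow_sub hϰ] at e1
  rw [e3] at e2
  simp only [Pi.add_apply, Pi.single_eq_same, Pi.single_eq_of_ne hsr, add_zero]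
  rw [show γ r + 1 - γ s - 1 = γ r - γ s by ring, show γ s - γ r - 1 = γ s - (γ r + 1) by ring]
  linear_combination (wFun N (amp m s / amp m r) (y m s m r) (γ s - (γ r + 1) - 1) *
    y m s m r) * e1 - y m r m s * wFun N (amp m r / amp m s) (y m r m s) (γ r - γ s - 1) * e2

end OpenChain
end RTC
end
noncomputable section
namespace RTC
open Finset

/-! ### Action of the monodromy matrix on the eigenvectors of the open chain -/

/-! ### Lagrange coefficients and partial fractions for the open chain -/

section ScalarIdentities

variable {m : ℕ}

lemma interp_coef_eq (z : Fin (m + 1) → ℂ) (hz : ∀ i, z i ≠ 0) {x : ℂ} (hx : x ≠ 0)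
    (i : Fin (m + 1)) :
    (x / z i) ^ (-(m : ℤ)) * ∏ j ∈ univ.erase i, (x - z j) / (z i - z j) =
      ∏ j ∈ univ.erase i, (1 - z j / x) / (1 - z j / z i) := by
  have h1 : (x / z i) ^ (-(m : ℤ)) = ∏ _j ∈ univ.erase i, (z i / x) := by
    rw [Finset.prod_const, Finset.card_erase_of_mem (mem_univ i), Finset.card_univ,
      Fintype.card_fin, Nat.add_sub_cancel, zpow_neg, zpow_natCast, ← inv_pow, inv_div]
  rw [h1, ← Finset.prod_mul_distrib]
  refine Finset.prod_congr rfl fun j _ => ?_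
  have := hz i
  rw [one_sub_div hx, one_sub_div this, div_div_div_eq, div_mul_div_comm, mul_comm (z i) (x - z j)]

/-- Partial fraction expansion used for the eigenvalue of `A`. -/
lemma prod_one_sub_mul_sub_prod {l : Fin m → ℂ} (hl : Function.Injective l) (hl0 : ∀ i, l i ≠ 0)
    (l' : Fin (m + 1) → ℂ) {b : ℂ} (hb : b * ∏ i, -l i = ∏ k, -l' k) {x : ℂ} (hx : x ≠ 0) :
    (∏ i, (1 - l i / x)) * (1 + b / x) - ∏ k, (1 - l' k / x) =
      -(x⁻¹ * ∑ r, (∏ k, (l r - l' k)) * (l r)⁻¹ *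
        ∏ s ∈ univ.erase r, (1 - l s / x) / (l r - l s)) := by
  -- The node 0 joins the `l i` to make both polynomials monic of degree m + 1. By `hb` its term is
  -- b ∏ (x - l i), which replaces the factor x by x + b.
  have hinj : Function.Injective (Fin.cons 0 l : Fin (m + 1) → ℂ) := by
    rw [Fin.cons_injective_iff]
    exact ⟨fun ⟨i, hi⟩ => hl0 i hi, hl⟩
  have h := prod_sub_prod_eq (by simp) hinj l' x
  have he : (univ : Finset (Fin (m + 1))).erase 0 = univ.map ⟨Fin.succ, Fin.succ_injective m⟩ := by
    ext i
    refine Fin.cases ?_ (fun j => ?_) i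
    · simp
    · simp
  have he' (r : Fin m) : (univ : Finset (Fin (m + 1))).erase r.succ =
      insert 0 ((univ.erase r).map ⟨Fin.succ, Fin.succ_injective m⟩) := by
    ext i
    refine Fin.cases ?_ (fun j => ?_) i
    · simp [(Fin.succ_ne_zero r).symm]
    · simp
  rw [Fin.prod_univ_succ, Fin.sum_univ_succ] at h
  simp only [Fin.cons_zero, Fin.cons_succ, he, he', Finset.prod_map, Function.Embedding.coeFn_mk,
    sub_zero, zero_sub] at h
  have h0 : ∏ i, -l i ≠ 0 := Finset.prod_ne_zero_iff.mpr fun i _ => neg_ne_zero.mpr (hl0 i)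
  rw [Finset.prod_div_distrib, ← hb, mul_assoc, mul_div_cancel₀ _ h0] at h
  have hi (r : Fin m) : ∏ i ∈ insert 0 ((univ.erase r).map ⟨Fin.succ, Fin.succ_injective m⟩),
      (x - (Fin.cons 0 l : Fin (m + 1) → ℂ) i) / (l r - (Fin.cons 0 l : Fin (m + 1) → ℂ) i) =
      x / l r * ∏ s ∈ univ.erase r, (x - l s) / (l r - l s) := by
    rw [Finset.prod_insert (by simp [Fin.succ_ne_zero]), Finset.prod_map]
    simp
  simp only [hi] at h
  have e1 : (∏ i, (1 - l i / x)) * (1 + b / x) - ∏ k, (1 - l' k / x) =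
      ((∏ i, (x - l i)) * (x + b) - ∏ k, (x - l' k)) / x ^ (m + 1) := by
    have f1 : ∏ i, (1 - l i / x) = (∏ i, (x - l i)) / x ^ m := by
      simp only [one_sub_div hx, Finset.prod_div_distrib]
      simp
    have f2 : ∏ k, (1 - l' k / x) = (∏ k, (x - l' k)) / x ^ (m + 1) := by
      simp only [one_sub_div hx, Finset.prod_div_distrib]
      simp
    rw [f1, f2]
    field_simp
    ring
  have e2 (r : Fin m) : ∏ s ∈ univ.erase r, (1 - l s / x) / (l r - l s) =
      (∏ s ∈ univ.erase r, (x - l s) / (l r - l s)) * x / x ^ m := by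
    have hm : m = (m - 1) + 1 := by have := r.2; omega
    have f : x / x ^ m = ∏ _s ∈ univ.erase r, x⁻¹ := by
      rw [Finset.prod_const, Finset.card_erase_of_mem (mem_univ r), Finset.card_univ,
        Fintype.card_fin]
      conv_lhs => rw [hm, pow_succ]
      field_simp
      rw [one_div, inv_pow, mul_inv_cancel₀ (pow_ne_zero _ hx)]
    rw [mul_div_assoc, f, ← Finset.prod_mul_distrib]
    refine Finset.prod_congr rfl fun s _ => ?_
    field_simp
  have e3 : (∏ i, (x - l i)) * (x + b) - ∏ k, (x - l' k) =
      -∑ r, (∏ k, (l r - l' k)) * (x / l r * ∏ s ∈ univ.erase r, (x - l s) / (l r - l s)) := by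
    linear_combination h
  rw [e1, e3, neg_div, Finset.sum_div, Finset.mul_sum]
  congr 1
  refine Finset.sum_congr rfl fun r _ => ?_
  rw [e2]
  have := hl0 r
  field_simp
  ring

end ScalarIdentities

section Action

variable {N n : ℕ} [NeZero N] {u v ϰ : ℂ} {amp : (m : ℕ) → Fin m → ℂ}
  {y : (m : ℕ) → Fin m → (m' : ℕ) → Fin m' → ℂ}

/-- The condition on the amplitude products is what supplies hypothesis `hb` of
`prod_one_sub_mul_sub_prod`, with b equal to ϰ times the eigenvalue of v on the last site. -/
lemma IsOpenData.prod_neg_lamB_succ (h : IsOpenData N n v ϰ amp y) {m : ℕ} (hm : m < n)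
    (γ : Fin m → ZMod N) (γ' : Fin (m + 1) → ZMod N) :
    ϰ * v * wpow N (∑ k, γ' k - ∑ l, γ l) * ∏ i, -lamB N m ϰ (amp m) γ i =
      ∏ k, -lamB N (m + 1) ϰ (amp (m + 1)) γ' k := by
  rw [prod_neg_lamB, prod_neg_lamB, h.prod_amp_eq m hm.le, h.prod_amp_eq (m + 1) hm, wpow_sub]
  have := wpow_ne_zero N (∑ l, γ l)
  field_simp
  ring

/-- The recursion in `γ_m` satisfied by the coefficients of `|γ_{m+1}⟩`. -/
lemma muCoef_mul_QOpen_rec (h : IsOpenData N n v ϰ amp y) (hu : u ≠ 0) (hv : v ≠ 0) (hϰ : ϰ ≠ 0)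
    {m : ℕ} (hm : m < n) (γ : Fin m → ZMod N) (γ' : Fin (m + 1) → ZMod N) (r : Fin m) :
    muCoef N amp y m γ * QOpen N amp y m γ γ' *
        ((∏ k, (lamB N m ϰ (amp m) γ r - lamB N (m + 1) ϰ (amp (m + 1)) γ' k)) *
          (lamB N m ϰ (amp m) γ r)⁻¹ /
          ∏ s ∈ univ.erase r, (lamB N m ϰ (amp m) γ r - lamB N m ϰ (amp m) γ s)) =
      -(muCoef N amp y m (γ + Pi.single r 1) * QOpen N amp y m (γ + Pi.single r 1) γ' *
        (v * wpow N (∑ k, γ' k - ∑ l, γ l) * (omega N)⁻¹ * u⁻¹ * hCoef m u y r /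
          ∏ s ∈ univ.erase r,
            (1 - lamB N m ϰ (amp m) γ s / (omega N * lamB N m ϰ (amp m) γ r)))) := by
  have hm1 : 1 ≤ m := Nat.one_le_iff_ne_zero.mpr (by rintro rfl; exact r.elim0)
  have hQ := QOpen_add_single h hϰ hm γ γ' r
  have hM := muCoef_add_single h hϰ hm.le γ r
  have hrec := h.rec_y m hm1 hm r
  have hb := h.prod_neg_lamB_succ hm γ γ'
  have hl0 := fun s => lamB_ne_zero hϰ (h.amp_ne_zero hv hm.le s) γ
  have hl0' := fun s => lamB_ne_zero hϰ (h.amp_ne_zero hv hm s) γ'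
  have p1 : ∏ k, (lamB N m ϰ (amp m) γ r - lamB N (m + 1) ϰ (amp (m + 1)) γ' k) =
      (∏ k, -lamB N (m + 1) ϰ (amp (m + 1)) γ' k) *
        ∏ k, (1 - lamB N m ϰ (amp m) γ r / lamB N (m + 1) ϰ (amp (m + 1)) γ' k) := by
    rw [← Finset.prod_mul_distrib]
    refine Finset.prod_congr rfl fun k _ => ?_
    have := hl0' k
    field_simp
    ring
  have p2 : ∏ s ∈ univ.erase r, (lamB N m ϰ (amp m) γ r - lamB N m ϰ (amp m) γ s) =
      (∏ s ∈ univ.erase r, -lamB N m ϰ (amp m) γ s) *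
        ∏ s ∈ univ.erase r, (1 - lamB N m ϰ (amp m) γ r / lamB N m ϰ (amp m) γ s) := by
    rw [← Finset.prod_mul_distrib]
    refine Finset.prod_congr rfl fun k _ => ?_
    have := hl0 k
    field_simp
    ring
  have p3 := Finset.mul_prod_erase univ (fun s => -lamB N m ϰ (amp m) γ s) (mem_univ r)
  have hF := fun (i j : Fin m) (hij : i ≠ j) => h.fermat_same m hm1 hm.le i j hij
  have n1 : ∏ s ∈ univ.erase r, y m s m r ≠ 0 := Finset.prod_ne_zero_iff.mpr fun s hs =>
    (hF s r (Finset.ne_of_mem_erase hs)).2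
  have n2 : ∏ s ∈ univ.erase r, y m r m s ≠ 0 := Finset.prod_ne_zero_iff.mpr fun s hs =>
    (hF r s (Finset.ne_of_mem_erase hs).symm).2
  have n3 : ∏ k, y m r (m + 1) k ≠ 0 := Finset.prod_ne_zero_iff.mpr fun k _ =>
    (h.fermat_succ m hm1 hm r k).2
  have n4 : ∏ s ∈ univ.erase r, (1 - lamB N m ϰ (amp m) γ r / lamB N m ϰ (amp m) γ s) ≠ 0 :=
    Finset.prod_ne_zero_iff.mpr fun s hs =>
      h.one_sub_ne_zero hϰ hm.le γ γ (Finset.ne_of_mem_erase hs).symm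
  have n5 : ∏ s ∈ univ.erase r,
      (1 - lamB N m ϰ (amp m) γ s / (omega N * lamB N m ϰ (amp m) γ r)) ≠ 0 :=
    Finset.prod_ne_zero_iff.mpr fun s hs => by
      rw [← lamB_add_single_self]
      exact h.one_sub_ne_zero hϰ hm.le γ _ (Finset.ne_of_mem_erase hs)
  have n6 : ∏ s ∈ univ.erase r, -lamB N m ϰ (amp m) γ s ≠ 0 :=
    Finset.prod_ne_zero_iff.mpr fun s _ => neg_ne_zero.mpr (hl0 s)
  -- If this product were 0, the quotient in `rec_y` would be 0 by the convention for division, not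
  -- 1.
  have n7 : ∏ s : Fin (m - 1), y (m - 1) s m r ≠ 0 := by
    intro h0
    rw [h0] at hrec
    simp at hrec
  rw [Finset.prod_div_distrib] at hrec
  rw [p1, p2, ← hb, ← p3, hCoef]
  have hr := hl0 r
  have hω := omega_ne_zero N
  set P1 := ∏ s ∈ univ.erase r, y m s m r
  set P2 := ∏ s ∈ univ.erase r, y m r m s
  set YK := ∏ k, y m r (m + 1) k
  set D1 := ∏ s ∈ univ.erase r, (1 - lamB N m ϰ (amp m) γ r / lamB N m ϰ (amp m) γ s)
  set D2 := ∏ s ∈ univ.erase r,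
      (1 - lamB N m ϰ (amp m) γ s / (omega N * lamB N m ϰ (amp m) γ r))
  set E := ∏ k, (1 - lamB N m ϰ (amp m) γ r / lamB N (m + 1) ϰ (amp (m + 1)) γ' k)
  set G := ∏ s : Fin (m - 1), y (m - 1) s m r
  set S := ∏ s ∈ univ.erase r, -lamB N m ϰ (amp m) γ s
  set W := wpow N (∑ k, γ' k - ∑ l, γ l)
  -- The condition on the y-coordinates is exactly the matching of the constants left by the shifts
  -- of μ and Q with those in the coefficient of B.
  have hrec' : ϰ * P1 * YK = P2 * G := by
    field_simp at hrec
    linear_combination hrec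
  have hM' : muCoef N amp y m (γ + Pi.single r 1) =
      muCoef N amp y m γ * (P2 * D2) / (P1 * D1) := by
    rw [eq_div_iff (mul_ne_zero n1 n4), hM]
  have hQ' : QOpen N amp y m (γ + Pi.single r 1) γ' =
      QOpen N amp y m γ γ' * omega N * E / YK := by
    rw [eq_div_iff n3, hQ]
  rw [hM', hQ']
  field_simp
  linear_combination (-muCoef N amp y m γ * QOpen N amp y m γ γ' * W * E) * hrec'

/-- The shift of `|γ_{m+1}⟩` by `B` at the zeros of the eigenvalue of `A`. -/
lemma Tmat_zero_one_openVec (h : IsOpenData N n v ϰ amp y) (hv : v ≠ 0) (hϰ : ϰ ≠ 0) {m : ℕ}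
    (hm : m < n)
    (hA : ∀ (γ : Fin m → ZMod N) (x : ℂ), x ≠ 0 → Tmat N u v ϰ m x 0 0 (openVec N amp y m γ) =
      (∏ s, (1 - lamB N m ϰ (amp m) γ s / x)) • openVec N amp y m γ)
    (γ' : Fin (m + 1) → ZMod N) (r : Fin (m + 1)) :
    Tmat N u v ϰ (m + 1) (lamB N (m + 1) ϰ (amp (m + 1)) γ' r) 0 1
        (openVec N amp y (m + 1) γ') =
      -(hCoef (m + 1) u y r / lamB N (m + 1) ϰ (amp (m + 1)) γ' r) •
        openVec N amp y (m + 1) (γ' - Pi.single r 1) := by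
  have hl0' := lamB_ne_zero hϰ (h.amp_ne_zero hv hm r) γ'
  rw [openVec_succ, openVec_succ, map_sum, Finset.smul_sum]
  refine Finset.sum_congr rfl fun γ _ => ?_
  rw [Tmat_succ_zero_one, map_smul, LinearMap.smul_apply, Module.End.mul_apply, uOp_tens,
    map_smul, liftEnd_tens, hA γ _ hl0', tens_smul, sum_sub_single, sub_right_comm]
  simp only [smul_smul]
  congr 1
  have hQ := QOpen_sub_single h hϰ hm γ γ' r
  have hh : hCoef (m + 1) u y r = u * ∏ l : Fin m, y m l (m + 1) r := rfl
  rw [hh]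
  linear_combination (-muCoef N amp y m γ * u / lamB N (m + 1) ϰ (amp (m + 1)) γ' r) * hQ

/-- `A` and `B` on the eigenvectors of the open chain. -/
theorem Tmat_openVec_aux (h : IsOpenData N n v ϰ amp y) (hu : u ≠ 0) (hv : v ≠ 0) (hϰ : ϰ ≠ 0) :
    ∀ m, m ≤ n →
      (∀ (γ : Fin m → ZMod N) (x : ℂ), x ≠ 0 → Tmat N u v ϰ m x 0 0 (openVec N amp y m γ) =
        (∏ s, (1 - lamB N m ϰ (amp m) γ s / x)) • openVec N amp y m γ) ∧
      (∀ (γ : Fin m → ZMod N) (x : ℂ), x ≠ 0 → Tmat N u v ϰ m x 0 1 (openVec N amp y m γ) =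
        ∑ r, (-(x⁻¹ * hCoef m u y r * ∏ s ∈ univ.erase r, (1 - lamB N m ϰ (amp m) γ s / x) /
          (1 - lamB N m ϰ (amp m) γ s / lamB N m ϰ (amp m) γ r))) •
            openVec N amp y m (γ - Pi.single r 1))
  | 0, _ => by simp [Tmat_zero]
  | m + 1, hm => by
    obtain ⟨hA, hB⟩ := Tmat_openVec_aux h hu hv hϰ m (by omega)
    have hm' : m < n := hm
    refine ⟨fun γ' x hx => ?_, fun γ' x hx => ?_⟩
    · have hω := omega_ne_zero N
      -- A on m + 1 sites is A times 1 + ϰv/x plus B times u⁻¹v, with A and B on m sites. The first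
      -- part keeps γ and the second lowers one γ_r.
      have e1 : Tmat N u v ϰ (m + 1) x 0 0 (openVec N amp y (m + 1) γ') =
          ∑ γ : Fin m → ZMod N, ((muCoef N amp y m γ * QOpen N amp y m γ γ' *
            ((∏ s, (1 - lamB N m ϰ (amp m) γ s / x)) *
              (1 + ϰ * v * wpow N (∑ k, γ' k - ∑ l, γ l) / x))) •
              tens (openVec N amp y m γ) (∑ k, γ' k - ∑ l, γ l) +
            ∑ r, (muCoef N amp y m γ * QOpen N amp y m γ γ' *
              (v * wpow N (∑ k, γ' k - ∑ l, γ l) * u⁻¹) *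
              (-(x⁻¹ * hCoef m u y r * ∏ s ∈ univ.erase r, (1 - lamB N m ϰ (amp m) γ s / x) /
                (1 - lamB N m ϰ (amp m) γ s / lamB N m ϰ (amp m) γ r)))) •
              tens (openVec N amp y m (γ - Pi.single r 1)) (∑ k, γ' k - ∑ l, γ l + 1)) := by
        rw [openVec_succ, map_sum]
        refine Finset.sum_congr rfl fun γ _ => ?_
        rw [Tmat_succ_apply, map_smul, LinearMap.add_apply, Module.End.mul_apply,
          Module.End.mul_apply]
        have f1 : Lop N (m + 1) u v ϰ x (Fin.last m) 0 0
            (tens (openVec N amp y m γ) (∑ k, γ' k - ∑ l, γ l)) =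
            (1 + ϰ * v * wpow N (∑ k, γ' k - ∑ l, γ l) / x) •
              tens (openVec N amp y m γ) (∑ k, γ' k - ∑ l, γ l) := by
          simp only [Lop, Matrix.of_apply, Matrix.cons_val', Matrix.cons_val_zero,
            LinearMap.add_apply, Module.End.one_apply, LinearMap.smul_apply, vOp_tens, smul_smul,
            add_smul, one_smul]
          congr 2
          ring
        have f2 : Lop N (m + 1) u v ϰ x (Fin.last m) 1 0
            (tens (openVec N amp y m γ) (∑ k, γ' k - ∑ l, γ l)) =
            (v * wpow N (∑ k, γ' k - ∑ l, γ l) * u⁻¹) •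
              tens (openVec N amp y m γ) (∑ k, γ' k - ∑ l, γ l + 1) := by
          have : Lop N (m + 1) u v ϰ x (Fin.last m) 1 0 =
              uInv N (m + 1) u (Fin.last m) * vOp N (m + 1) v (Fin.last m) := rfl
          rw [this, Module.End.mul_apply, vOp_tens, map_smul, uInv_tens, smul_smul]
        rw [f1, f2, map_smul, map_smul, liftEnd_tens, liftEnd_tens, hA γ x hx, hB γ x hx,
          tens_smul, tens_sum, smul_add, Finset.smul_sum, Finset.smul_sum, smul_smul, smul_smul]
        congr 1
        · congr 1; ring
        · refine Finset.sum_congr rfl fun r _ => ?_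
          rw [tens_smul, smul_smul, smul_smul]
      -- Reindexing by γ ↦ γ + e_r returns the shifted vectors to |γ⟩. The recursion then makes
      -- their coefficients terms of a partial fraction expansion.
      have e2 : ∀ r : Fin m, ∑ γ : Fin m → ZMod N, (muCoef N amp y m γ * QOpen N amp y m γ γ' *
              (v * wpow N (∑ k, γ' k - ∑ l, γ l) * u⁻¹) *
              (-(x⁻¹ * hCoef m u y r * ∏ s ∈ univ.erase r, (1 - lamB N m ϰ (amp m) γ s / x) /
                (1 - lamB N m ϰ (amp m) γ s / lamB N m ϰ (amp m) γ r)))) •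
              tens (openVec N amp y m (γ - Pi.single r 1)) (∑ k, γ' k - ∑ l, γ l + 1) =
          ∑ γ : Fin m → ZMod N, (muCoef N amp y m γ * QOpen N amp y m γ γ' *
            (x⁻¹ * ((∏ k, (lamB N m ϰ (amp m) γ r - lamB N (m + 1) ϰ (amp (m + 1)) γ' k)) *
              (lamB N m ϰ (amp m) γ r)⁻¹ * ∏ s ∈ univ.erase r, (1 - lamB N m ϰ (amp m) γ s / x) /
                (lamB N m ϰ (amp m) γ r - lamB N m ϰ (amp m) γ s)))) •
              tens (openVec N amp y m γ) (∑ k, γ' k - ∑ l, γ l) := by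
        intro r
        rw [← Equiv.sum_comp (Equiv.addRight (Pi.single r 1 : Fin m → ZMod N))]
        refine Finset.sum_congr rfl fun γ _ => ?_
        have g1 : ∏ s ∈ univ.erase r, (1 - lamB N m ϰ (amp m) (γ + Pi.single r 1) s / x) /
            (1 - lamB N m ϰ (amp m) (γ + Pi.single r 1) s /
              lamB N m ϰ (amp m) (γ + Pi.single r 1) r) =
            (∏ s ∈ univ.erase r, (1 - lamB N m ϰ (amp m) γ s / x)) / ∏ s ∈ univ.erase r,
              (1 - lamB N m ϰ (amp m) γ s / (omega N * lamB N m ϰ (amp m) γ r)) := by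
          rw [← Finset.prod_div_distrib]
          refine Finset.prod_congr rfl fun s hs => ?_
          rw [lamB_add_single_self, lamB_add_single_of_ne _ _ _ (Finset.ne_of_mem_erase hs)]
        rw [Equiv.coe_addRight, sum_add_single, g1, add_sub_cancel_right,
          show ∑ k, γ' k - (∑ l, γ l + 1) + 1 = ∑ k, γ' k - ∑ l, γ l by ring,
          show ∑ k, γ' k - (∑ l, γ l + 1) = ∑ k, γ' k - ∑ l, γ l - 1 by ring,
          wpow_sub _ 1, wpow_one, Finset.prod_div_distrib]
        congr 1
        have := muCoef_mul_QOpen_rec (u := u) h hu hv hϰ hm' γ γ' r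
        linear_combination (-x⁻¹ * ∏ s ∈ univ.erase r, (1 - lamB N m ϰ (amp m) γ s / x)) * this
      rw [e1, Finset.sum_add_distrib, Finset.sum_comm, Finset.sum_congr rfl fun r _ => e2 r,
        Finset.sum_comm, ← Finset.sum_add_distrib, openVec_succ, Finset.smul_sum]
      refine Finset.sum_congr rfl fun γ _ => ?_
      rw [← Finset.sum_smul, ← add_smul, smul_smul]
      congr 1
      have hb := h.prod_neg_lamB_succ hm' γ γ'
      have := prod_one_sub_mul_sub_prod (h.lamB_injective hv hϰ hm'.le γ)
        (fun s => lamB_ne_zero hϰ (h.amp_ne_zero hv hm'.le s) γ) _ hb hx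
      rw [← Finset.mul_sum, ← Finset.mul_sum]
      linear_combination (muCoef N amp y m γ * QOpen N amp y m γ γ') * this
    · have hz := fun s => lamB_ne_zero hϰ (h.amp_ne_zero hv hm s) γ'
      -- x B(x) is interpolated from the m + 1 zeros of the new eigenvalue of A, where B is a single
      -- shift.
      have hL := (laurentOn_Tmat_zero_one (N := N) u v ϰ m).map
        (LinearMap.applyₗ (openVec N amp y (m + 1) γ'))
      have e := hL.eq_sum (h.lamB_injective hv hϰ hm γ') hz (by simp) hx
      simp only [map_smul, LinearMap.applyₗ_apply_apply] at e
      rw [← inv_smul_smul₀ hx (Tmat N u v ϰ (m + 1) x 0 1 _), e, Finset.smul_sum]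
      refine Finset.sum_congr rfl fun r _ => ?_
      rw [Tmat_zero_one_openVec h hv hϰ hm' hA, interp_coef_eq _ hz hx, smul_smul, smul_smul,
        smul_smul]
      congr 1
      linear_combination (-x⁻¹ * ∏ s ∈ univ.erase r,
        (1 - lamB N (m + 1) ϰ (amp (m + 1)) γ' s / x) / (1 - lamB N (m + 1) ϰ (amp (m + 1)) γ' s /
          lamB N (m + 1) ϰ (amp (m + 1)) γ' r)) *
            mul_div_cancel₀ (hCoef (m + 1) u y r) (hz r)

end Action
end RTC
end
noncomputable section
namespace RTC
open Finset

/-! ### The operator C on the eigenvectors of the open chain -/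

section ActionC

variable {N n : ℕ} {u v ϰ : ℂ} {amp : (m : ℕ) → Fin m → ℂ}
  {y : (m : ℕ) → Fin m → (m' : ℕ) → Fin m' → ℂ}

lemma IsOpenData.hCoef_ne_zero (h : IsOpenData N n v ϰ amp y) (hu : u ≠ 0) {m : ℕ}
    (hm : m < n) (r : Fin (m + 1)) : hCoef (m + 1) u y r ≠ 0 := by
  refine mul_ne_zero hu (Finset.prod_ne_zero_iff.mpr fun (l : Fin m) _ => ?_)
  exact (h.fermat_succ m (Nat.one_le_iff_ne_zero.mpr (by rintro rfl; exact l.elim0)) hm l r).2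

variable [NeZero N]

/-- The eigenvalues of `A` on the open chain. -/
theorem Tmat_zero_zero_openVec (h : IsOpenData N n v ϰ amp y) (hu : u ≠ 0) (hv : v ≠ 0)
    (hϰ : ϰ ≠ 0) {m : ℕ} (hm : m ≤ n) (γ : Fin m → ZMod N) {x : ℂ} (hx : x ≠ 0) :
    Tmat N u v ϰ m x 0 0 (openVec N amp y m γ) =
      (∏ s, (1 - lamB N m ϰ (amp m) γ s / x)) • openVec N amp y m γ :=
  (Tmat_openVec_aux h hu hv hϰ m hm).1 γ x hx

/-- The coefficient of the shift of `|γ_m⟩` by `C`. -/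
def cCoef (N m : ℕ) [NeZero N] (u v ϰ : ℂ) (amp : (m : ℕ) → Fin m → ℂ)
    (y : (m : ℕ) → Fin m → (m' : ℕ) → Fin m' → ℂ) (γ : Fin m → ZMod N) (r : Fin m) : ℂ :=
  lamB N m ϰ (amp m) γ r / hCoef m u y r * (1 / (omega N * lamB N m ϰ (amp m) γ r)) ^ m *
    (v ^ m * wpow N (∑ k, γ k) * omega N)

/-- The quantum determinant at x = λ_r(γ) is applied to |γ + e_r⟩. There A(ωx) vanishes and B(ωx)
returns a nonzero multiple of |γ⟩, so C(x)|γ⟩ is the only unknown left, while the right-hand side is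
diagonal. -/
lemma Tmat_one_zero_openVec_lamB (h : IsOpenData N n v ϰ amp y) (hu : u ≠ 0) (hv : v ≠ 0)
    (hϰ : ϰ ≠ 0) {m : ℕ} (hm : m < n) (γ : Fin (m + 1) → ZMod N) (r : Fin (m + 1)) :
    Tmat N u v ϰ (m + 1) (lamB N (m + 1) ϰ (amp (m + 1)) γ r) 1 0
        (openVec N amp y (m + 1) γ) =
      cCoef N (m + 1) u v ϰ amp y γ r • openVec N amp y (m + 1) (γ + Pi.single r 1) := by
  have hl := lamB_ne_zero hϰ (h.amp_ne_zero hv hm r) γ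
  have hω := omega_ne_zero N
  have hh := h.hCoef_ne_zero hu hm r
  have hq := LinearMap.congr_fun (quantum_det (N := N) u v ϰ _ hu hl (m + 1))
    (openVec N amp y (m + 1) (γ + Pi.single r 1))
  have hB := Tmat_zero_one_openVec (u := u) h hv hϰ hm
    (fun γ x hx => Tmat_zero_zero_openVec h hu hv hϰ hm.le γ hx) (γ + Pi.single r 1) r
  rw [lamB_add_single_self, add_sub_cancel_right] at hB
  have hA : Tmat N u v ϰ (m + 1) (omega N * lamB N (m + 1) ϰ (amp (m + 1)) γ r) 0 0
      (openVec N amp y (m + 1) (γ + Pi.single r 1)) = 0 := by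
    rw [Tmat_zero_zero_openVec h hu hv hϰ hm _ (mul_ne_zero hω hl),
      Finset.prod_eq_zero (mem_univ r), zero_smul]
    rw [lamB_add_single_self, div_self (mul_ne_zero hω hl), sub_self]
  rw [LinearMap.sub_apply, LinearMap.smul_apply, LinearMap.smul_apply, Module.End.mul_apply,
    Module.End.mul_apply, hA, hB, map_zero, map_smul, vTot_openVec, zero_sub, smul_smul,
    smul_smul, ← neg_smul, sum_add_single, wpow_add, wpow_one] at hq
  have e : -(omega N * -(hCoef (m + 1) u y r / (omega N *
      lamB N (m + 1) ϰ (amp (m + 1)) γ r))) ≠ 0 := by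
    rw [mul_neg, neg_neg]
    exact mul_ne_zero hω (div_ne_zero hh (mul_ne_zero hω hl))
  rw [← inv_smul_smul₀ e (Tmat N u v ϰ (m + 1) _ 1 0 _), hq, smul_smul, cCoef]
  congr 1
  field_simp

/-- The action of `C` on the eigenvectors of the open chain. -/
lemma Tmat_one_zero_openVec (h : IsOpenData N n v ϰ amp y) (hu : u ≠ 0) (hv : v ≠ 0)
    (hϰ : ϰ ≠ 0) {m : ℕ} (hm : m < n) (γ : Fin (m + 1) → ZMod N) {x : ℂ} (hx : x ≠ 0) :
    Tmat N u v ϰ (m + 1) x 1 0 (openVec N amp y (m + 1) γ) =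
      ∑ r, ((∏ s ∈ univ.erase r, (1 - lamB N (m + 1) ϰ (amp (m + 1)) γ s / x) /
        (1 - lamB N (m + 1) ϰ (amp (m + 1)) γ s / lamB N (m + 1) ϰ (amp (m + 1)) γ r)) *
          cCoef N (m + 1) u v ϰ amp y γ r) •
        openVec N amp y (m + 1) (γ + Pi.single r 1) := by
  have hz := fun s => lamB_ne_zero hϰ (h.amp_ne_zero hv hm s) γ
  have hL := (laurentOn_Tmat_one (N := N) u v ϰ m 0).map
    (LinearMap.applyₗ (openVec N amp y (m + 1) γ))
  have e := hL.eq_sum (h.lamB_injective hv hϰ hm γ) hz (by simp) hx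
  simp only [LinearMap.applyₗ_apply_apply] at e
  rw [e]
  refine Finset.sum_congr rfl fun r _ => ?_
  rw [Tmat_one_zero_openVec_lamB h hu hv hϰ hm, interp_coef_eq _ hz hx, smul_smul]

end ActionC

/-! ### The eigenvectors of the open chain form a basis -/

section Basis

variable {N n : ℕ} [NeZero N] {u v ϰ : ℂ} {amp : (m : ℕ) → Fin m → ℂ}
  {y : (m : ℕ) → Fin m → (m' : ℕ) → Fin m' → ℂ}

open Polynomial in
/-- Finitely many distinct polynomials take distinct values at some nonzero point. -/
lemma exists_injective_eval {ι : Type*} [Finite ι] {p : ι → ℂ[X]} (hp : Function.Injective p) :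
    ∃ x : ℂ, x ≠ 0 ∧ Function.Injective fun i => (p i).eval x := by
  classical
  cases nonempty_fintype ι
  have h0 : (X * ∏ i, ∏ j ∈ univ.erase i, (p i - p j) : ℂ[X]) ≠ 0 := by
    refine mul_ne_zero X_ne_zero (Finset.prod_ne_zero_iff.mpr fun i _ =>
      Finset.prod_ne_zero_iff.mpr fun j hj => sub_ne_zero.mpr fun e => ?_)
    exact Finset.ne_of_mem_erase hj (hp e.symm)
  obtain ⟨x, hx⟩ : ∃ x : ℂ, (X * ∏ i, ∏ j ∈ univ.erase i, (p i - p j) : ℂ[X]).eval x ≠ 0 := by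
    by_contra! hc
    exact h0 (Polynomial.funext fun x => by rw [hc x, eval_zero])
  rw [eval_mul, eval_X, eval_prod] at hx
  refine ⟨x, left_ne_zero_of_mul hx, fun i j hij => ?_⟩
  by_contra hne
  have h1 := Finset.prod_ne_zero_iff.mp (right_ne_zero_of_mul hx) i (mem_univ i)
  rw [eval_prod] at h1
  have h2 := Finset.prod_ne_zero_iff.mp h1 j (Finset.mem_erase.mpr ⟨Ne.symm hne, mem_univ j⟩)
  rw [eval_sub] at h2
  exact h2 (sub_eq_zero.mpr hij)

open Polynomial in
-- A common root must carry the same index, and then ω^γ determines γ modulo N. Hence the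
-- eigenvalues of A, as functions of x, separate the labels γ.
lemma IsOpenData.prod_X_sub_C_injective (h : IsOpenData N n v ϰ amp y) (hv : v ≠ 0)
    (hϰ : ϰ ≠ 0) {m : ℕ} (hm : m ≤ n) :
    Function.Injective fun γ : Fin m → ZMod N =>
      ∏ s, (X - C (lamB N m ϰ (amp m) γ s)) := by
  intro γ γ' e
  funext s
  by_contra hne
  have e1 := congrArg (eval (lamB N m ϰ (amp m) γ s)) e
  simp only [eval_prod, eval_sub, eval_X, eval_C] at e1
  rw [Finset.prod_eq_zero (mem_univ s) (sub_self _), eq_comm, Finset.prod_eq_zero_iff] at e1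
  obtain ⟨s', -, hs'⟩ := e1
  rw [sub_eq_zero] at hs'
  by_cases hss : s = s'
  · subst hss
    have hc : -ϰ * amp m s ≠ 0 := mul_ne_zero (neg_ne_zero.mpr hϰ) (h.amp_ne_zero hv hm s)
    exact hne (wpow_injective (mul_left_cancel₀ hc hs'))
  · exact h.lamB_ne hv hϰ hm γ γ' hss hs'

lemma linearIndependent_openVec_of_ne_zero (h : IsOpenData N n v ϰ amp y) (hv : v ≠ 0)
    (hϰ : ϰ ≠ 0) {m : ℕ} (hm : m ≤ n) (h0 : ∀ γ, openVec N amp y m γ ≠ 0) :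
    LinearIndependent ℂ (openVec N amp y m) := by
  obtain ⟨x, hx, hinj⟩ := exists_injective_eval (h.prod_X_sub_C_injective hv hϰ hm)
  -- The vectors do not involve u, so the value u = 1 may be used.
  refine Module.End.eigenvectors_linearIndependent' (Tmat N 1 v ϰ m x 0 0)
    (fun γ => ∏ s, (1 - lamB N m ϰ (amp m) γ s / x)) ?_ _ fun γ => ⟨?_, h0 γ⟩
  · intro γ γ' e
    apply hinj
    simp only [one_sub_div hx, Finset.prod_div_distrib] at e
    simp only [Polynomial.eval_prod, Polynomial.eval_sub, Polynomial.eval_X, Polynomial.eval_C]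
    exact (div_left_inj' (Finset.prod_ne_zero_iff.mpr fun _ _ => hx)).mp e
  · exact Module.End.mem_eigenspace_iff.mpr
      (Tmat_zero_zero_openVec h one_ne_zero hv hϰ hm γ hx)

/-- Fixing the label of the last site gives a combination of the shorter vectors, which are
independent by induction. The coefficient at γ = 0 is a nonzero product of values of w_p. -/
lemma openVec_ne_zero (h : IsOpenData N n v ϰ amp y) (hv : v ≠ 0) (hϰ : ϰ ≠ 0) :
    ∀ {m : ℕ}, m ≤ n → ∀ γ, openVec N amp y m γ ≠ 0
  | 0, _, γ => fun e => one_ne_zero (congrFun e 0)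
  | m + 1, hm, γ' => fun e => by
    have hli := linearIndependent_openVec_of_ne_zero h hv hϰ (m := m) (by omega)
      (openVec_ne_zero h hv hϰ (by omega))
    -- The slice at last label ∑ γ'_k selects the γ with ∑ γ_l = 0, among them γ = 0.
    have h1 : ∑ γ : Fin m → ZMod N, (muCoef N amp y m γ * QOpen N amp y m γ γ' *
        if ∑ k, γ' k = ∑ k, γ' k - ∑ l, γ l then 1 else 0) • openVec N amp y m γ = 0 := by
      funext c
      have := congrFun e (Fin.snoc (α := fun _ => ZMod N) c (∑ k, γ' k))
      rw [openVec_succ] at this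
      simp only [Finset.sum_apply, Pi.smul_apply, tens, Fin.init_snoc, Fin.snoc_last,
        smul_eq_mul] at this ⊢
      refine Eq.trans ?_ this
      exact Finset.sum_congr rfl fun γ _ => by ring
    have h2 := Fintype.linearIndependent_iff.mp hli _ h1 0
    simp only [Pi.zero_apply, Finset.sum_const_zero, sub_zero, if_true, mul_one] at h2
    rcases mul_eq_zero.mp h2 with h3 | h3
    · refine Finset.prod_ne_zero_iff.mpr (fun j _ => Finset.prod_ne_zero_iff.mpr fun l hl => ?_) h3
      exact wFun_ne_zero (h.fermat_same m (Nat.one_le_iff_ne_zero.mpr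
        (by rintro rfl; exact j.elim0)) (by omega) j l (Finset.ne_of_mem_erase hl).symm) _
    · refine div_ne_zero (wpow_ne_zero N _) (Finset.prod_ne_zero_iff.mpr fun k _ =>
        Finset.prod_ne_zero_iff.mpr fun l _ => ?_) h3
      exact wFun_ne_zero (h.fermat_succ m (Nat.one_le_iff_ne_zero.mpr
        (by rintro rfl; exact l.elim0)) hm l k) _

lemma span_openVec_eq_top (h : IsOpenData N n v ϰ amp y) (hv : v ≠ 0) (hϰ : ϰ ≠ 0) {m : ℕ}
    (hm : m ≤ n) : Submodule.span ℂ (Set.range (openVec N amp y m)) = ⊤ :=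
  (linearIndependent_openVec_of_ne_zero h hv hϰ hm
    (openVec_ne_zero h hv hϰ hm)).span_eq_top_of_card_eq_finrank' (by simp)

/-- `A(x)` is injective if none of its eigenvalues vanishes. -/
lemma Tmat_zero_zero_injective (h : IsOpenData N n v ϰ amp y) (hu : u ≠ 0) (hv : v ≠ 0)
    (hϰ : ϰ ≠ 0) {m : ℕ} (hm : m ≤ n) {x : ℂ} (hx : x ≠ 0)
    (h0 : ∀ (γ : Fin m → ZMod N) s, 1 - lamB N m ϰ (amp m) γ s / x ≠ 0) :
    Function.Injective (Tmat N u v ϰ m x 0 0) := by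
  refine LinearMap.injective_iff_surjective.mpr (LinearMap.range_eq_top.mp ?_)
  rw [eq_top_iff, ← span_openVec_eq_top h hv hϰ hm, Submodule.span_le]
  rintro _ ⟨γ, rfl⟩
  refine ⟨(∏ s, (1 - lamB N m ϰ (amp m) γ s / x))⁻¹ • openVec N amp y m γ, ?_⟩
  rw [map_smul, Tmat_zero_zero_openVec h hu hv hϰ hm γ hx,
    inv_smul_smul₀ (Finset.prod_ne_zero_iff.mpr fun s _ => h0 γ s)]

end Basis
end RTC
end
noncomputable section
namespace RTC
open Finset

/-! ### The one-boundary chain -/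

/-- Ratio of two products over unordered pairs that differ only in the pairs containing `r`. -/
lemma prod_pairs_mul {n : ℕ} (r : Fin n) (F G : Fin n → Fin n → ℂ) (f g : Fin n → ℂ)
    (h1 : ∀ a b, a ≠ r → b ≠ r → F a b = G a b)
    (h2 : ∀ s, r < s → F r s * g s = G r s * f s)
    (h3 : ∀ s, s < r → F s r * g s = G s r * f s) :
    (∏ a, ∏ b ∈ univ.filter (fun b => a < b), F a b) * ∏ s ∈ univ.erase r, g s =
      (∏ a, ∏ b ∈ univ.filter (fun b => a < b), G a b) * ∏ s ∈ univ.erase r, f s := by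
  have key : ∀ k : Fin n → ℂ, ∏ s ∈ univ.erase r, k s =
      ∏ a, ∏ b ∈ univ.filter (fun b => a < b),
        if a = r then k b else if b = r then k a else 1 := by
    intro k
    rw [← Finset.mul_prod_erase univ _ (mem_univ r)]
    have e1 : ∀ a ∈ univ.erase r, (∏ b ∈ univ.filter (fun b => a < b),
        if a = r then k b else if b = r then k a else 1) = if a < r then k a else 1 := by
      intro a ha
      simp only [if_neg (Finset.ne_of_mem_erase ha)]
      rw [Finset.prod_ite_eq']
      simp
    rw [Finset.prod_congr rfl e1]
    simp only [if_true]
    have e2 : ∏ b ∈ univ.filter (fun b => r < b), k b =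
        ∏ a ∈ univ.erase r, if r < a then k a else 1 := by
      rw [← Finset.prod_filter]
      refine Finset.prod_congr ?_ fun _ _ => rfl
      ext b
      simp only [mem_filter, mem_univ, true_and, mem_erase, and_true]
      exact ⟨fun hb => ⟨hb.ne', hb⟩, fun hb => hb.2⟩
    rw [e2, ← Finset.prod_mul_distrib]
    refine Finset.prod_congr rfl fun a ha => ?_
    rcases lt_or_gt_of_ne (Finset.ne_of_mem_erase ha) with hlt | hlt
    · simp [hlt, hlt.not_gt]
    · simp [hlt, hlt.not_gt]
  rw [key g, key f, ← Finset.prod_mul_distrib, ← Finset.prod_mul_distrib]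
  refine Finset.prod_congr rfl fun a _ => ?_
  rw [← Finset.prod_mul_distrib, ← Finset.prod_mul_distrib]
  refine Finset.prod_congr rfl fun b hb => ?_
  have hab : a < b := (Finset.mem_filter.mp hb).2
  by_cases ha : a = r
  · subst ha
    simpa using h2 b hab
  · by_cases hb' : b = r
    · subst hb'
      simpa [ha] using h3 a hab
    · simp [ha, hb', h1 a b ha hb']

section Boundary

variable {N n : ℕ} [NeZero N] {u v ϰ θ α η : ℂ} {amp : (m : ℕ) → Fin m → ℂ}
  {y : (m : ℕ) → Fin m → (m' : ℕ) → Fin m' → ℂ} {s : Fin n → ℂ} {yB yBt yt : Fin n → Fin n → ℂ}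

lemma mul_div_mul_wpow_add {m : ℕ} (ϰ θ : ℂ) (a b : Fin m → ℂ) (γ γ' : Fin m → ZMod N)
    (i j : Fin m) :
    ϰ ^ 2 * a i * b j / (omega N * θ) * wpow N (γ i + γ' j) =
      lamB N m ϰ a γ i * lamB N m ϰ b γ' j / (omega N * θ) := by
  rw [wpow_add, lamB, lamB]
  ring

lemma lamB_sub_single_self (ϰ : ℂ) {m : ℕ} (a : Fin m → ℂ) (γ : Fin m → ZMod N) (r : Fin m) :
    lamB N m ϰ a (γ - Pi.single r 1) r = lamB N m ϰ a γ r / omega N := by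
  have h := omega_ne_zero N
  rw [eq_div_iff h, mul_comm, ← lamB_add_single_self, sub_add_cancel]

lemma lamB_sub_single_of_ne (ϰ : ℂ) {m : ℕ} (a : Fin m → ℂ) (γ : Fin m → ZMod N) {r s : Fin m}
    (h : s ≠ r) : lamB N m ϰ a (γ - Pi.single r 1) s = lamB N m ϰ a γ s := by
  simp [lamB, h]

/-- The recursion in `γ_n` satisfied by the coefficients of `Ψ_σ`. -/
lemma QBoundary_sub_single (hϰ : ϰ ≠ 0)
    (hb : IsBoundaryData N n u ϰ θ α η amp y s yB yBt yt) (γ σ : Fin n → ZMod N) (r : Fin n) :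
    QBoundary N n ϰ θ amp s yB yBt yt (γ - Pi.single r 1) σ *
      (wpow N (γ r) ^ 2 * (∏ k, yB r k * yBt r k) * ∏ t ∈ univ.erase r,
        ((lamB N n ϰ (amp n) γ r - lamB N n ϰ (amp n) γ t) *
          (1 - lamB N n ϰ (amp n) γ r * lamB N n ϰ (amp n) γ t / (omega N * θ)))) =
    QBoundary N n ϰ θ amp s yB yBt yt γ σ *
      ((∏ k, (1 - lamB N n ϰ (amp n) γ r / lamB N n ϰ s σ k) *
          (1 - lamB N n ϰ (amp n) γ r * lamB N n ϰ s σ k / (omega N * θ))) *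
        ∏ t ∈ univ.erase r,
          ((lamB N n ϰ (amp n) γ r / omega N - lamB N n ϰ (amp n) γ t) * yt r t)) := by
  have hω := omega_ne_zero N
  -- The Gaussian exponent satisfies (γ - 1)² + (γ - 1) + 2γ = γ² + γ, which produces the factor
  -- ω^{2γ_r}.
  have q1 : (∏ t, wpow N ((γ - Pi.single r 1 : Fin n → ZMod N) t ^ 2 +
        (γ - Pi.single r 1 : Fin n → ZMod N) t)) * wpow N (γ r) ^ 2 =
      ∏ t, wpow N (γ t ^ 2 + γ t) := by
    rw [← Finset.mul_prod_erase univ _ (mem_univ r),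
      ← Finset.mul_prod_erase univ (fun t => wpow N (γ t ^ 2 + γ t)) (mem_univ r), mul_right_comm]
    congr 1
    · rw [sq (wpow N (γ r)), ← wpow_add, ← wpow_add]
      congr 1
      simp only [Pi.sub_apply, Pi.single_eq_same]
      ring
    · refine Finset.prod_congr rfl fun t ht => ?_
      simp [Finset.ne_of_mem_erase ht]
  have q2 : (∏ k, ∏ t, wFun N (amp n t / s k) (yB t k)
          ((γ - Pi.single r 1 : Fin n → ZMod N) t - σ k) *
        wFun N (ϰ ^ 2 * amp n t * s k / (omega N * θ)) (yBt t k)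
          ((γ - Pi.single r 1 : Fin n → ZMod N) t + σ k)) * (∏ k, yB r k * yBt r k) =
      (∏ k, ∏ t, wFun N (amp n t / s k) (yB t k) (γ t - σ k) *
        wFun N (ϰ ^ 2 * amp n t * s k / (omega N * θ)) (yBt t k) (γ t + σ k)) *
        ∏ k, (1 - lamB N n ϰ (amp n) γ r / lamB N n ϰ s σ k) *
          (1 - lamB N n ϰ (amp n) γ r * lamB N n ϰ s σ k / (omega N * θ)) := by
    rw [← Finset.prod_mul_distrib, ← Finset.prod_mul_distrib]
    refine Finset.prod_congr rfl fun k _ => ?_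
    rw [← Finset.mul_prod_erase univ _ (mem_univ r),
      ← Finset.mul_prod_erase univ (fun t => wFun N (amp n t / s k) (yB t k) (γ t - σ k) *
        wFun N (ϰ ^ 2 * amp n t * s k / (omega N * θ)) (yBt t k) (γ t + σ k)) (mem_univ r)]
    have e : ∏ t ∈ univ.erase r, wFun N (amp n t / s k) (yB t k)
          ((γ - Pi.single r 1 : Fin n → ZMod N) t - σ k) *
        wFun N (ϰ ^ 2 * amp n t * s k / (omega N * θ)) (yBt t k)
          ((γ - Pi.single r 1 : Fin n → ZMod N) t + σ k) =
      ∏ t ∈ univ.erase r, wFun N (amp n t / s k) (yB t k) (γ t - σ k) *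
        wFun N (ϰ ^ 2 * amp n t * s k / (omega N * θ)) (yBt t k) (γ t + σ k) := by
      refine Finset.prod_congr rfl fun t ht => ?_
      simp [Finset.ne_of_mem_erase ht]
    rw [e, mul_right_comm, mul_right_comm _ _ ((1 - _) * (1 - _))]
    congr 1
    have e1 := wFun_mul_one_sub (hb.fermat_B r k) (γ r - σ k)
    have e2 := wFun_mul_one_sub (hb.fermat_Bt r k) (γ r + σ k)
    rw [div_mul_wpow_sub hϰ] at e1
    rw [mul_div_mul_wpow_add] at e2
    simp only [Pi.sub_apply, Pi.single_eq_same]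
    rw [show γ r - 1 - σ k = γ r - σ k - 1 by ring, show γ r - 1 + σ k = γ r + σ k - 1 by ring]
    linear_combination (-yBt r k * wFun N (ϰ ^ 2 * amp n r * s k / (omega N * θ)) (yBt r k)
      (γ r + σ k - 1)) * e1 - (wFun N (amp n r / s k) (yB r k) (γ r - σ k) *
        (1 - lamB N n ϰ (amp n) γ r / lamB N n ϰ s σ k)) * e2
  -- Only pairs containing r change. They occur as (r, t) or (t, r) according to the order, and
  -- `yt_symm` gives both the same ratio.
  have q3 := prod_pairs_mul r (fun a b => (amp n a * wpow N ((γ - Pi.single r 1 :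
        Fin n → ZMod N) a) - amp n b * wpow N ((γ - Pi.single r 1 : Fin n → ZMod N) b)) /
        wFun N (ϰ ^ 2 * amp n a * amp n b / (omega N * θ)) (yt a b)
          ((γ - Pi.single r 1 : Fin n → ZMod N) a + (γ - Pi.single r 1 : Fin n → ZMod N) b))
    (fun a b => (amp n a * wpow N (γ a) - amp n b * wpow N (γ b)) /
        wFun N (ϰ ^ 2 * amp n a * amp n b / (omega N * θ)) (yt a b) (γ a + γ b))
    (fun t => (lamB N n ϰ (amp n) γ r / omega N - lamB N n ϰ (amp n) γ t) * yt r t)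
    (fun t => (lamB N n ϰ (amp n) γ r - lamB N n ϰ (amp n) γ t) *
          (1 - lamB N n ϰ (amp n) γ r * lamB N n ϰ (amp n) γ t / (omega N * θ)))
    (fun a b ha hb => by simp [ha, hb])
    (fun t ht => by
      have e := wFun_mul_one_sub (hb.fermat_t r t ht.ne) (γ r + γ t)
      have n1 := wFun_ne_zero (hb.fermat_t r t ht.ne) (γ r + γ t)
      have n2 := wFun_ne_zero (hb.fermat_t r t ht.ne) (γ r + γ t - 1)
      rw [mul_div_mul_wpow_add] at e
      simp only [Pi.sub_apply, Pi.single_eq_same, Pi.single_eq_of_ne ht.ne', sub_zero]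
      rw [show γ r - 1 + γ t = γ r + γ t - 1 by ring, wpow_sub, wpow_one, div_mul_eq_mul_div,
        div_mul_eq_mul_div, div_eq_div_iff n2 n1]
      simp only [lamB] at e ⊢
      linear_combination ((amp n r * (wpow N (γ r) / omega N) - amp n t * wpow N (γ t)) *
        (-ϰ * amp n r * wpow N (γ r) - -ϰ * amp n t * wpow N (γ t))) * e)
    (fun t ht => by
      have e := wFun_mul_one_sub (hb.fermat_t t r ht.ne) (γ t + γ r)
      have n1 := wFun_ne_zero (hb.fermat_t t r ht.ne) (γ t + γ r)
      have n2 := wFun_ne_zero (hb.fermat_t t r ht.ne) (γ t + γ r - 1)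
      rw [mul_div_mul_wpow_add] at e
      simp only [Pi.sub_apply, Pi.single_eq_same, Pi.single_eq_of_ne ht.ne, sub_zero]
      rw [show γ t + (γ r - 1) = γ t + γ r - 1 by ring, wpow_sub, wpow_one, div_mul_eq_mul_div,
        div_mul_eq_mul_div, div_eq_div_iff n2 n1, hb.yt_symm r t]
      simp only [lamB] at e ⊢
      linear_combination ((amp n t * wpow N (γ t) - amp n r * (wpow N (γ r) / omega N)) *
        (-ϰ * amp n r * wpow N (γ r) - -ϰ * amp n t * wpow N (γ t))) * e)
  unfold QBoundary
  rw [← q1]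
  have q := congrArg₂ (· * ·) q2 q3
  linear_combination (∏ t, wpow N ((γ - Pi.single r 1 : Fin n → ZMod N) t ^ 2 +
        (γ - Pi.single r 1 : Fin n → ZMod N) t)) * wpow N (γ r) ^ 2 * q

end Boundary
end RTC
end
noncomputable section
namespace RTC
open Finset

/-! ### The boundary recursion in the variable z = 1/x + x/(ωθ) -/

section Eigen

variable {N m : ℕ} {u v ϰ θ α η : ℂ} {amp : (m : ℕ) → Fin m → ℂ}
  {y : (m : ℕ) → Fin m → (m' : ℕ) → Fin m' → ℂ} {s : Fin (m + 1) → ℂ}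
  {yB yBt yt : Fin (m + 1) → Fin (m + 1) → ℂ}

/-- The variable `1/x + x/(ωθ)`, invariant under `x ↦ ωθ/x`. -/
def zB (N : ℕ) (θ x : ℂ) : ℂ := 1 / x + x / (omega N * θ)

/-- The two factors are the two ways in which z can coincide, x = x' and xx' = ωθ. They match the
two kinds of Fermat points in Ψ_σ. -/
lemma zB_sub_zB {x x' : ℂ} (hx : x ≠ 0) (hx' : x' ≠ 0) (hθ : θ ≠ 0) :
    zB N θ x - zB N θ x' = x⁻¹ * ((1 - x / x') * (1 - x * x' / (omega N * θ))) := by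
  have := omega_ne_zero N
  unfold zB
  field_simp
  ring

lemma zB_sub_zB' {x x' : ℂ} (hx : x ≠ 0) (hx' : x' ≠ 0) (hθ : θ ≠ 0) :
    zB N θ x - zB N θ x' =
      x⁻¹ * ((-x')⁻¹ * ((x - x') * (1 - x * x' / (omega N * θ)))) := by
  rw [zB_sub_zB hx hx' hθ]
  field_simp
  ring

/-- The condition `eq_y` without denominators. In particular it removes the integer power ϰ^(n-2),
whose exponent is negative for n = 1. -/
lemma IsBoundaryData.eq_y' (hb : IsBoundaryData N (m + 1) u ϰ θ α η amp y s yB yBt yt)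
    (hϰ : ϰ ≠ 0) (hθ : θ ≠ 0) (r : Fin (m + 1)) :
    η * ϰ ^ 2 * amp (m + 1) r ^ 2 * ∏ r' ∈ univ.erase r, yt r r' =
      α * hCoef (m + 1) u y r * (∏ k, yB r k * yBt r k) *
        (ϰ ^ (m + 1) * omega N ^ (m + 2) * θ) := by
  have h := hb.eq_y r
  have hω := omega_ne_zero N
  rw [← h, zpow_sub₀ hϰ, zpow_natCast, show (2 : ℤ) = ((2 : ℕ) : ℤ) from rfl, zpow_natCast]
  field_simp

variable [NeZero N]

lemma IsBoundaryData.one_sub_ne_zero (hb : IsBoundaryData N (m + 1) u ϰ θ α η amp y s yB yBt yt)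
    (γ : Fin (m + 1) → ZMod N) {r t : Fin (m + 1)} (hrt : r ≠ t) :
    1 - lamB N (m + 1) ϰ (amp (m + 1)) γ r * lamB N (m + 1) ϰ (amp (m + 1)) γ t /
      (omega N * θ) ≠ 0 := by
  rw [← mul_div_mul_wpow_add]
  exact one_sub_mul_wpow_ne_zero (hb.fermat_t r t hrt) _

lemma IsBoundaryData.zB_injective (hb : IsBoundaryData N (m + 1) u ϰ θ α η amp y s yB yBt yt)
    (h : IsOpenData N (m + 1) v ϰ amp y) (hv : v ≠ 0) (hϰ : ϰ ≠ 0) (hθ : θ ≠ 0)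
    (γ : Fin (m + 1) → ZMod N) :
    Function.Injective fun r => zB N θ (lamB N (m + 1) ϰ (amp (m + 1)) γ r) := by
  intro r t e
  by_contra hne
  have hl := fun t => lamB_ne_zero hϰ (h.amp_ne_zero hv le_rfl t) γ
  refine mul_ne_zero (inv_ne_zero (hl r)) (mul_ne_zero (h.one_sub_ne_zero hϰ le_rfl γ γ hne)
    (hb.one_sub_ne_zero γ hne)) ?_
  rw [← zB_sub_zB (hl r) (hl t) hθ]
  exact sub_eq_zero.mpr e

/-- The recursion for the coefficients of `Ψ_σ` in the form needed for the expansion in partial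
fractions. -/
lemma QBoundary_rec (hb : IsBoundaryData N (m + 1) u ϰ θ α η amp y s yB yBt yt)
    (h : IsOpenData N (m + 1) v ϰ amp y) (hu : u ≠ 0) (hv : v ≠ 0) (hϰ : ϰ ≠ 0) (hθ : θ ≠ 0)
    (γ σ : Fin (m + 1) → ZMod N) (r : Fin (m + 1)) :
    -(α * QBoundary N (m + 1) ϰ θ amp s yB yBt yt γ σ *
      ((∏ k, (zB N θ (lamB N (m + 1) ϰ (amp (m + 1)) γ r) -
          zB N θ (lamB N (m + 1) ϰ s σ k))) /
        ∏ t ∈ univ.erase r, (zB N θ (lamB N (m + 1) ϰ (amp (m + 1)) γ r) -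
          zB N θ (lamB N (m + 1) ϰ (amp (m + 1)) γ t)))) =
    QBoundary N (m + 1) ϰ θ amp s yB yBt yt (γ - Pi.single r 1) σ * (η / (omega N * θ)) *
      (cCoef N (m + 1) u v ϰ amp y (γ - Pi.single r 1) r /
        ∏ t ∈ univ.erase r, (1 - omega N * lamB N (m + 1) ϰ (amp (m + 1)) γ t /
          lamB N (m + 1) ϰ (amp (m + 1)) γ r)) := by
  have hω := omega_ne_zero N
  have hl := fun t => lamB_ne_zero hϰ (h.amp_ne_zero hv le_rfl t) γ
  have hL := fun t => lamB_ne_zero hϰ (hb.s_ne_zero t) σ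
  have hh := h.hCoef_ne_zero hu (Nat.lt_succ_self m) r
  have hw := wpow_ne_zero N (γ r)
  have hQ := QBoundary_sub_single hϰ hb γ σ r
  have hy := hb.eq_y' hϰ hθ r
  have hneg := prod_neg_lamB ϰ (amp (m + 1)) γ
  rw [h.prod_amp_eq (m + 1) le_rfl, ← Finset.mul_prod_erase univ _ (mem_univ r)] at hneg
  have hcard : (univ.erase r).card = m := by
    rw [Finset.card_erase_of_mem (mem_univ r), Finset.card_univ, Fintype.card_fin,
      Nat.add_sub_cancel]
  have p1 : ∏ k, (zB N θ (lamB N (m + 1) ϰ (amp (m + 1)) γ r) -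
      zB N θ (lamB N (m + 1) ϰ s σ k)) = ((lamB N (m + 1) ϰ (amp (m + 1)) γ r) ^ (m + 1))⁻¹ *
      ∏ k, (1 - lamB N (m + 1) ϰ (amp (m + 1)) γ r / lamB N (m + 1) ϰ s σ k) *
          (1 - lamB N (m + 1) ϰ (amp (m + 1)) γ r * lamB N (m + 1) ϰ s σ k / (omega N * θ)) := by
    simp only [zB_sub_zB (hl r) (hL _) hθ]
    rw [Finset.prod_mul_distrib, Finset.prod_const, Finset.card_univ, Fintype.card_fin, inv_pow]
  have p2 : ∏ t ∈ univ.erase r, (zB N θ (lamB N (m + 1) ϰ (amp (m + 1)) γ r) -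
      zB N θ (lamB N (m + 1) ϰ (amp (m + 1)) γ t)) =
      ((lamB N (m + 1) ϰ (amp (m + 1)) γ r) ^ m)⁻¹ *
      ((∏ t ∈ univ.erase r, -lamB N (m + 1) ϰ (amp (m + 1)) γ t)⁻¹ *
        ∏ t ∈ univ.erase r, ((lamB N (m + 1) ϰ (amp (m + 1)) γ r -
            lamB N (m + 1) ϰ (amp (m + 1)) γ t) *
          (1 - lamB N (m + 1) ϰ (amp (m + 1)) γ r * lamB N (m + 1) ϰ (amp (m + 1)) γ t /
            (omega N * θ)))) := by
    simp only [zB_sub_zB' (hl r) (hl _) hθ]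
    rw [Finset.prod_mul_distrib, Finset.prod_mul_distrib, Finset.prod_const, hcard, inv_pow,
      Finset.prod_inv_distrib]
  have p3 : ∏ t ∈ univ.erase r, (1 - omega N * lamB N (m + 1) ϰ (amp (m + 1)) γ t /
          lamB N (m + 1) ϰ (amp (m + 1)) γ r) =
      (omega N / lamB N (m + 1) ϰ (amp (m + 1)) γ r) ^ m *
        ∏ t ∈ univ.erase r, (lamB N (m + 1) ϰ (amp (m + 1)) γ r / omega N -
          lamB N (m + 1) ϰ (amp (m + 1)) γ t) := by
    have e : (omega N / lamB N (m + 1) ϰ (amp (m + 1)) γ r) ^ m =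
        ∏ _t ∈ univ.erase r, omega N / lamB N (m + 1) ϰ (amp (m + 1)) γ r := by
      rw [Finset.prod_const, hcard]
    rw [e, ← Finset.prod_mul_distrib]
    refine Finset.prod_congr rfl fun t _ => ?_
    have := hl r
    field_simp
  have n1 : ∏ k, yB r k * yBt r k ≠ 0 := Finset.prod_ne_zero_iff.mpr fun k _ =>
    mul_ne_zero (hb.fermat_B r k).2 (hb.fermat_Bt r k).2
  have n2 : ∏ t ∈ univ.erase r, ((lamB N (m + 1) ϰ (amp (m + 1)) γ r -
        lamB N (m + 1) ϰ (amp (m + 1)) γ t) * (1 - lamB N (m + 1) ϰ (amp (m + 1)) γ r *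
          lamB N (m + 1) ϰ (amp (m + 1)) γ t / (omega N * θ))) ≠ 0 :=
    Finset.prod_ne_zero_iff.mpr fun t ht => mul_ne_zero
      (sub_ne_zero.mpr (h.lamB_ne hv hϰ le_rfl γ γ (Finset.ne_of_mem_erase ht).symm))
      (hb.one_sub_ne_zero γ (Finset.ne_of_mem_erase ht).symm)
  have n3 : ∏ t ∈ univ.erase r, (lamB N (m + 1) ϰ (amp (m + 1)) γ r / omega N -
          lamB N (m + 1) ϰ (amp (m + 1)) γ t) ≠ 0 :=
    Finset.prod_ne_zero_iff.mpr fun t ht => by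
      rw [← lamB_sub_single_self]
      exact sub_ne_zero.mpr (h.lamB_ne hv hϰ le_rfl _ γ (Finset.ne_of_mem_erase ht).symm)
  have n4 : ∏ t ∈ univ.erase r, -lamB N (m + 1) ϰ (amp (m + 1)) γ t ≠ 0 :=
    Finset.prod_ne_zero_iff.mpr fun t _ => neg_ne_zero.mpr (hl t)
  rw [Finset.prod_mul_distrib (f := fun t => lamB N (m + 1) ϰ (amp (m + 1)) γ r / omega N -
    lamB N (m + 1) ϰ (amp (m + 1)) γ t)] at hQ
  rw [p1, p2, p3, cCoef, lamB_sub_single_self, sum_sub_single, wpow_sub, wpow_one]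
  have hr := hl r
  have hlr : lamB N (m + 1) ϰ (amp (m + 1)) γ r ^ 2 =
      ϰ ^ 2 * amp (m + 1) r ^ 2 * wpow N (γ r) ^ 2 := by rw [lamB]; ring
  set l := lamB N (m + 1) ϰ (amp (m + 1)) γ r
  set YB := ∏ k, yB r k * yBt r k
  set YT := ∏ r' ∈ univ.erase r, yt r r'
  set D := ∏ t ∈ univ.erase r, ((l - lamB N (m + 1) ϰ (amp (m + 1)) γ t) *
          (1 - l * lamB N (m + 1) ϰ (amp (m + 1)) γ t / (omega N * θ)))
  set K := ∏ t ∈ univ.erase r, (l / omega N - lamB N (m + 1) ϰ (amp (m + 1)) γ t)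
  set S := ∏ t ∈ univ.erase r, -lamB N (m + 1) ϰ (amp (m + 1)) γ t
  set E := ∏ k, (1 - l / lamB N (m + 1) ϰ s σ k) *
          (1 - l * lamB N (m + 1) ϰ s σ k / (omega N * θ))
  set W := wpow N (γ r)
  set w := wpow N (∑ k, γ k)
  set H := hCoef (m + 1) u y r
  have hQ' : QBoundary N (m + 1) ϰ θ amp s yB yBt yt (γ - Pi.single r 1) σ =
      QBoundary N (m + 1) ϰ θ amp s yB yBt yt γ σ * (E * (K * YT)) / (W ^ 2 * YB * D) := by
    rw [eq_div_iff (mul_ne_zero (mul_ne_zero (pow_ne_zero 2 hw) n1) n2), hQ]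
  -- The product of all -λ_t is fixed by the total label, so omitting the factor at r is division by
  -- -l.
  have hS : S = -(ϰ ^ (m + 1) * v ^ (m + 1) * w) / l := by
    rw [eq_div_iff hr]
    linear_combination -hneg
  -- Multiplication by ω^{2γ_r}, the contribution of the Gaussian factor, turns the squared
  -- amplitude in `eq_y` into λ_r².
  have hη : η * l ^ 2 * YT = α * H * YB * (ϰ ^ (m + 1) * omega N ^ (m + 2) * θ) * W ^ 2 := by
    rw [hlr]
    linear_combination W ^ 2 * hy
  rw [hQ', hS]
  simp only [div_pow, one_div, inv_pow]
  field_simp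
  linear_combination (-QBoundary N (m + 1) ϰ θ amp s yB yBt yt γ σ * E * w) * hη

end Eigen
end RTC
end
-- Action of 𝒜 and 𝒞 on Ψ_σ
noncomputable section
namespace RTC
open Finset

/-- By symmetry under x ↦ ωθ/x, the eigenvalue of A(ωθ/x)A(x) is a polynomial in z(x) with roots
z(λ_t). -/
lemma one_sub_mul_one_sub_eq {N : ℕ} {θ : ℂ} (hθ : θ ≠ 0) {x l : ℂ} (hx : x ≠ 0) (hl : l ≠ 0) :
    (1 - l / x) * (1 - l / (omega N * θ / x)) = -l * (zB N θ x - zB N θ l) := by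
  have := omega_ne_zero N
  unfold zB
  field_simp
  ring

section ActionPsi

variable {N m : ℕ} [NeZero N] {u v ϰ θ α η : ℂ} {amp : (m : ℕ) → Fin m → ℂ}
  {y : (m : ℕ) → Fin m → (m' : ℕ) → Fin m' → ℂ} {s : Fin (m + 1) → ℂ}
  {yB yBt yt : Fin (m + 1) → Fin (m + 1) → ℂ}

/-- The action of `𝒜(x)` on the eigenvectors of the open chain. -/
lemma Umat_zero_zero_openVec (h : IsOpenData N (m + 1) v ϰ amp y) (hu : u ≠ 0) (hv : v ≠ 0)
    (hϰ : ϰ ≠ 0) (hθ : θ ≠ 0) (γ : Fin (m + 1) → ZMod N) {x : ℂ} (hx : x ≠ 0) :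
    Umat N (m + 1) u v ϰ θ α η x 0 0 (openVec N amp y (m + 1) γ) =
      ((omega N * θ) ^ (m + 1) * (θ / x - x)) •
        ((α * (∏ t, (1 - lamB N (m + 1) ϰ (amp (m + 1)) γ t / x) *
            (1 - lamB N (m + 1) ϰ (amp (m + 1)) γ t / (omega N * θ / x))) *
            (v ^ (m + 1) * wpow N (∑ k, γ k))⁻¹) • openVec N amp y (m + 1) γ +
        ∑ r, (η * (lamB N (m + 1) ϰ (amp (m + 1)) γ r / θ) *
          (cCoef N (m + 1) u v ϰ amp y γ r / ∏ t ∈ univ.erase r,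
            (1 - lamB N (m + 1) ϰ (amp (m + 1)) γ t / lamB N (m + 1) ϰ (amp (m + 1)) γ r)) *
          (∏ t ∈ univ.erase r, (1 - lamB N (m + 1) ϰ (amp (m + 1)) γ t / x) *
            (1 - lamB N (m + 1) ϰ (amp (m + 1)) γ t / (omega N * θ / x))) *
          (v ^ (m + 1) * wpow N (∑ k, (γ + Pi.single r 1 : Fin (m + 1) → ZMod N) k))⁻¹) •
            openVec N amp y (m + 1) (γ + Pi.single r 1)) := by
  have hω := omega_ne_zero N
  have hμ : omega N * θ / x ≠ 0 := div_ne_zero (mul_ne_zero hω hθ) hx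
  have hAx := Tmat_zero_zero_openVec (u := u) h hu hv hϰ le_rfl γ hx
  have hAμ := fun γ : Fin (m + 1) → ZMod N => Tmat_zero_zero_openVec (u := u) h hu hv hϰ le_rfl γ hμ
  have hCx := Tmat_one_zero_openVec (u := u) h hu hv hϰ (Nat.lt_succ_self m) γ hx
  have hCμ := Tmat_one_zero_openVec (u := u) h hu hv hϰ (Nat.lt_succ_self m) γ hμ
  have hW := fun γ : Fin (m + 1) → ZMod N => vTotInv_openVec amp y hv (m + 1) γ
  rw [Umat_zero_zero u v ϰ θ α η x hv hθ hx]
  simp only [LinearMap.smul_apply, Module.End.mul_apply, LinearMap.add_apply,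
    LinearMap.sub_apply, hAx, hCx, hCμ, hAμ, map_smul, map_add, map_sum, map_sub, hW]
  rw [mul_smul ((omega N * θ) ^ (m + 1))]
  congr 1
  rw [smul_add]
  congr 1
  · simp only [smul_smul]
    congr 1
    rw [Finset.prod_mul_distrib]
    ring
  · rw [Finset.smul_sum, Finset.smul_sum, ← Finset.sum_sub_distrib, Finset.smul_sum]
    refine Finset.sum_congr rfl fun r _ => ?_
    simp only [smul_smul]
    rw [← sub_smul, smul_smul]
    congr 1
    have e1 : ∏ t, (1 - lamB N (m + 1) ϰ (amp (m + 1)) (γ + Pi.single r 1) t /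
          (omega N * θ / x)) =
        (1 - omega N * lamB N (m + 1) ϰ (amp (m + 1)) γ r / (omega N * θ / x)) *
          ∏ t ∈ univ.erase r, (1 - lamB N (m + 1) ϰ (amp (m + 1)) γ t / (omega N * θ / x)) := by
      rw [← Finset.mul_prod_erase univ _ (mem_univ r), lamB_add_single_self]
      congr 1
      refine Finset.prod_congr rfl fun t ht => ?_
      rw [lamB_add_single_of_ne _ _ _ (Finset.ne_of_mem_erase ht)]
    rw [e1, ← Finset.mul_prod_erase univ (fun t => 1 - lamB N (m + 1) ϰ (amp (m + 1)) γ t / x)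
      (mem_univ r), Finset.prod_mul_distrib, Finset.prod_div_distrib, Finset.prod_div_distrib]
    -- The two products of A and C differ, at the shift by e_r, only in this factor. The difference
    -- is proportional to θ/x - x, the same factor as in the diagonal term.
    have e2 : (1 - omega N * lamB N (m + 1) ϰ (amp (m + 1)) γ r / (omega N * θ / x)) -
        (1 - lamB N (m + 1) ϰ (amp (m + 1)) γ r / x) =
        (θ / x - x) * (lamB N (m + 1) ϰ (amp (m + 1)) γ r / θ) := by
      field_simp
      ring
    linear_combination (η * (v ^ (m + 1) * wpow N (∑ k, (γ + Pi.single r 1 :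
        Fin (m + 1) → ZMod N) k))⁻¹ * (cCoef N (m + 1) u v ϰ amp y γ r / ∏ t ∈ univ.erase r,
          (1 - lamB N (m + 1) ϰ (amp (m + 1)) γ t / lamB N (m + 1) ϰ (amp (m + 1)) γ r)) *
        (∏ t ∈ univ.erase r, (1 - lamB N (m + 1) ϰ (amp (m + 1)) γ t / x)) *
        ∏ t ∈ univ.erase r, (1 - lamB N (m + 1) ϰ (amp (m + 1)) γ t / (omega N * θ / x))) * e2

/-- `𝒜` annihilates `Ψ_σ` at the zeros of its eigenvalue. -/
theorem Umat_zero_zero_Psi (hb : IsBoundaryData N (m + 1) u ϰ θ α η amp y s yB yBt yt)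
    (h : IsOpenData N (m + 1) v ϰ amp y) (hu : u ≠ 0) (hv : v ≠ 0) (hϰ : ϰ ≠ 0) (hθ : θ ≠ 0)
    (σ : Fin (m + 1) → ZMod N) {x : ℂ} (hx : x ≠ 0) (k : Fin (m + 1))
    (hk : zB N θ x = zB N θ (lamB N (m + 1) ϰ s σ k)) :
    Umat N (m + 1) u v ϰ θ α η x 0 0 (Psi N (m + 1) ϰ θ amp y s yB yBt yt σ) = 0 := by
  have hω := omega_ne_zero N
  rw [Psi, map_sum]
  simp only [map_smul, Umat_zero_zero_openVec h hu hv hϰ hθ _ hx]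
  simp only [smul_comm _ ((omega N * θ) ^ (m + 1) * (θ / x - x))]
  rw [← Finset.smul_sum]
  refine smul_eq_zero_of_right _ ?_
  simp only [smul_add, Finset.smul_sum, smul_smul]
  rw [Finset.sum_add_distrib, Finset.sum_comm]
  have e : ∀ r, ∑ γ : Fin (m + 1) → ZMod N, (QBoundary N (m + 1) ϰ θ amp s yB yBt yt γ σ *
        (η * (lamB N (m + 1) ϰ (amp (m + 1)) γ r / θ) *
          (cCoef N (m + 1) u v ϰ amp y γ r / ∏ t ∈ univ.erase r,
            (1 - lamB N (m + 1) ϰ (amp (m + 1)) γ t / lamB N (m + 1) ϰ (amp (m + 1)) γ r)) *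
          (∏ t ∈ univ.erase r, (1 - lamB N (m + 1) ϰ (amp (m + 1)) γ t / x) *
            (1 - lamB N (m + 1) ϰ (amp (m + 1)) γ t / (omega N * θ / x))) *
          (v ^ (m + 1) * wpow N (∑ k, (γ + Pi.single r 1 : Fin (m + 1) → ZMod N) k))⁻¹)) •
            openVec N amp y (m + 1) (γ + Pi.single r 1) =
      ∑ γ : Fin (m + 1) → ZMod N, ((v ^ (m + 1) * wpow N (∑ k, γ k))⁻¹ *
        (α * QBoundary N (m + 1) ϰ θ amp s yB yBt yt γ σ *
          (∏ t, -lamB N (m + 1) ϰ (amp (m + 1)) γ t) *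
        ((∏ k, (zB N θ (lamB N (m + 1) ϰ (amp (m + 1)) γ r) -
          zB N θ (lamB N (m + 1) ϰ s σ k))) *
        ∏ t ∈ univ.erase r, (zB N θ x - zB N θ (lamB N (m + 1) ϰ (amp (m + 1)) γ t)) /
          (zB N θ (lamB N (m + 1) ϰ (amp (m + 1)) γ r) -
            zB N θ (lamB N (m + 1) ϰ (amp (m + 1)) γ t))))) • openVec N amp y (m + 1) γ := by
    intro r
    -- Reindexing by γ ↦ γ - e_r collects all contributions to the same |γ⟩.
    rw [← Equiv.sum_comp (Equiv.subRight (Pi.single r 1 : Fin (m + 1) → ZMod N))]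
    refine Finset.sum_congr rfl fun γ _ => ?_
    have hl := fun t => lamB_ne_zero hϰ (h.amp_ne_zero hv le_rfl t) γ
    simp only [Equiv.subRight_apply, sub_add_cancel]
    congr 1
    have g1 : ∏ t ∈ univ.erase r, (1 - lamB N (m + 1) ϰ (amp (m + 1)) (γ - Pi.single r 1) t /
          lamB N (m + 1) ϰ (amp (m + 1)) (γ - Pi.single r 1) r) =
        ∏ t ∈ univ.erase r, (1 - omega N * lamB N (m + 1) ϰ (amp (m + 1)) γ t /
          lamB N (m + 1) ϰ (amp (m + 1)) γ r) := by
      refine Finset.prod_congr rfl fun t ht => ?_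
      rw [lamB_sub_single_self, lamB_sub_single_of_ne _ _ _ (Finset.ne_of_mem_erase ht),
        div_div_eq_mul_div, mul_comm (omega N)]
    have g2 : ∏ t ∈ univ.erase r, (1 - lamB N (m + 1) ϰ (amp (m + 1)) (γ - Pi.single r 1) t / x) *
          (1 - lamB N (m + 1) ϰ (amp (m + 1)) (γ - Pi.single r 1) t / (omega N * θ / x)) =
        (∏ t ∈ univ.erase r, -lamB N (m + 1) ϰ (amp (m + 1)) γ t) *
          ∏ t ∈ univ.erase r, (zB N θ x - zB N θ (lamB N (m + 1) ϰ (amp (m + 1)) γ t)) := by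
      rw [← Finset.prod_mul_distrib]
      refine Finset.prod_congr rfl fun t ht => ?_
      rw [lamB_sub_single_of_ne _ _ _ (Finset.ne_of_mem_erase ht),
        one_sub_mul_one_sub_eq hθ hx (hl t)]
    rw [g1, g2, lamB_sub_single_self, Finset.prod_div_distrib,
      ← Finset.mul_prod_erase univ (fun t => -lamB N (m + 1) ϰ (amp (m + 1)) γ t) (mem_univ r)]
    have hrec := QBoundary_rec hb h hu hv hϰ hθ γ σ r
    rw [show lamB N (m + 1) ϰ (amp (m + 1)) γ r / omega N / θ =
      lamB N (m + 1) ϰ (amp (m + 1)) γ r / (omega N * θ) from div_div _ _ _]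
    linear_combination (-lamB N (m + 1) ϰ (amp (m + 1)) γ r *
      (∏ t ∈ univ.erase r, -lamB N (m + 1) ϰ (amp (m + 1)) γ t) *
      (∏ t ∈ univ.erase r, (zB N θ x - zB N θ (lamB N (m + 1) ϰ (amp (m + 1)) γ t))) *
      (v ^ (m + 1) * wpow N (∑ k, γ k))⁻¹) * hrec
  rw [Finset.sum_congr rfl fun r _ => e r, Finset.sum_comm, ← Finset.sum_add_distrib]
  refine Finset.sum_eq_zero fun γ _ => ?_
  have hl := fun t => lamB_ne_zero hϰ (h.amp_ne_zero hv le_rfl t) γ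
  rw [← Finset.sum_smul, ← add_smul]
  refine smul_eq_zero_of_left ?_ _
  -- The diagonal and shifted terms add up to a multiple of ∏_k (z(x) - z(λ_k)), which vanishes by
  -- `hk`.
  have hp := prod_sub_prod_eq rfl (hb.zB_injective h hv hϰ hθ γ)
    (fun k => zB N θ (lamB N (m + 1) ϰ s σ k)) (zB N θ x)
  rw [Finset.prod_eq_zero (f := fun k => zB N θ x - zB N θ (lamB N (m + 1) ϰ s σ k))
    (mem_univ k) (sub_eq_zero.mpr hk), sub_zero] at hp
  simp only [one_sub_mul_one_sub_eq hθ hx (hl _)]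
  rw [Finset.prod_mul_distrib, hp, ← Finset.mul_sum, ← Finset.mul_sum]
  ring

/-- The dependence of the coefficients of `Ψ_σ` on `σ`. -/
lemma QBoundary_add_single {n : ℕ} {s : Fin n → ℂ} {yB yBt yt : Fin n → Fin n → ℂ} (hϰ : ϰ ≠ 0)
    (hb : IsBoundaryData N n u ϰ θ α η amp y s yB yBt yt) (γ σ : Fin n → ZMod N) (k : Fin n) :
    QBoundary N n ϰ θ amp s yB yBt yt γ (σ + Pi.single k 1) *
      ((∏ r, yB r k) * ∏ r, (1 - lamB N n ϰ (amp n) γ r * lamB N n ϰ s σ k / θ)) =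
    QBoundary N n ϰ θ amp s yB yBt yt γ σ *
      ((∏ r, yBt r k) * ∏ r, (1 - lamB N n ϰ (amp n) γ r / lamB N n ϰ s σ k)) := by
  have hω := omega_ne_zero N
  unfold QBoundary
  rw [mul_right_comm, mul_right_comm _ _ ((∏ r, yBt r k) * _)]
  congr 1
  rw [mul_assoc, mul_assoc]
  congr 1
  rw [← Finset.mul_prod_erase univ _ (mem_univ k), ← Finset.mul_prod_erase univ
    (fun k => ∏ r, wFun N (amp n r / s k) (yB r k) (γ r - σ k) *
      wFun N (ϰ ^ 2 * amp n r * s k / (omega N * θ)) (yBt r k) (γ r + σ k)) (mem_univ k)]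
  have e : ∏ j ∈ univ.erase k, ∏ r, wFun N (amp n r / s j) (yB r j)
        (γ r - (σ + Pi.single k 1 : Fin n → ZMod N) j) *
      wFun N (ϰ ^ 2 * amp n r * s j / (omega N * θ)) (yBt r j)
        (γ r + (σ + Pi.single k 1 : Fin n → ZMod N) j) =
      ∏ j ∈ univ.erase k, ∏ r, wFun N (amp n r / s j) (yB r j) (γ r - σ j) *
      wFun N (ϰ ^ 2 * amp n r * s j / (omega N * θ)) (yBt r j) (γ r + σ j) := by
    refine Finset.prod_congr rfl fun j hj => ?_
    simp [Finset.ne_of_mem_erase hj]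
  rw [e, mul_right_comm, mul_right_comm _ _ ((∏ r, yBt r k) * _)]
  congr 1
  simp only [← Finset.prod_mul_distrib]
  refine Finset.prod_congr rfl fun r _ => ?_
  have e1 := wFun_mul_one_sub (hb.fermat_B r k) (γ r - σ k)
  have e2 := wFun_mul_one_sub (hb.fermat_Bt r k) (γ r + (σ + Pi.single k 1 : Fin n → ZMod N) k)
  rw [div_mul_wpow_sub hϰ] at e1
  rw [mul_div_mul_wpow_add, lamB_add_single_self, mul_left_comm,
    mul_div_mul_left _ _ hω] at e2
  simp only [Pi.add_apply, Pi.single_eq_same] at e2 ⊢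
  rw [show γ r + (σ k + 1) - 1 = γ r + σ k by ring] at e2
  rw [show γ r - (σ k + 1) = γ r - σ k - 1 by ring]
  linear_combination (wFun N (amp n r / s k) (yB r k) (γ r - σ k - 1) * yB r k) * e2 -
    (yBt r k * wFun N (ϰ ^ 2 * amp n r * s k / (omega N * θ)) (yBt r k) (γ r + σ k)) * e1

lemma Tmat_zero_zero_Psi (h : IsOpenData N (m + 1) v ϰ amp y) (hu : u ≠ 0) (hv : v ≠ 0)
    (hϰ : ϰ ≠ 0) (σ : Fin (m + 1) → ZMod N) {x : ℂ} (hx : x ≠ 0) :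
    Tmat N u v ϰ (m + 1) x 0 0 (Psi N (m + 1) ϰ θ amp y s yB yBt yt σ) =
      ∑ γ : Fin (m + 1) → ZMod N, (QBoundary N (m + 1) ϰ θ amp s yB yBt yt γ σ *
        ∏ t, (1 - lamB N (m + 1) ϰ (amp (m + 1)) γ t / x)) • openVec N amp y (m + 1) γ := by
  rw [Psi, map_sum]
  refine Finset.sum_congr rfl fun γ _ => ?_
  rw [map_smul, Tmat_zero_zero_openVec h hu hv hϰ le_rfl γ hx, smul_smul]

/-- A criterion for `𝒞(x) Ψ_σ` to be a multiple of `Ψ_σ'`. -/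
lemma Cop_Psi_eq (hb : IsBoundaryData N (m + 1) u ϰ θ α η amp y s yB yBt yt)
    (h : IsOpenData N (m + 1) v ϰ amp y) (hu : u ≠ 0) (hv : v ≠ 0) (hϰ : ϰ ≠ 0) (hθ : θ ≠ 0)
    (σ σ' : Fin (m + 1) → ZMod N) {x : ℂ} (hx : x ≠ 0) (k : Fin (m + 1))
    (hk : zB N θ x = zB N θ (lamB N (m + 1) ϰ s σ k))
    (h0 : ∀ (γ : Fin (m + 1) → ZMod N) t,
      1 - lamB N (m + 1) ϰ (amp (m + 1)) γ t / (θ / x) ≠ 0) {c : ℂ}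
    (hc : ∀ γ, c * (QBoundary N (m + 1) ϰ θ amp s yB yBt yt γ σ' *
      ∏ t, (1 - lamB N (m + 1) ϰ (amp (m + 1)) γ t / (θ / x))) =
      η * x ^ (m + 1) * (QBoundary N (m + 1) ϰ θ amp s yB yBt yt γ σ *
        ∏ t, (1 - lamB N (m + 1) ϰ (amp (m + 1)) γ t / x))) :
    Cop N (m + 1) u v ϰ θ α η x (Psi N (m + 1) ϰ θ amp y s yB yBt yt σ) =
      c • Psi N (m + 1) ϰ θ amp y s yB yBt yt σ' := by
  have hκ : θ / x ≠ 0 := div_ne_zero hθ hx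
  -- It suffices to compare both sides after applying A(θ/x). Since 𝒜(x)Ψ_σ = 0, `row_mul_Umat` then
  -- expresses the left side by A(x)Ψ_σ.
  apply Tmat_zero_zero_injective (u := u) h hu hv hϰ le_rfl hκ h0
  have e := LinearMap.congr_fun (row_mul_Umat (N := N) u v ϰ θ α η x hu hv hθ hx (m + 1))
    (Psi N (m + 1) ϰ θ amp y s yB yBt yt σ)
  rw [LinearMap.add_apply, Module.End.mul_apply, Module.End.mul_apply,
    Umat_zero_zero_Psi hb h hu hv hϰ hθ σ hx k hk, map_zero, zero_add, LinearMap.smul_apply] at e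
  rw [Cop, e, map_smul, Tmat_zero_zero_Psi h hu hv hϰ σ hx, Tmat_zero_zero_Psi h hu hv hϰ σ' hκ,
    Finset.smul_sum, Finset.smul_sum]
  refine Finset.sum_congr rfl fun γ _ => ?_
  rw [smul_smul, smul_smul, hc γ]

/-- The action of `𝒞(λ_k)` on `Ψ_σ`. -/
theorem Cop_lamB_Psi (hb : IsBoundaryData N (m + 1) u ϰ θ α η amp y s yB yBt yt)
    (h : IsOpenData N (m + 1) v ϰ amp y) (hu : u ≠ 0) (hv : v ≠ 0) (hϰ : ϰ ≠ 0) (hθ : θ ≠ 0)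
    (σ : Fin (m + 1) → ZMod N) (k : Fin (m + 1)) :
    Cop N (m + 1) u v ϰ θ α η (lamB N (m + 1) ϰ s σ k)
      (Psi N (m + 1) ϰ θ amp y s yB yBt yt σ) =
      (η * fCoef N (m + 1) ϰ s yB yBt σ k) •
        Psi N (m + 1) ϰ θ amp y s yB yBt yt (σ + Pi.single k 1) := by
  have hω := omega_ne_zero N
  have hL := lamB_ne_zero hϰ (hb.s_ne_zero k) σ
  have n1 : ∏ r, yBt r k ≠ 0 := Finset.prod_ne_zero_iff.mpr fun r _ => (hb.fermat_Bt r k).2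
  refine Cop_Psi_eq hb h hu hv hϰ hθ σ _ hL k rfl (fun γ t => ?_) fun γ => ?_
  -- Raising σ_k by one supplies the ω that cancels the one in the denominator ωθ of the Fermat
  -- coordinate.
  · have := one_sub_mul_wpow_ne_zero (hb.fermat_Bt t k)
      (γ t + (σ + Pi.single k 1 : Fin (m + 1) → ZMod N) k)
    rwa [mul_div_mul_wpow_add, lamB_add_single_self, mul_left_comm, mul_div_mul_left _ _ hω,
      ← div_div_eq_mul_div] at this
  · have hq := QBoundary_add_single hϰ hb γ σ k
    simp only [← div_div_eq_mul_div] at hq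
    rw [fCoef, Finset.prod_div_distrib, Finset.prod_mul_distrib, Finset.prod_const,
      Finset.card_univ, Fintype.card_fin]
    rw [mul_div_assoc', div_mul_eq_mul_div, div_eq_iff n1]
    linear_combination (η * lamB N (m + 1) ϰ s σ k ^ (m + 1)) * hq

/-- The action of `𝒞(ωθ/λ_k)` on `Ψ_σ`. -/
theorem Cop_div_lamB_Psi (hb : IsBoundaryData N (m + 1) u ϰ θ α η amp y s yB yBt yt)
    (h : IsOpenData N (m + 1) v ϰ amp y) (hu : u ≠ 0) (hv : v ≠ 0) (hϰ : ϰ ≠ 0) (hθ : θ ≠ 0)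
    (σ : Fin (m + 1) → ZMod N) (k : Fin (m + 1)) :
    Cop N (m + 1) u v ϰ θ α η (omega N * θ / lamB N (m + 1) ϰ s σ k)
      (Psi N (m + 1) ϰ θ amp y s yB yBt yt σ) =
      (η * (omega N * θ) ^ (m + 1) * (fCoef N (m + 1) ϰ s yB yBt σ k)⁻¹) •
        Psi N (m + 1) ϰ θ amp y s yB yBt yt (σ - Pi.single k 1) := by
  have hω := omega_ne_zero N
  have hL := lamB_ne_zero hϰ (hb.s_ne_zero k) σ
  have n1 : ∏ r, yB r k ≠ 0 := Finset.prod_ne_zero_iff.mpr fun r _ => (hb.fermat_B r k).2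
  -- Here θ/x is the zero λ_k of the lowered label σ - e_k, so the points p^B guarantee
  -- invertibility and the σ-recursion is used from σ - e_k to σ.
  have hκ : θ / (omega N * θ / lamB N (m + 1) ϰ s σ k) =
      lamB N (m + 1) ϰ s (σ - Pi.single k 1) k := by
    rw [lamB_sub_single_self]
    field_simp
  refine Cop_Psi_eq hb h hu hv hϰ hθ σ _ (div_ne_zero (mul_ne_zero hω hθ) hL) k ?_
    (fun γ t => ?_) fun γ => ?_
  · unfold zB
    field_simp
    ring
  · rw [hκ, ← div_mul_wpow_sub hϰ]
    exact one_sub_mul_wpow_ne_zero (hb.fermat_B t k) _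
  · have hq := QBoundary_add_single hϰ hb γ (σ - Pi.single k 1) k
    have e (t : Fin (m + 1)) : lamB N (m + 1) ϰ (amp (m + 1)) γ t *
        lamB N (m + 1) ϰ s (σ - Pi.single k 1) k / θ =
        lamB N (m + 1) ϰ (amp (m + 1)) γ t / (omega N * θ / lamB N (m + 1) ϰ s σ k) := by
      rw [lamB_sub_single_self]
      field_simp
    simp only [sub_add_cancel, e] at hq
    rw [hκ, fCoef, Finset.prod_div_distrib, Finset.prod_mul_distrib, Finset.prod_const,
      Finset.card_univ, Fintype.card_fin, inv_div, div_pow, mul_div_assoc', div_mul_eq_mul_div,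
      div_eq_iff (mul_ne_zero (pow_ne_zero _ hL) n1)]
    have e3 : (omega N * θ) ^ (m + 1) / lamB N (m + 1) ϰ s σ k ^ (m + 1) *
        lamB N (m + 1) ϰ s σ k ^ (m + 1) = (omega N * θ) ^ (m + 1) :=
      div_mul_cancel₀ _ (pow_ne_zero _ hL)
    linear_combination (-(η * (omega N * θ) ^ (m + 1))) * hq -
      (η * (QBoundary N (m + 1) ϰ θ amp s yB yBt yt γ σ * ∏ t, (1 - lamB N (m + 1) ϰ
        (amp (m + 1)) γ t / (omega N * θ / lamB N (m + 1) ϰ s σ k))) * ∏ r, yB r k) * e3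

end ActionPsi
end RTC
end
noncomputable section
namespace RTC
open Finset

/-! ### Explicit interpolation in 2n + 2 points -/

section InterpolationFormula

variable {V : Type*} [AddCommGroup V] [Module ℂ V]

/-- A Laurent polynomial with exponents `-n, …, n + 1` is given by `interp`. -/
theorem LaurentOn.eq_interp {N n : ℕ} {θ ρ : ℂ} (hθ : θ ≠ 0) (hρ : ρ ^ 2 = θ) {F : ℂ → V}
    (hF : LaurentOn (-(n : ℤ)) (2 * n + 2) F) {L : Fin n → ℂ} (hL : ∀ k, L k ≠ 0)
    (h1 : ∀ k r, k ≠ r → L k ≠ L r) (h2 : ∀ k r, L k * L r ≠ omega N * θ)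
    (h3 : ∀ k, L k ^ 2 ≠ θ) (h4 : ∀ k, L k ^ 2 ≠ omega N ^ 2 * θ) {x : ℂ} (hx : x ≠ 0) :
    F x = interp N n θ ρ L (fun k => F (L k)) (fun k => F (omega N * θ / L k))
      (fun ε => F (ε * ρ)) x := by
  have hω := omega_ne_zero N
  have hρ0 : ρ ≠ 0 := fun h => hθ (by rw [← hρ, h]; simp)
  have hM : ∀ k, omega N * θ / L k ≠ 0 := fun k => div_ne_zero (mul_ne_zero hω hθ) (hL k)
  have hρn : ρ ≠ -ρ := fun h => hρ0 (by linear_combination h / 2)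
  -- The Boolean chooses within the pairs {λ_k, ωθ/λ_k} and {ρ, -ρ}. Grouping the nodes in these
  -- pairs produces the factors of `interp`.
  let P : Fin n → Bool → ℂ := fun k b => if b then omega N * θ / L k else L k
  let R : Bool → ℂ := fun b => if b then -ρ else ρ
  let z : Fin n × Bool ⊕ Bool → ℂ := Sum.elim (fun p => P p.1 p.2) R
  have hR : ∀ b, R b ^ 2 = θ := by rintro (_ | _) <;> simp [R, hρ]
  have hM2 : ∀ k, (omega N * θ / L k) ^ 2 ≠ θ := fun k h => h4 k (by
    rw [div_pow, div_eq_iff (pow_ne_zero _ (hL k))] at h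
    apply mul_left_cancel₀ hθ
    linear_combination -h)
  have hLM : ∀ k r, L k ≠ omega N * θ / L r := fun k r h => h2 k r (by
    rw [h, div_mul_cancel₀ _ (hL r)])
  have hMM : ∀ k r, omega N * θ / L k = omega N * θ / L r → k = r := fun k r h => by
    by_contra hk
    refine h1 k r hk ?_
    rw [div_eq_div_iff (hL k) (hL r)] at h
    exact (mul_left_cancel₀ (mul_ne_zero hω hθ) h).symm
  have hP2 : ∀ k b, P k b ^ 2 ≠ θ := by
    rintro k (_ | _)
    · simpa [P] using h3 k
    · simpa [P] using hM2 k
  have hz : Function.Injective z := by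
    rintro (⟨k, b⟩ | b) (⟨r, c⟩ | c) h
    · have h : P k b = P r c := h
      have : b = c ∧ k = r := by
        cases b <;> cases c <;> simp [P] at h ⊢
        · by_contra hk
          exact h1 k r hk h
        · exact hLM _ _ h
        · exact hLM _ _ h.symm
        · exact hMM _ _ h
      rw [this.1, this.2]
    · have h : P k b = R c := h
      exact absurd (h ▸ hR c) (hP2 k b)
    · have h : R b = P r c := h
      exact absurd (h ▸ hR b) (hP2 r c)
    · have h : R b = R c := h
      cases b <;> cases c <;> simp [R] at h ⊢
      · exact hρn h
      · exact hρn h.symm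
  have hz0 : ∀ i, z i ≠ 0 := by
    rintro (⟨k, _ | _⟩ | _ | _)
    · simpa [z, P] using hL k
    · simpa [z, P] using ⟨⟨hω, hθ⟩, hL k⟩
    · simpa [z, R] using hρ0
    · simpa [z, R] using hρ0
  have hcard : 2 * n + 2 ≤ Fintype.card (Fin n × Bool ⊕ Bool) := by
    simp [mul_comm]
  have key := hF.eq_sum hz hz0 hcard hx
  have hprod : ∀ f : Fin n × Bool ⊕ Bool → ℂ, ∏ i, f i =
      (∏ k, f (Sum.inl (k, false)) * f (Sum.inl (k, true))) *
        (f (Sum.inr false) * f (Sum.inr true)) := fun f => by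
    simp [Fintype.prod_sum_type, Fintype.prod_prod_type, mul_comm]
  have herase : ∀ (f : Fin n × Bool ⊕ Bool → ℂ) i,
      ∏ j ∈ univ.erase i, f j = ∏ j, Function.update f i 1 j := fun f i => by
    rw [Finset.prod_update_of_mem (mem_univ i), one_mul, Finset.sdiff_singleton_eq_erase]
  have hinl : ∀ (f : Fin n × Bool ⊕ Bool → ℂ) k b, ∏ j ∈ univ.erase (Sum.inl (k, b)), f j =
      (∏ r ∈ univ.erase k, f (Sum.inl (r, false)) * f (Sum.inl (r, true))) *
        f (Sum.inl (k, !b)) * (f (Sum.inr false) * f (Sum.inr true)) := fun f k b => by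
    rw [herase, hprod, ← Finset.prod_erase_mul univ _ (mem_univ k)]
    congr 2
    · refine Finset.prod_congr rfl fun r hr => ?_
      have := Finset.ne_of_mem_erase hr
      simp [this]
    · cases b <;> simp
  have hinr : ∀ (f : Fin n × Bool ⊕ Bool → ℂ) b, ∏ j ∈ univ.erase (Sum.inr b), f j =
      (∏ k, f (Sum.inl (k, false)) * f (Sum.inl (k, true))) * f (Sum.inr !b) := fun f b => by
    rw [herase, hprod]
    cases b <;> simp
  have hpow : ∀ (w : ℂ), w ≠ 0 → (x / w) ^ (-(n : ℤ)) = ∏ _r : Fin n, w / x := fun w hw => by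
    rw [Finset.prod_const, Finset.card_univ, Fintype.card_fin, zpow_neg, zpow_natCast, ← inv_pow,
      inv_div]
  -- Of the n factors w/x, one goes to each pair with r ≠ k and the last to the remaining nodes.
  have hpow' : ∀ (w : ℂ) (k : Fin n), w ≠ 0 →
      (x / w) ^ (-(n : ℤ)) = (∏ _r ∈ univ.erase k, w / x) * (w / x) := fun w k hw => by
    rw [hpow w hw, Finset.prod_erase_mul univ _ (mem_univ k)]
  have n1 : ∀ k r, k ≠ r → L k - L r ≠ 0 := fun k r h => sub_ne_zero.mpr (h1 k r h)
  have n2 : ∀ k r, omega N * θ - L k * L r ≠ 0 := fun k r => sub_ne_zero.mpr (h2 k r).symm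
  have n3 : ∀ k, θ - L k ^ 2 ≠ 0 := fun k => sub_ne_zero.mpr (h3 k).symm
  have n4 : ∀ k, omega N ^ 2 * θ - L k ^ 2 ≠ 0 := fun k => sub_ne_zero.mpr (h4 k).symm
  have hzL : ∀ k, z (Sum.inl (k, false)) = L k := fun _ => rfl
  have hzM : ∀ k, z (Sum.inl (k, true)) = omega N * θ / L k := fun _ => rfl
  have hzR : ∀ b, z (Sum.inr b) = R b := fun _ => rfl
  have hcomb : ∀ a b c d e f g : ℂ, a * c = e → b * d * f = g → a * b * (c * d * f) = e * g := by
    rintro a b c d e f g rfl rfl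
    ring
  have e1 : ∀ w r, (x - omega N * θ / L r) / (w - omega N * θ / L r) =
      (omega N * θ - x * L r) / (omega N * θ - w * L r) := fun w r => by
    rw [← mul_div_mul_right _ _ (neg_ne_zero.mpr (hL r)), sub_mul, sub_mul, mul_neg (omega N * θ / L r),
      div_mul_cancel₀ _ (hL r)]
    congr 1 <;> ring
  have e2 : ∀ w, (x - R false) / (w - R false) * ((x - R true) / (w - R true)) =
      (θ - x ^ 2) / (θ - w ^ 2) := fun w => by
    rw [div_mul_div_comm, ← neg_div_neg_eq, ← hρ]
    congr 1 <;> simp only [R] <;> simp <;> ring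
  have cL : ∀ k, (x / L k) ^ (-(n : ℤ)) *
      ∏ j ∈ univ.erase (Sum.inl (k, false)), (x - z j) / (z (Sum.inl (k, false)) - z j) =
      (∏ r ∈ univ.erase k, L k * (x - L r) * (omega N * θ - x * L r) /
        (x * (L k - L r) * (omega N * θ - L k * L r))) *
        ((θ - x ^ 2) / x * (L k / (omega N * θ - L k ^ 2)) *
          ((omega N * θ - x * L k) / (θ - L k ^ 2))) := fun k => by
    rw [hinl, hpow' _ k (hL k)]
    simp only [Bool.not_false, hzL, hzM, hzR, e1, e2]
    refine hcomb _ _ _ _ _ _ _ ?_ ?_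
    · rw [← Finset.prod_mul_distrib]
      refine Finset.prod_congr rfl fun r _ => ?_
      rw [div_mul_div_comm, div_mul_div_comm]
      congr 1 <;> ring
    · rw [div_mul_div_comm, div_mul_div_comm, div_mul_div_comm, div_mul_div_comm]
      congr 1 <;> ring
  have cM : ∀ k, (x / (omega N * θ / L k)) ^ (-(n : ℤ)) *
      ∏ j ∈ univ.erase (Sum.inl (k, true)), (x - z j) / (z (Sum.inl (k, true)) - z j) =
      (∏ r ∈ univ.erase k, L k * (x - L r) * (omega N * θ - x * L r) /
        (x * (L k - L r) * (omega N * θ - L k * L r))) *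
        -((θ - x ^ 2) / x * (L k / (omega N * θ - L k ^ 2)) *
          (omega N * L k * (x - L k) / (omega N ^ 2 * θ - L k ^ 2))) := fun k => by
    rw [hinl, hpow' _ k (hM k)]
    simp only [Bool.not_true, hzL, hzM, hzR, e1, e2]
    have m1 : ∀ r, omega N * θ / L k - L r = (omega N * θ - L k * L r) / L k := fun r => by
      have := hL k
      field_simp
    refine hcomb _ _ _ _ _ _ _ ?_ ?_
    · rw [← Finset.prod_mul_distrib]
      refine Finset.prod_congr rfl fun r hr => ?_
      have m2 : omega N * θ - omega N * θ / L k * L r = omega N * θ * (L k - L r) / L k := by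
        have := hL k
        field_simp
      have := hL k
      have := n1 k r (Finset.ne_of_mem_erase hr).symm
      have := n2 k r
      rw [m1, m2]
      field_simp
    · have m2 : θ - (omega N * θ / L k) ^ 2 =
          -(θ * (omega N ^ 2 * θ - L k ^ 2)) / L k ^ 2 := by
        have := hL k
        field_simp
        ring
      have := hL k
      have q := n2 k k
      have := n4 k
      rw [← sq] at q
      rw [m1, m2, ← sq]
      field_simp
  -- The opposite root contributes (x + R b)/(2 R b) = (1 + R b x/θ)/2, the source of the
  -- coefficient 1/2.
  have cR : ∀ b, (x / R b) ^ (-(n : ℤ)) *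
      ∏ j ∈ univ.erase (Sum.inr b), (x - z j) / (z (Sum.inr b) - z j) =
      (1 / 2) * ((∏ r, (x - L r) * (omega N * θ - x * L r) /
        (x * (R b - L r) * (omega N * R b - L r))) * (1 + R b * x / θ)) := fun b => by
    have hw : R b ≠ 0 := hz0 (Sum.inr b)
    rw [hinr, hpow _ hw, ← mul_assoc, ← Finset.prod_mul_distrib, mul_left_comm]
    congr 1
    · refine Finset.prod_congr rfl fun r _ => ?_
      simp only [hzL, hzM, hzR, e1]
      have : omega N * θ - R b * L r = R b * (omega N * R b - L r) := by
        rw [← hR b]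
        ring
      rw [this, div_mul_div_comm, div_mul_div_comm]
      conv_rhs => rw [← mul_div_mul_left _ _ hw]
      congr 1 <;> ring
    · have h' : z (Sum.inr !b) = -R b := by cases b <;> simp [z, R]
      rw [h', hzR, ← hR b]
      field_simp
      ring
  have hs : (1 : ℂ) ≠ -1 := by norm_num
  rw [key, Fintype.sum_sum_type, Fintype.sum_prod_type, interp, Finset.sum_pair hs]
  congr 1
  · rw [Finset.smul_sum]
    refine Finset.sum_congr rfl fun k _ => ?_
    rw [Fintype.sum_bool, hzL, hzM]
    have a1 := cL k
    have a2 := cM k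
    rw [hzL] at a1
    rw [hzM] at a2
    rw [a1, a2]
    module
  · rw [Fintype.sum_bool]
    have a1 := cR true
    have a2 := cR false
    have e1 : z (Sum.inr true) = -ρ := rfl
    have e2 : z (Sum.inr false) = ρ := rfl
    rw [e1] at a1 ⊢
    rw [e2] at a2 ⊢
    have r1 : R true = -ρ := rfl
    have r2 : R false = ρ := rfl
    rw [r1] at a1
    rw [r2] at a2
    rw [a1, a2]
    have q1 : 1 + ρ * x / θ = 1 + 1 * x / ρ := by rw [← hρ]; field_simp
    have q2 : 1 + -ρ * x / θ = 1 + -1 * x / ρ := by rw [← hρ]; field_simp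
    rw [q1, q2]
    simp only [one_mul, mul_one, mul_neg, neg_mul]
    module

end InterpolationFormula
lemma Cop_of_sq_eq {N n : ℕ} [NeZero N] {u v ϰ θ α η ρ : ℂ} (hu : u ≠ 0) (hv : v ≠ 0)
    (hθ : θ ≠ 0) (hρ : ρ ^ 2 = θ) (f : States N n) :
    Cop N n u v ϰ θ α η ρ f = (η * ρ ^ n) • f := by
  have hρ0 : ρ ≠ 0 := fun h => hθ (by rw [← hρ, h]; simp)
  rw [Cop, Umat_of_sq_eq u v ϰ θ α η ρ hu hv hρ0 hρ]
  simp

end RTC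
end

/-! ### The theorem -/

theorem mainTheorem3 (N n : ℕ) [NeZero N] (hN : 2 ≤ N) (hn : 1 ≤ n)
    (u v ϰ θ α η : ℂ) (hu : u ≠ 0) (hv : v ≠ 0) (hϰ : ϰ ≠ 0) (hθ : θ ≠ 0)
    (ρ : ℂ) (hρ : ρ ^ 2 = θ)
    (amp : (m : ℕ) → Fin m → ℂ) (y : (m : ℕ) → Fin m → (m' : ℕ) → Fin m' → ℂ)
    (hopen : RTC.IsOpenData N n v ϰ amp y)
    (s : Fin n → ℂ) (yB yBt yt : Fin n → Fin n → ℂ)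
    (hbdry : RTC.IsBoundaryData N n u ϰ θ α η amp y s yB yBt yt)
    (σ : Fin n → ZMod N) :
    let C : ℂ → Module.End ℂ (RTC.States N n) := RTC.Cop N n u v ϰ θ α η
    let Ψ : (Fin n → ZMod N) → RTC.States N n := RTC.Psi N n ϰ θ amp y s yB yBt yt
    let L : Fin n → ℂ := RTC.lamB N n ϰ s σ
    let f : Fin n → ℂ := RTC.fCoef N n ϰ s yB yBt σ
    let ω : ℂ := RTC.omega N
    -- the action at the points `λ_k` and `ωθ / λ_k`
    (∀ k, C (L k) (Ψ σ) = (η * f k) • Ψ (σ + Pi.single k 1)) ∧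
    (∀ k, C (ω * θ / L k) (Ψ σ) = (η * (ω * θ) ^ n * (f k)⁻¹) • Ψ (σ - Pi.single k 1)) ∧
    -- the action at the points `±√θ`
    C ρ (Ψ σ) = (η * ρ ^ n) • Ψ σ ∧
    C (-ρ) (Ψ σ) = (η * (-ρ) ^ n) • Ψ σ ∧
    -- `C` is a Laurent polynomial with exponents between `-n` and `n + 1`
    (∃ c : Fin (2 * n + 2) → Module.End ℂ (RTC.States N n), ∀ lam : ℂ, lam ≠ 0 →
      C lam = ∑ j : Fin (2 * n + 2), lam ^ (((j : ℕ) : ℤ) - (n : ℤ)) • c j) ∧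
    -- interpolation in `2n + 2` points, assumed pairwise distinct
    ((∀ k r, k ≠ r → L k ≠ L r) → (∀ k r, L k * L r ≠ ω * θ) →
      (∀ k, L k ^ 2 ≠ θ) → (∀ k, L k ^ 2 ≠ ω ^ 2 * θ) →
      ∀ lam : ℂ, lam ≠ 0 →
        C lam (Ψ σ) = RTC.interp N n θ ρ L (fun k => C (L k) (Ψ σ))
          (fun k => C (ω * θ / L k) (Ψ σ)) (fun ε => C (ε * ρ) (Ψ σ)) lam ∧
        C lam (Ψ σ) = RTC.interp N n θ ρ L (fun k => (η * f k) • Ψ (σ + Pi.single k 1))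
          (fun k => (η * (ω * θ) ^ n * (f k)⁻¹) • Ψ (σ - Pi.single k 1))
          (fun ε => (η * (ε * ρ) ^ n) • Ψ σ) lam) := by
  have hω := RTC.omega_ne_zero N
  obtain ⟨m, rfl⟩ : ∃ m, n = m + 1 := ⟨n - 1, by omega⟩
  intro C Ψ L f ω
  have i1 : ∀ k, C (L k) (Ψ σ) = (η * f k) • Ψ (σ + Pi.single k 1) := fun k =>
    RTC.Cop_lamB_Psi hbdry hopen hu hv hϰ hθ σ k
  have i2 : ∀ k, C (ω * θ / L k) (Ψ σ) =
      (η * (ω * θ) ^ (m + 1) * (f k)⁻¹) • Ψ (σ - Pi.single k 1) := fun k =>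
    RTC.Cop_div_lamB_Psi hbdry hopen hu hv hϰ hθ σ k
  have i3 : C ρ (Ψ σ) = (η * ρ ^ (m + 1)) • Ψ σ := RTC.Cop_of_sq_eq hu hv hθ hρ _
  have i4 : C (-ρ) (Ψ σ) = (η * (-ρ) ^ (m + 1)) • Ψ σ :=
    RTC.Cop_of_sq_eq hu hv hθ (by rw [neg_sq, hρ]) _
  refine ⟨i1, i2, i3, i4, ?_, fun h1 h2 h3 h4 x hx => ?_⟩
  · obtain ⟨c, hc⟩ := RTC.laurentOn_Cop (N := N) u v ϰ θ α η m
    refine ⟨fun j => c j, fun x hx => ?_⟩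
    rw [show C x = _ from hc x hx, Finset.sum_range]
    refine Finset.sum_congr rfl fun j _ => ?_
    rw [neg_add_eq_sub]
  · have e : C x (Ψ σ) = RTC.interp N (m + 1) θ ρ L (fun k => C (L k) (Ψ σ))
        (fun k => C (ω * θ / L k) (Ψ σ)) (fun ε => C (ε * ρ) (Ψ σ)) x :=
      ((RTC.laurentOn_Cop (N := N) u v ϰ θ α η m).map (LinearMap.applyₗ (Ψ σ))).eq_interp hθ hρ
        (fun k => RTC.lamB_ne_zero hϰ (hbdry.s_ne_zero k) σ) h1 h2 h3 h4 hx
    refine ⟨e, e.trans ?_⟩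
    have hs : (1 : ℂ) ≠ -1 := by norm_num
    simp only [RTC.interp, Finset.sum_pair hs, i1, i2, one_mul, neg_one_mul, i3, i4]
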